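/- **Theorem (stochastic OGDA/EG, nonconvex-concave).** Let $\ell,G,D,\epsilon>0$, $\sigma\ge 0$. Let $\mathcal Y\subset\mathbb R^n$ be a nonempty closed bounded convex set of diameter at most $D$, and let $f:\mathbb R^m\times\mathcal Y\to\mathbb R$ be differentiable with $\ell$-smooth joint dependence, $\|\nabla f(x_1,y_1)-\nabla f(x_2,y_2)\|^2\le \ell^2\|x_1-x_2\|^2+\ell^2\|y_1-y_2\|^2$, with $f(\cdot,y)$ $G$-Lipschitz and $f(x,\cdot)$ concave. Put $\Phi(x)=\max_{y\in\mathcal Y}f(x,y)$, $\Phi_{1/2\ell}(x)=\min_{x'}\{\Phi(x')+\ell\|x'-x\|^2\}$, assume that $\Phi_{1/2\ell}$ is bounded below, and put $\hat\Delta_\Phi=\Phi_{1/2\ell}(x_0)-\inf_x\Phi_{1/2\ell}(x)$. The stochastic oracles are unbiased, $\mathbb E\,\nabla_xf(x,y,\xi^x)=\nabla_xf(x,y)$ and $\mathbb E\,\nabla_yf(x,y,\xi^y)=\nabla_yf(x,y)$, each with variance at most $\sigma^2$; $g_{x,t},g_{y,t}$ denote their values at $(x_t,y_t)$ with fresh samples,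 independent of all samples used at other indices. Let $x_0\in\mathbb R^m$, $y_0\in\mathcal Y$. Stochastic OGDA (with $x_{-1}=x_0$, $y_{-1}=y_0$) is $$x_{t+1}=x_t-\eta_xg_{x,t}-\eta_x(g_{x,t}-g_{x,t-1}),\qquad y_{t+1}=\mathcal P_{\mathcal Y}\big(y_t+\eta_yg_{y,t}+\eta_y(g_{y,t}-g_{y,t-1})\big),$$ and stochastic EG (with $x_{-1/2}=x_0$) is $$x_{t+1/2}=x_t-\eta_xg_{x,t},\quad y_{t+1/2}=\mathcal P_{\mathcal Y}(y_t+\eta_yg_{y,t}),\quad x_{t+1}=x_t-\eta_xg_{x,t+1/2},\quad y_{t+1}=\mathcal P_{\mathcal Y}(y_t+\eta_yg_{y,t+1/2}).$$ Take $$\eta_x=c_x\min\Big\{\tfrac{\epsilon^2}{\ell(G^2+\sigma^2)},\tfrac{\epsilon^4}{D^2\ell^3G\sqrt{G^2+\sigma^2}},\tfrac{\epsilon^6}{D^2\ell^3\sigma^2G\sqrt{G^2+\sigma^2}}\Big\},\qquad \eta_y=c_y\min\Big\{\tfrac1{4\ell},\tfrac{\epsilon^2}{\ell\sigma^2}\Big\}$$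 (entries with $\sigma^2$ as a factor of the denominator are $+\infty$ if $\sigma=0$), where $c_y>0$ is any sufficiently small absolute constant and $c_x>0$ any constant that is sufficiently small in terms of $c_y$ only. Then $\Phi_{1/2\ell}$ is differentiable, and there is a constant $C$ depending only on $c_x,c_y$ such that for each of the two algorithms there is a $T_0$ for which * for all $T\ge T_0$: $\frac1{T+1}\sum_{t=0}^T\mathbb E\|\nabla\Phi_{1/2\ell}(x_t)\|^2\le\epsilon^2$ for OGDA, and $\frac1{T+1}\sum_{t=0}^T\mathbb E\|\nabla\Phi_{1/2\ell}(x_{t-1/2})\|^2\le\epsilon^2$ for EG; * the number of stochastic gradient evaluations needed to produce these points up to $T=T_0$ is at most $$C\,\frac{D^2\ell^3G\sqrt{G^2+\sigma^2}\,\hat\Delta_\Phi}{\epsilon^6}\max\Big\{1,\frac{\sigma^2}{\epsilon^2}\Big\}$$ whenever $\epsilon^2\sqrt{G^2+\sigma^2}\le D^2\ell^2G\max\{1,\sigma^2/\epsilon^2\}$ (in particular for all sufficiently small $\epsilon$), and, for every $\epsilon>0$, at most $C$ times the maximum of $\frac{D^2\ell^3G\sqrt{G^2+\sigma^2}\,\hat\Delta_\Phi}{\epsilon^6}\max\{1,\frac{\sigma^2}{\epsilon^2}\}$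 and $\frac{\ell(G^2+\sigma^2)\hat\Delta_\Phi}{\epsilon^4}$. -/

import Mathlib

open MeasureTheory ProbabilityTheory

noncomputable section

namespace NCC

/-! ### The minimax problem -/

/-- The primal function `Φ(x) = max_{y ∈ Y} f(x, y)`. -/
def primal {E F : Type*} (Y : Set F) (f : E → F → ℝ) (x : E) : ℝ :=
  ⨆ y : Y, f x y

/-- The `p`-Moreau envelope `Φ_p(x) = min_{x'} { Φ(x') + ‖x' - x‖² / (2p) }`. -/
def moreau {E : Type*} [NormedAddCommGroup E] (p : ℝ) (Φ : E → ℝ) (x : E) : ℝ :=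
  ⨅ x' : E, (Φ x' + 1 / (2 * p) * ‖x' - x‖ ^ 2)

/-- The function `Φ_{1/(2ℓ)}` that measures stationarity. -/
def envelope {E F : Type*} [NormedAddCommGroup E] (Y : Set F) (f : E → F → ℝ) (ℓ : ℝ) : E → ℝ :=
  moreau (1 / (2 * ℓ)) (primal Y f)

/-- The initial gap `Φ_{1/(2ℓ)}(x₀) - min_x Φ_{1/(2ℓ)}(x)`. -/
def initialGap {E F : Type*} [NormedAddCommGroup E] (Y : Set F) (f : E → F → ℝ) (ℓ : ℝ)
    (x₀ : E) : ℝ :=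
  envelope Y f ℓ x₀ - ⨅ x : E, envelope Y f ℓ x

/-- The nonconvex-concave assumptions on `f : E × Y → ℝ`, with partial gradients
`fx = ∇ₓf` and `fy = ∇_y f`: `Y` is a nonempty closed bounded convex set of diameter at most `D`,
`f` is differentiable on `E × Y` (relative to `E × Y`, so `Y` may have boundary points or an
empty interior) with jointly `ℓ`-Lipschitz gradient, `f(·, y)` is `G`-Lipschitz, and `f(x, ·)` is
concave on `Y`. Values of `f`, `fx`, `fy` at `y ∉ Y` play no role. -/
structure IsNonconvexConcave {E F : Type*} [NormedAddCommGroup E] [InnerProductSpace ℝ E]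
    [NormedAddCommGroup F] [InnerProductSpace ℝ F]
    (Y : Set F) (f : E → F → ℝ) (fx : E → F → E) (fy : E → F → F) (ℓ G D : ℝ) : Prop where
  nonempty : Y.Nonempty
  isClosed : IsClosed Y
  convex : Convex ℝ Y
  isBounded : Bornology.IsBounded Y
  diam_le : Metric.diam Y ≤ D
  hasGradient : ∀ x, ∀ y ∈ Y,
    HasFDerivWithinAt (fun z : E × F => f z.1 z.2)
      ((innerSL ℝ (fx x y)).coprod (innerSL ℝ (fy x y))) (Set.univ ×ˢ Y) (x, y)
  smooth : ∀ x₁ x₂, ∀ y₁ ∈ Y, ∀ y₂ ∈ Y,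
    ‖fx x₁ y₁ - fx x₂ y₂‖ ^ 2 + ‖fy x₁ y₁ - fy x₂ y₂‖ ^ 2
      ≤ ℓ ^ 2 * ‖x₁ - x₂‖ ^ 2 + ℓ ^ 2 * ‖y₁ - y₂‖ ^ 2
  lipschitz : ∀ x₁ x₂, ∀ y ∈ Y, |f x₁ y - f x₂ y| ≤ G * ‖x₁ - x₂‖
  concave : ∀ x, ConcaveOn ℝ Y (f x)

/-! ### The stochastic gradient oracle -/

/-- `g x y ξ`, with `ξ ∼ ν`, is an unbiased estimator of the vector field `h x y` at every
`(x, y) ∈ E × Y`, with variance at most `σ²`. -/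
structure IsUnbiasedOracle {E F V Ξ : Type*} [MeasurableSpace E] [MeasurableSpace F]
    [NormedAddCommGroup V] [NormedSpace ℝ V] [MeasurableSpace V] [MeasurableSpace Ξ]
    (Y : Set F) (h : E → F → V) (ν : Measure Ξ) (g : E → F → Ξ → V) (σ : ℝ) : Prop where
  measurable : Measurable fun q : E × F × Ξ => g q.1 q.2.1 q.2.2
  unbiased : ∀ x, ∀ y ∈ Y, ∫ ξ, g x y ξ ∂ν = h x y
  integrable : ∀ x, ∀ y ∈ Y, Integrable (fun ξ => ‖g x y ξ - h x y‖ ^ 2) ν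
  variance_le : ∀ x, ∀ y ∈ Y, ∫ ξ, ‖g x y ξ - h x y‖ ^ 2 ∂ν ≤ σ ^ 2

/-- The samples drawn by the algorithm: `ξx k ∼ νx`, `ξy k ∼ νy`, and the pairs `(ξx k, ξy k)`
are independent for different `k` (within a pair, any dependence is allowed). -/
structure IsSampling {Ω Ξx Ξy : Type*} [MeasurableSpace Ω] [MeasurableSpace Ξx]
    [MeasurableSpace Ξy] (P : Measure Ω) (νx : Measure Ξx) (νy : Measure Ξy)
    (ξx : ℕ → Ω → Ξx) (ξy : ℕ → Ω → Ξy) : Prop where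
  measurable_x : ∀ k, Measurable (ξx k)
  measurable_y : ∀ k, Measurable (ξy k)
  law_x : ∀ k, P.map (ξx k) = νx
  law_y : ∀ k, P.map (ξy k) = νy
  indep : iIndepFun (fun k ω => (ξx k ω, ξy k ω)) P

/-! ### The algorithms -/

/-- The Euclidean projection onto `Y`. -/
def proj {F : Type*} [NormedAddCommGroup F] (Y : Set F) (u : F) : F :=
  Classical.epsilon fun p => p ∈ Y ∧ ‖u - p‖ = ⨅ w : Y, ‖u - w‖

theorem proj_spec {F : Type*} [NormedAddCommGroup F] [InnerProductSpace ℝ F]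
    [FiniteDimensional ℝ F] {Y : Set F} (hne : Y.Nonempty) (hcl : IsClosed Y)
    (hcv : Convex ℝ Y) (u : F) :
    proj Y u ∈ Y ∧ ‖u - proj Y u‖ = ⨅ w : Y, ‖u - w‖ := by
  have : CompleteSpace F := FiniteDimensional.complete ℝ F
  obtain ⟨p, hp, hpu⟩ := exists_norm_eq_iInf_of_complete_convex hne hcl.isComplete hcv u
  exact Classical.epsilon_spec (p := fun p => p ∈ Y ∧ ‖u - p‖ = ⨅ w : Y, ‖u - w‖) ⟨p, hp, hpu⟩

/-- State of stochastic OGDA after `t` iterations: the iterate `(x_t, y_t)` and the previous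
gradient estimates `g_{x,t-1}`, `g_{y,t-1}`. -/
structure OGDAState (E F : Type*) where
  x : E
  y : F
  gx : E
  gy : F

/-- Stochastic OGDA with step sizes `ηx, ηy`, started at `x_{-1} = x_0`, `y_{-1} = y_0`:
`x_{t+1} = x_t - ηx g_{x,t} - ηx (g_{x,t} - g_{x,t-1})`,
`y_{t+1} = proj_Y (y_t + ηy g_{y,t} + ηy (g_{y,t} - g_{y,t-1}))`,
where `g_{·,t}` is the oracle at `(x_t, y_t)` with the fresh samples `a (t+1)`, `b (t+1)`; the
estimates `g_{·,-1}` at `(x_{-1}, y_{-1})` use `a 0`, `b 0`. -/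
def ogda {E F Ξx Ξy : Type*} [NormedAddCommGroup E] [NormedSpace ℝ E]
    [NormedAddCommGroup F] [NormedSpace ℝ F] (Y : Set F)
    (gx : E → F → Ξx → E) (gy : E → F → Ξy → F) (ηx ηy : ℝ) (x₀ : E) (y₀ : F)
    (a : ℕ → Ξx) (b : ℕ → Ξy) : ℕ → OGDAState E F
  | 0 => ⟨x₀, y₀, gx x₀ y₀ (a 0), gy x₀ y₀ (b 0)⟩
  | t + 1 =>
    let s := ogda Y gx gy ηx ηy x₀ y₀ a b t
    let u := gx s.x s.y (a (t + 1))
    let v := gy s.x s.y (b (t + 1))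
    ⟨s.x - ηx • u - ηx • (u - s.gx), proj Y (s.y + ηy • v + ηy • (v - s.gy)), u, v⟩

/-- Number of stochastic gradients (in `x` and in `y`) that OGDA evaluates to produce
`x_0, …, x_T`: none if `T = 0`, otherwise `g_{x,t}` and `g_{y,t}` for `t = -1, …, T - 1`. -/
def ogdaEvals (T : ℕ) : ℕ := if T = 0 then 0 else 2 * (T + 1)

/-- The half step of stochastic EG from `(x_t, y_t)`:
`x_{t+1/2} = x_t - ηx g_{x,t}`, `y_{t+1/2} = proj_Y (y_t + ηy g_{y,t})`, the oracle at
`(x_t, y_t)` using the fresh samples `a (2t)`, `b (2t)`. -/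
def egHalf {E F Ξx Ξy : Type*} [NormedAddCommGroup E] [NormedSpace ℝ E]
    [NormedAddCommGroup F] [NormedSpace ℝ F] (Y : Set F)
    (gx : E → F → Ξx → E) (gy : E → F → Ξy → F) (ηx ηy : ℝ)
    (a : ℕ → Ξx) (b : ℕ → Ξy) (t : ℕ) (z : E × F) : E × F :=
  (z.1 - ηx • gx z.1 z.2 (a (2 * t)), proj Y (z.2 + ηy • gy z.1 z.2 (b (2 * t))))

/-- Stochastic EG, the iterates `(x_t, y_t)`:
`x_{t+1} = x_t - ηx g_{x,t+1/2}`, `y_{t+1} = proj_Y (y_t + ηy g_{y,t+1/2})`, the oracle at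
`(x_{t+1/2}, y_{t+1/2})` using the fresh samples `a (2t+1)`, `b (2t+1)`. -/
def eg {E F Ξx Ξy : Type*} [NormedAddCommGroup E] [NormedSpace ℝ E]
    [NormedAddCommGroup F] [NormedSpace ℝ F] (Y : Set F)
    (gx : E → F → Ξx → E) (gy : E → F → Ξy → F) (ηx ηy : ℝ) (x₀ : E) (y₀ : F)
    (a : ℕ → Ξx) (b : ℕ → Ξy) : ℕ → E × F
  | 0 => (x₀, y₀)
  | t + 1 =>
    let z := eg Y gx gy ηx ηy x₀ y₀ a b t
    let w := egHalf Y gx gy ηx ηy a b t z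
    (z.1 - ηx • gx w.1 w.2 (a (2 * t + 1)), proj Y (z.2 + ηy • gy w.1 w.2 (b (2 * t + 1))))

/-- The mid-points `x_{t-1/2}` of stochastic EG, with the convention `x_{-1/2} = x_0`. -/
def egMid {E F Ξx Ξy : Type*} [NormedAddCommGroup E] [NormedSpace ℝ E]
    [NormedAddCommGroup F] [NormedSpace ℝ F] (Y : Set F)
    (gx : E → F → Ξx → E) (gy : E → F → Ξy → F) (ηx ηy : ℝ) (x₀ : E) (y₀ : F)
    (a : ℕ → Ξx) (b : ℕ → Ξy) : ℕ → E
  | 0 => x₀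
  | t + 1 => (egHalf Y gx gy ηx ηy a b t (eg Y gx gy ηx ηy x₀ y₀ a b t)).1

/-- Number of stochastic gradients (in `x` and in `y`) that EG evaluates in the `T` iterations
that produce `x_{-1/2}, x_{1/2}, …, x_{T-1/2}`: four per iteration. -/
def egEvals (T : ℕ) : ℕ := 4 * T

/-! ### Step sizes and complexity -/

/-- `min {ε²/(ℓ(G²+σ²)), ε⁴/(D²ℓ³G√(G²+σ²)), ε⁶/(D²ℓ³σ²G√(G²+σ²))}`; the last entry is `+∞`,
hence dropped, if `σ = 0`. -/
def primalStep (ℓ G D σ ε : ℝ) : ℝ :=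
  let m := min (ε ^ 2 / (ℓ * (G ^ 2 + σ ^ 2)))
    (ε ^ 4 / (D ^ 2 * ℓ ^ 3 * G * √(G ^ 2 + σ ^ 2)))
  if σ = 0 then m else min m (ε ^ 6 / (D ^ 2 * ℓ ^ 3 * σ ^ 2 * G * √(G ^ 2 + σ ^ 2)))

/-- `min {1/(4ℓ), ε²/(ℓσ²)}`; the last entry is `+∞`, hence dropped, if `σ = 0`. -/
def dualStep (ℓ σ ε : ℝ) : ℝ :=
  if σ = 0 then 1 / (4 * ℓ) else min (1 / (4 * ℓ)) (ε ^ 2 / (ℓ * σ ^ 2))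

/-- `D²ℓ³G√(G²+σ²)Δ/ε⁶ · max {1, σ²/ε²}`. -/
def complexity (ℓ G D σ ε Δ : ℝ) : ℝ :=
  D ^ 2 * ℓ ^ 3 * G * √(G ^ 2 + σ ^ 2) * Δ / ε ^ 6 * max 1 (σ ^ 2 / ε ^ 2)

/-- The random sequence `z` of points reaches stationarity with gradient complexity controlled by
`C`: there is `T₀` for which producing `z_0, …, z_{T₀}` costs at most
`C · max {complexity, ℓ(G²+σ²)Δ/ε⁴}` gradient evaluations, and at most `C · complexity` as soon as
`ε²√(G²+σ²) ≤ D²ℓ²G max {1, σ²/ε²}`, and for every `T ≥ T₀` the average over `t = 0, …, T` of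
`𝔼 ‖∇Ψ(z_t)‖²` is at most `ε²`. -/
def ReachesStationarity {Ω E : Type*} [MeasurableSpace Ω] [NormedAddCommGroup E]
    [InnerProductSpace ℝ E] [CompleteSpace E] (P : Measure Ω) (Ψ : E → ℝ) (z : ℕ → Ω → E)
    (evals : ℕ → ℕ) (C ℓ G D σ ε Δ : ℝ) : Prop :=
  (∀ t, Integrable (fun ω => ‖gradient Ψ (z t ω)‖ ^ 2) P) ∧
  ∃ T₀ : ℕ,
    (evals T₀ : ℝ) ≤ C * max (complexity ℓ G D σ ε Δ) (ℓ * (G ^ 2 + σ ^ 2) * Δ / ε ^ 4) ∧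
    (ε ^ 2 * √(G ^ 2 + σ ^ 2) ≤ D ^ 2 * ℓ ^ 2 * G * max 1 (σ ^ 2 / ε ^ 2) →
      (evals T₀ : ℝ) ≤ C * complexity ℓ G D σ ε Δ) ∧
    ∀ T ≥ T₀, 1 / ((T : ℝ) + 1) *
      ∑ t ∈ Finset.range (T + 1), ∫ ω, ‖gradient Ψ (z t ω)‖ ^ 2 ∂P ≤ ε ^ 2

end NCC

end

open scoped RealInnerProductSpace

/-! Write M² = G² + σ². The primal function Φ is `ℓ`-weakly convex, so the proximal problem behind
the envelope is `ℓ`-strongly convex. Hence the envelope is differentiable with Lipschitz gradient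
2ℓ(x - prox x) (`hasGradientAt_envelope`), and it serves as a Lyapunov function: a step from `w`
along a gradient estimate taken at a nearby `z` and at any y ∈ Y lowers it by η/8 ‖∇‖², up to 2ℓη
times the dual gap Φ(z) - f(z, y), a mean-zero term and terms of order ℓη²M² in expectation
(`envelope_step`). Stationarity therefore follows once the average dual gap is a small multiple of
ε²/ℓ.

The gap is controlled in blocks of length B (`gap_block`, `gap_sum`). Within a block the primal
points travel O(ηMB) in mean, so by the G-Lipschitz property the comparator can be frozen at a
maximizer for the first point of the block, at a cost O(GMηB) per step. Against a frozen comparator,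
concavity bounds the gap by the regret of an online method. Projected extragradient and projected
optimistic ascent both have regret O(D²/τ) plus τ times squared errors (`extragradient_regret`,
`optimistic_regret`). Up to a small primal drift term, the average gap is then of order D²/(τB) +
GMηB + τσ². The choice B ≈ ε²/(ℓηGM), up to a constant, and the prescribed step sizes make this
small enough (`grad_sum_le`).

Both algorithms fit one abstraction, `IsScheme`: anchors W follow W - ηU, with U an unbiased
gradient estimate at Z = W - ηH. For EG, W is x_t and Z is x_{t+1/2}; for OGDA, Z is x_{t+1} and W
is x_{t+1} + η g_{x,t}, for which the extrapolation telescopes (`isScheme_eg`, `isScheme_ogda`).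
Conditional expectations are replaced by orthogonality to variables determined by the past
(`IsNoise`). Comparators are chosen path by path and all bounds are uniform in them, so no
measurable selection is needed.

Two regimes escape the block argument: horizons shorter than B, where the points have not moved far
(`grad_Z_le`), and ε > G, where the envelope gradient is at most G anyway. -/

namespace NCC

/-! ### Consequences of the assumptions for `f` and for the primal function. -/

section Problem

variable {E F : Type*} [NormedAddCommGroup E] [InnerProductSpace ℝ E]
  [NormedAddCommGroup F] [InnerProductSpace ℝ F]
  {Y : Set F} {f : E → F → ℝ} {fx : E → F → E} {fy : E → F → F} {ℓ G D : ℝ}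

namespace IsNonconvexConcave

theorem hasFDerivAt_left (h : IsNonconvexConcave Y f fx fy ℓ G D) (x : E) {y : F} (hy : y ∈ Y) :
    HasFDerivAt (fun x => f x y) (innerSL ℝ (fx x y)) x := by
  have h1 := h.hasGradient x y hy
  have h2 : HasFDerivWithinAt (fun x : E => (x, y)) (ContinuousLinearMap.inl ℝ E F) Set.univ x :=
    ((hasFDerivAt_id x).prodMk (hasFDerivAt_const y x)).hasFDerivWithinAt
  have h3 := h1.comp (t := Set.univ ×ˢ Y) x h2 (fun z _ => ⟨trivial, hy⟩)
  rw [hasFDerivWithinAt_univ] at h3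
  refine h3.congr_fderiv ?_
  ext z
  simp

theorem norm_fx_le (h : IsNonconvexConcave Y f fx fy ℓ G D) (hG : 0 ≤ G) (x : E) {y : F}
    (hy : y ∈ Y) : ‖fx x y‖ ≤ G := by
  have := (h.hasFDerivAt_left x hy).le_of_lip' hG (Filter.Eventually.of_forall fun z => by
    rw [Real.norm_eq_abs]; exact h.lipschitz z x y hy)
  simpa using this

theorem fx_sub_sq_le (h : IsNonconvexConcave Y f fx fy ℓ G D) (x₁ x₂ : E) {y₁ y₂ : F}
    (hy₁ : y₁ ∈ Y) (hy₂ : y₂ ∈ Y) :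
    ‖fx x₁ y₁ - fx x₂ y₂‖ ^ 2 ≤ ℓ ^ 2 * ‖x₁ - x₂‖ ^ 2 + ℓ ^ 2 * ‖y₁ - y₂‖ ^ 2 := by
  have := h.smooth x₁ x₂ y₁ hy₁ y₂ hy₂
  nlinarith [sq_nonneg ‖fy x₁ y₁ - fy x₂ y₂‖]

theorem fy_sub_sq_le (h : IsNonconvexConcave Y f fx fy ℓ G D) (x₁ x₂ : E) {y₁ y₂ : F}
    (hy₁ : y₁ ∈ Y) (hy₂ : y₂ ∈ Y) :
    ‖fy x₁ y₁ - fy x₂ y₂‖ ^ 2 ≤ ℓ ^ 2 * ‖x₁ - x₂‖ ^ 2 + ℓ ^ 2 * ‖y₁ - y₂‖ ^ 2 := by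
  have := h.smooth x₁ x₂ y₁ hy₁ y₂ hy₂
  nlinarith [sq_nonneg ‖fx x₁ y₁ - fx x₂ y₂‖]

theorem norm_fx_sub_le (h : IsNonconvexConcave Y f fx fy ℓ G D) (hℓ : 0 ≤ ℓ) (x₁ x₂ : E) {y : F}
    (hy : y ∈ Y) : ‖fx x₁ y - fx x₂ y‖ ≤ ℓ * ‖x₁ - x₂‖ := by
  have := h.fx_sub_sq_le x₁ x₂ hy hy
  rw [sub_self, norm_zero] at this
  refine abs_le_of_sq_le_sq' (by nlinarith) (by positivity) |>.2

/-- The quadratic lower bound for a function with Lipschitz gradient. -/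
theorem quadratic_lower (h : IsNonconvexConcave Y f fx fy ℓ G D) (hℓ : 0 ≤ ℓ) (x x' : E) {y : F}
    (hy : y ∈ Y) :
    f x y + ⟪fx x y, x' - x⟫ - ℓ / 2 * ‖x' - x‖ ^ 2 ≤ f x' y := by
  set d := x' - x with hd
  -- Along the segment, the linear part is removed and the maximal curvature added back, so that the
  -- Lipschitz bound on `fx` makes the function monotone.
  let φ : ℝ → ℝ := fun t => f (x + t • d) y - t * ⟪fx x y, d⟫ + ℓ / 2 * t ^ 2 * ‖d‖ ^ 2
  have hder : ∀ t, HasDerivAt φ (⟪fx (x + t • d) y, d⟫ - ⟪fx x y, d⟫ + ℓ * t * ‖d‖ ^ 2) t := by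
    intro t
    have h1 : HasDerivAt (fun t : ℝ => x + t • d) d t := by
      simpa using ((hasDerivAt_id t).smul_const d).const_add x
    have h2 := (h.hasFDerivAt_left (x + t • d) hy).comp_hasDerivAt t h1
    have h3 : HasDerivAt (fun t : ℝ => t * ⟪fx x y, d⟫) ⟪fx x y, d⟫ t := by
      simpa using (hasDerivAt_id t).mul_const ⟪fx x y, d⟫
    have h4 : HasDerivAt (fun t : ℝ => ℓ / 2 * t ^ 2 * ‖d‖ ^ 2) (ℓ * t * ‖d‖ ^ 2) t := by
      have := ((hasDerivAt_pow 2 t).const_mul (ℓ / 2)).mul_const (‖d‖ ^ 2)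
      refine this.congr_deriv ?_
      push_cast; ring
    exact (h2.sub h3).add h4
  have hmono : MonotoneOn φ (Set.Icc 0 1) := by
    refine monotoneOn_of_deriv_nonneg (convex_Icc 0 1)
      (fun t _ => (hder t).continuousAt.continuousWithinAt)
      (fun t _ => (hder t).differentiableAt.differentiableWithinAt) ?_
    intro t ht
    rw [interior_Icc] at ht
    rw [(hder t).deriv, ← inner_sub_left]
    have h1 := h.norm_fx_sub_le hℓ (x + t • d) x hy
    have h2 : ‖x + t • d - x‖ = t * ‖d‖ := by
      rw [add_sub_cancel_left, norm_smul, Real.norm_of_nonneg ht.1.le]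
    have h3 := neg_le_of_abs_le (abs_real_inner_le_norm (fx (x + t • d) y - fx x y) d)
    have h4 : ‖fx (x + t • d) y - fx x y‖ * ‖d‖ ≤ ℓ * (t * ‖d‖) * ‖d‖ := by
      rw [h2] at h1
      exact mul_le_mul_of_nonneg_right h1 (norm_nonneg d)
    nlinarith
  have := hmono (Set.left_mem_Icc.2 zero_le_one) (Set.right_mem_Icc.2 zero_le_one) zero_le_one
  simp only [φ, zero_smul, add_zero, one_smul] at this
  have e : x + d = x' := by rw [hd]; abel
  rw [e] at this
  nlinarith

/-- The first-order upper bound for a concave function. -/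
theorem concave_upper (h : IsNonconvexConcave Y f fx fy ℓ G D) (x : E) {y y' : F}
    (hy : y ∈ Y) (hy' : y' ∈ Y) : f x y' ≤ f x y + ⟪fy x y, y' - y⟫ := by
  set d := y' - y with hd
  have hmem : ∀ t ∈ Set.Icc (0 : ℝ) 1, y + t • d ∈ Y := fun t ht =>
    h.convex.add_smul_sub_mem hy hy' ht
  let φ : ℝ → ℝ := fun t => f x (y + t • d)
  -- Only a one-sided derivative is available: `f` is differentiable relative to `Y`, and `y` may
  -- lie on its boundary.
  have hder : HasDerivWithinAt φ ⟪fy x y, d⟫ (Set.Icc 0 1) 0 := by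
    have h1 : HasDerivWithinAt (fun t : ℝ => ((x, y + t • d) : E × F)) (0, d) (Set.Icc 0 1) 0 := by
      have h2 : HasDerivAt (fun t : ℝ => y + t • d) d 0 := by
        simpa using ((hasDerivAt_id (0 : ℝ)).smul_const d).const_add y
      exact ((hasDerivAt_const (0 : ℝ) x).prodMk h2).hasDerivWithinAt
    have h0 : ((x, y + (0 : ℝ) • d) : E × F) = (x, y) := by simp
    have h3 := h.hasGradient x y hy
    rw [← h0] at h3
    have h4 := h3.comp_hasDerivWithinAt (0 : ℝ) h1 (fun t ht =>
      Set.mk_mem_prod (Set.mem_univ _) (hmem t ht))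
    refine h4.congr_deriv ?_
    simp
  have hcc : ConcaveOn ℝ (Set.Icc (0 : ℝ) 1) φ := by
    refine ⟨convex_Icc 0 1, fun s hs t ht a b ha hb hab => ?_⟩
    have := (h.concave x).2 (hmem s hs) (hmem t ht) ha hb hab
    have e : y + (a • s + b • t) • d = a • (y + s • d) + b • (y + t • d) := by
      have : y = (a + b) • y := by rw [hab, one_smul]
      simp only [smul_eq_mul]
      conv_lhs => rw [this]
      module
    simp only [φ, e]
    exact this
  have := ConcaveOn.slope_le_of_hasDerivWithinAt (x := 0) (y := 1) hcc (by simp) (by simp)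
    zero_lt_one hder
  simp only [φ, slope, zero_smul, add_zero, one_smul, sub_zero, inv_one, vsub_eq_sub] at this
  have e : y + d = y' := by rw [hd]; abel
  rw [e] at this
  linarith

theorem continuousOn_right (h : IsNonconvexConcave Y f fx fy ℓ G D) (x : E) :
    ContinuousOn (f x) Y := by
  have h1 : ContinuousOn (fun z : E × F => f z.1 z.2) (Set.univ ×ˢ Y) := fun z hz =>
    (h.hasGradient z.1 z.2 hz.2).continuousWithinAt
  exact h1.comp (f := fun y => (x, y)) (by fun_prop) (fun y hy => ⟨trivial, hy⟩)

theorem norm_sub_le (h : IsNonconvexConcave Y f fx fy ℓ G D) {y y' : F} (hy : y ∈ Y)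
    (hy' : y' ∈ Y) : ‖y - y'‖ ≤ D := by
  rw [← dist_eq_norm]
  exact (Metric.dist_le_diam_of_mem h.isBounded hy hy').trans h.diam_le

variable [FiniteDimensional ℝ F]

theorem isCompact (h : IsNonconvexConcave Y f fx fy ℓ G D) : IsCompact Y :=
  Metric.isCompact_of_isClosed_isBounded h.isClosed h.isBounded

theorem exists_primal_eq (h : IsNonconvexConcave Y f fx fy ℓ G D) (x : E) :
    ∃ y ∈ Y, primal Y f x = f x y ∧ ∀ y' ∈ Y, f x y' ≤ f x y := by
  obtain ⟨y, hy, hmax⟩ := h.isCompact.exists_isMaxOn h.nonempty (h.continuousOn_right x)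
  have hle : ∀ y' ∈ Y, f x y' ≤ f x y := fun y' hy' => hmax hy'
  refine ⟨y, hy, ?_, hle⟩
  have : Nonempty Y := ⟨⟨y, hy⟩⟩
  refine le_antisymm (ciSup_le fun y' => hle y' y'.2) ?_
  exact le_ciSup (f := fun y' : Y => f x y')
    ⟨f x y, by rintro _ ⟨y', rfl⟩; exact hle y' y'.2⟩ ⟨y, hy⟩

theorem le_primal (h : IsNonconvexConcave Y f fx fy ℓ G D) (x : E) {y : F} (hy : y ∈ Y) :
    f x y ≤ primal Y f x := by
  obtain ⟨y', -, h1, h2⟩ := h.exists_primal_eq x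
  rw [h1]
  exact h2 y hy

theorem primal_le (h : IsNonconvexConcave Y f fx fy ℓ G D) (x x' : E) :
    primal Y f x ≤ primal Y f x' + G * ‖x - x'‖ := by
  obtain ⟨y, hy, h1, -⟩ := h.exists_primal_eq x
  have h2 := (abs_le.1 (h.lipschitz x x' y hy)).2
  have h3 := h.le_primal x' hy
  linarith

theorem continuous_primal (h : IsNonconvexConcave Y f fx fy ℓ G D) :
    Continuous (primal Y f) := by
  refine (LipschitzWith.of_le_add_mul G.toNNReal fun x x' => ?_).continuous
  refine (h.primal_le x x').trans ?_
  rw [dist_eq_norm]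
  gcongr
  exact Real.le_coe_toNNReal G

/-- The primal function is `ℓ`-weakly convex. -/
theorem primal_weakly_convex (h : IsNonconvexConcave Y f fx fy ℓ G D) (hℓ : 0 ≤ ℓ) (p u : E)
    {t : ℝ} (ht : 0 ≤ t) (ht' : t ≤ 1) :
    primal Y f (p + t • (u - p)) - ℓ / 2 * (t * (1 - t)) * ‖u - p‖ ^ 2
      ≤ (1 - t) * primal Y f p + t * primal Y f u := by
  set c := p + t • (u - p) with hc
  -- One maximizer, taken at the intermediate point `c`, serves both ends; with weights 1 - t and t
  -- the two linear terms cancel.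
  obtain ⟨y, hy, h1, -⟩ := h.exists_primal_eq c
  have hp := (h.quadratic_lower hℓ c p hy).trans (h.le_primal p hy)
  have hu := (h.quadratic_lower hℓ c u hy).trans (h.le_primal u hy)
  have ep : p - c = (-t) • (u - p) := by rw [hc]; module
  have eu : u - c = (1 - t) • (u - p) := by rw [hc]; module
  rw [ep, real_inner_smul_right, norm_smul, Real.norm_eq_abs, mul_pow, sq_abs] at hp
  rw [eu, real_inner_smul_right, norm_smul, Real.norm_eq_abs, mul_pow, sq_abs] at hu
  rw [h1]
  nlinarith [mul_le_mul_of_nonneg_left hp (sub_nonneg.2 ht'), mul_le_mul_of_nonneg_left hu ht]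

/-! ### The proximal point and the Moreau envelope -/

variable [FiniteDimensional ℝ E]

/-- Outside the ball of radius |G|/ℓ the quadratic penalty exceeds any decrease a G-Lipschitz
function can offer, so the minimizer over this compact ball is global. -/
theorem exists_prox (h : IsNonconvexConcave Y f fx fy ℓ G D) (hℓ : 0 < ℓ) (x : E) :
    ∃ p, ∀ u, primal Y f p + ℓ * ‖p - x‖ ^ 2 ≤ primal Y f u + ℓ * ‖u - x‖ ^ 2 := by
  have hcont : Continuous fun u => primal Y f u + ℓ * ‖u - x‖ ^ 2 :=
    h.continuous_primal.add (by fun_prop)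
  obtain ⟨p, -, hp⟩ := (isCompact_closedBall x (|G| / ℓ)).exists_isMinOn
    ⟨x, Metric.mem_closedBall_self (by positivity)⟩ hcont.continuousOn
  refine ⟨p, fun u => ?_⟩
  by_cases hu : u ∈ Metric.closedBall x (|G| / ℓ)
  · exact hp hu
  · have h1 : primal Y f p + ℓ * ‖p - x‖ ^ 2 ≤ primal Y f x + ℓ * ‖x - x‖ ^ 2 :=
      hp (Metric.mem_closedBall_self (by positivity))
    rw [sub_self, norm_zero] at h1
    rw [Metric.mem_closedBall, dist_eq_norm, not_le, div_lt_iff₀ hℓ] at hu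
    have h2 := h.primal_le x u
    rw [norm_sub_rev] at h2
    nlinarith [le_abs_self G, norm_nonneg (u - x)]

end IsNonconvexConcave

end Problem

/-- The proximal point of the primal function at `x`. -/
noncomputable def prox {E F : Type*} [NormedAddCommGroup E] (Y : Set F) (f : E → F → ℝ) (ℓ : ℝ)
    (x : E) : E :=
  Classical.epsilon fun p =>
    ∀ u, primal Y f p + ℓ * ‖p - x‖ ^ 2 ≤ primal Y f u + ℓ * ‖u - x‖ ^ 2

/-- The gradient of the Moreau envelope. -/
noncomputable def envelopeGrad {E F : Type*} [NormedAddCommGroup E] [NormedSpace ℝ E] (Y : Set F)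
    (f : E → F → ℝ) (ℓ : ℝ) (x : E) : E :=
  (2 * ℓ) • (x - prox Y f ℓ x)

theorem norm_prox_sub_self {E F : Type*} [NormedAddCommGroup E] [NormedSpace ℝ E] {Y : Set F}
    {f : E → F → ℝ} {ℓ : ℝ} (hℓ : 0 < ℓ) (x : E) :
    ‖prox Y f ℓ x - x‖ = ‖envelopeGrad Y f ℓ x‖ / (2 * ℓ) := by
  rw [envelopeGrad, norm_smul, Real.norm_of_nonneg (by positivity), norm_sub_rev]
  field_simp

namespace IsNonconvexConcave

variable {E F : Type*} [NormedAddCommGroup E] [InnerProductSpace ℝ E] [FiniteDimensional ℝ E]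
  [NormedAddCommGroup F] [InnerProductSpace ℝ F] [FiniteDimensional ℝ F]
  {Y : Set F} {f : E → F → ℝ} {fx : E → F → E} {fy : E → F → F} {ℓ G D : ℝ}

theorem prox_le (h : IsNonconvexConcave Y f fx fy ℓ G D) (hℓ : 0 < ℓ) (x u : E) :
    primal Y f (prox Y f ℓ x) + ℓ * ‖prox Y f ℓ x - x‖ ^ 2 ≤ primal Y f u + ℓ * ‖u - x‖ ^ 2 :=
  Classical.epsilon_spec (p := fun p =>
    ∀ u, primal Y f p + ℓ * ‖p - x‖ ^ 2 ≤ primal Y f u + ℓ * ‖u - x‖ ^ 2) (h.exists_prox hℓ x) u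

/-- The proximal objective grows quadratically away from its minimizer. -/
theorem prox_add_le (h : IsNonconvexConcave Y f fx fy ℓ G D) (hℓ : 0 < ℓ) (x u : E) :
    primal Y f (prox Y f ℓ x) + ℓ * ‖prox Y f ℓ x - x‖ ^ 2 + ℓ / 2 * ‖u - prox Y f ℓ x‖ ^ 2
      ≤ primal Y f u + ℓ * ‖u - x‖ ^ 2 := by
  set p := prox Y f ℓ x with hp
  -- Minimality is tested at a point of the segment and divided by `t`. The penalty is 2ℓ-strongly
  -- convex and Φ is ℓ-weakly convex, which leaves modulus ℓ; the factor 1 - t disappears as t → 0.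
  have key : ∀ t : ℝ, t ∈ Set.Ioo (0 : ℝ) 1 →
      primal Y f p + ℓ * ‖p - x‖ ^ 2 + (1 - t) * (ℓ / 2 * ‖u - p‖ ^ 2)
        ≤ primal Y f u + ℓ * ‖u - x‖ ^ 2 := by
    intro t ht
    have h1 := h.prox_le hℓ x (p + t • (u - p))
    rw [← hp] at h1
    have h2 := h.primal_weakly_convex hℓ.le p u ht.1.le ht.2.le
    have h3 : ‖p + t • (u - p) - x‖ ^ 2
        = (1 - t) * ‖p - x‖ ^ 2 + t * ‖u - x‖ ^ 2 - t * (1 - t) * ‖u - p‖ ^ 2 := by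
      have e1 : p + t • (u - p) - x = (p - x) + t • (u - p) := by abel
      have e2 : u - x = (p - x) + (u - p) := by abel
      rw [e1, e2, norm_add_sq_real, norm_add_sq_real, norm_smul, real_inner_smul_right,
        Real.norm_eq_abs, mul_pow, sq_abs]
      ring
    rw [h3] at h1
    have h4 : t * (primal Y f p + ℓ * ‖p - x‖ ^ 2 + (1 - t) * (ℓ / 2 * ‖u - p‖ ^ 2))
        ≤ t * (primal Y f u + ℓ * ‖u - x‖ ^ 2) := by nlinarith
    exact le_of_mul_le_mul_left h4 ht.1
  have hlim : Filter.Tendsto (fun t : ℝ => primal Y f p + ℓ * ‖p - x‖ ^ 2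
      + (1 - t) * (ℓ / 2 * ‖u - p‖ ^ 2)) (nhdsWithin 0 (Set.Ioi 0))
      (nhds (primal Y f p + ℓ * ‖p - x‖ ^ 2 + (1 - 0) * (ℓ / 2 * ‖u - p‖ ^ 2))) := by
    refine (Continuous.tendsto ?_ 0).mono_left nhdsWithin_le_nhds
    fun_prop
  have := le_of_tendsto hlim (Filter.mem_of_superset (Ioo_mem_nhdsGT zero_lt_one) key)
  linarith

/-- Adding the quadratic growth inequalities at the two proximal points, each tested at the other,
cancels the values of Φ and leaves ‖p - q‖² ≤ 2⟪p - q, x - x'⟫. -/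
theorem norm_prox_sub_le (h : IsNonconvexConcave Y f fx fy ℓ G D) (hℓ : 0 < ℓ) (x x' : E) :
    ‖prox Y f ℓ x - prox Y f ℓ x'‖ ≤ 2 * ‖x - x'‖ := by
  have h1 := h.prox_add_le hℓ x (prox Y f ℓ x')
  have h2 := h.prox_add_le hℓ x' (prox Y f ℓ x)
  set p := prox Y f ℓ x
  set q := prox Y f ℓ x'
  have e : ‖q - x‖ ^ 2 - ‖p - x‖ ^ 2 + ‖p - x'‖ ^ 2 - ‖q - x'‖ ^ 2 = 2 * ⟪p - q, x - x'⟫ := by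
    simp only [norm_sub_sq_real, inner_sub_left, inner_sub_right]
    ring
  rw [norm_sub_rev q p] at h1
  have h3 : ‖p - q‖ ^ 2 ≤ 2 * ⟪p - q, x - x'⟫ := by
    rw [← e]
    refine le_of_mul_le_mul_left ?_ hℓ
    linarith
  have h4 := real_inner_le_norm (p - q) (x - x')
  by_contra! hlt
  have : 0 < ‖p - q‖ := (by positivity : 0 ≤ 2 * ‖x - x'‖).trans_lt hlt
  nlinarith

theorem envelope_eq (h : IsNonconvexConcave Y f fx fy ℓ G D) (hℓ : 0 < ℓ) (x : E) :
    envelope Y f ℓ x = primal Y f (prox Y f ℓ x) + ℓ * ‖prox Y f ℓ x - x‖ ^ 2 := by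
  have e : 1 / (2 * (1 / (2 * ℓ))) = ℓ := by field_simp
  unfold envelope moreau
  rw [e]
  refine le_antisymm (ciInf_le ⟨primal Y f (prox Y f ℓ x) + ℓ * ‖prox Y f ℓ x - x‖ ^ 2, ?_⟩ _) (le_ciInf fun u => h.prox_le hℓ x u)
  rintro _ ⟨u, rfl⟩
  exact h.prox_le hℓ x u

theorem envelope_le (h : IsNonconvexConcave Y f fx fy ℓ G D) (hℓ : 0 < ℓ) (x u : E) :
    envelope Y f ℓ x ≤ primal Y f u + ℓ * ‖u - x‖ ^ 2 := by
  rw [h.envelope_eq hℓ]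
  exact h.prox_le hℓ x u

/-- The proximal point of `x` is a competitor in the problem at `x'`; expanding the square gives
this bound with no further loss. -/
theorem envelope_le_add (h : IsNonconvexConcave Y f fx fy ℓ G D) (hℓ : 0 < ℓ) (x x' : E) :
    envelope Y f ℓ x' ≤ envelope Y f ℓ x + ⟪envelopeGrad Y f ℓ x, x' - x⟫ + ℓ * ‖x' - x‖ ^ 2 := by
  have h1 := h.envelope_le hℓ x' (prox Y f ℓ x)
  rw [h.envelope_eq hℓ x]
  have e : ‖prox Y f ℓ x - x'‖ ^ 2 = ‖prox Y f ℓ x - x‖ ^ 2 + 2 * ⟪x - prox Y f ℓ x, x' - x⟫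
      + ‖x' - x‖ ^ 2 := by
    have : prox Y f ℓ x - x' = (prox Y f ℓ x - x) - (x' - x) := by abel
    rw [this, norm_sub_sq_real, ← neg_sub (prox Y f ℓ x) x, inner_neg_left]
    ring
  rw [e] at h1
  rw [envelopeGrad, real_inner_smul_left]
  linarith

theorem norm_envelopeGrad_sub_le (h : IsNonconvexConcave Y f fx fy ℓ G D) (hℓ : 0 < ℓ) (x x' : E) :
    ‖envelopeGrad Y f ℓ x - envelopeGrad Y f ℓ x'‖ ≤ 6 * ℓ * ‖x - x'‖ := by
  have e : envelopeGrad Y f ℓ x - envelopeGrad Y f ℓ x'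
      = (2 * ℓ) • ((x - x') - (prox Y f ℓ x - prox Y f ℓ x')) := by
    unfold envelopeGrad; module
  rw [e, norm_smul, Real.norm_of_nonneg (by positivity)]
  nlinarith [_root_.norm_sub_le (x - x') (prox Y f ℓ x - prox Y f ℓ x'), h.norm_prox_sub_le hℓ x x']

theorem continuous_prox (h : IsNonconvexConcave Y f fx fy ℓ G D) (hℓ : 0 < ℓ) :
    Continuous (prox Y f ℓ) := by
  refine (LipschitzWith.of_dist_le_mul (K := 2) fun x x' => ?_).continuous
  simpa [dist_eq_norm] using h.norm_prox_sub_le hℓ x x'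

theorem continuous_envelopeGrad (h : IsNonconvexConcave Y f fx fy ℓ G D) (hℓ : 0 < ℓ) :
    Continuous (envelopeGrad Y f ℓ) := by
  have := h.continuous_prox hℓ
  unfold envelopeGrad
  fun_prop

/-- The quadratic upper bound from `x` to `x'` and the one from `x'` to `x` enclose the remainder
from both sides once the gradients are compared: 7ℓ is ℓ from the bound plus 6ℓ from the Lipschitz
constant. -/
theorem hasGradientAt_envelope [CompleteSpace E] (h : IsNonconvexConcave Y f fx fy ℓ G D)
    (hℓ : 0 < ℓ) (x : E) : HasGradientAt (envelope Y f ℓ) (envelopeGrad Y f ℓ x) x := by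
  rw [hasGradientAt_iff_isLittleO]
  refine Asymptotics.IsBigO.trans_isLittleO (g := fun x' => ‖x' - x‖ ^ 2) ?_ ?_
  · refine Asymptotics.IsBigO.of_bound (7 * ℓ) (Filter.Eventually.of_forall fun x' => ?_)
    have h1 := h.envelope_le_add hℓ x x'
    have h2 := h.envelope_le_add hℓ x' x
    have h3 := h.norm_envelopeGrad_sub_le hℓ x' x
    have h4 := real_inner_le_norm (envelopeGrad Y f ℓ x' - envelopeGrad Y f ℓ x) (x - x')
    have h5 : ‖envelopeGrad Y f ℓ x' - envelopeGrad Y f ℓ x‖ * ‖x - x'‖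
        ≤ 6 * ℓ * ‖x' - x‖ * ‖x' - x‖ := by
      rw [norm_sub_rev x x']
      exact mul_le_mul_of_nonneg_right h3 (norm_nonneg _)
    have h6 : ⟪envelopeGrad Y f ℓ x, x - x'⟫ = - ⟪envelopeGrad Y f ℓ x, x' - x⟫ := by
      rw [← inner_neg_right, neg_sub]
    rw [norm_sub_rev x x'] at h2
    rw [inner_sub_left] at h4
    rw [Real.norm_eq_abs, Real.norm_of_nonneg (by positivity), abs_le]
    constructor <;> nlinarith [sq_nonneg ‖x' - x‖]
  · exact Asymptotics.isLittleO_norm_right.1 <| by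
      simpa using Asymptotics.isLittleO_pow_sub_sub x (m := 2) one_lt_two

theorem differentiable_envelope (h : IsNonconvexConcave Y f fx fy ℓ G D)
    (hℓ : 0 < ℓ) : Differentiable ℝ (envelope Y f ℓ) := by
  have : CompleteSpace E := FiniteDimensional.complete ℝ E
  exact fun x => (h.hasGradientAt_envelope hℓ x).differentiableAt

theorem gradient_envelope [CompleteSpace E] (h : IsNonconvexConcave Y f fx fy ℓ G D)
    (hℓ : 0 < ℓ) (x : E) : gradient (envelope Y f ℓ) x = envelopeGrad Y f ℓ x :=
  (h.hasGradientAt_envelope hℓ x).gradient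

/-- Translating the proximal point along with `x` keeps the penalty fixed, so the envelope inherits
the Lipschitz constant of Φ. -/
theorem envelope_le_add_norm (h : IsNonconvexConcave Y f fx fy ℓ G D) (hℓ : 0 < ℓ) (x x' : E) :
    envelope Y f ℓ x' ≤ envelope Y f ℓ x + G * ‖x' - x‖ := by
  have h1 := h.envelope_le hℓ x' (prox Y f ℓ x + (x' - x))
  have h2 := h.primal_le (prox Y f ℓ x + (x' - x)) (prox Y f ℓ x)
  have e1 : prox Y f ℓ x + (x' - x) - prox Y f ℓ x = x' - x := by abel
  have e2 : prox Y f ℓ x + (x' - x) - x' = prox Y f ℓ x - x := by abel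
  rw [e1] at h2
  rw [e2] at h1
  rw [h.envelope_eq hℓ x]
  linarith

theorem norm_envelopeGrad_le (h : IsNonconvexConcave Y f fx fy ℓ G D) (hℓ : 0 < ℓ) (hG : 0 ≤ G)
    (x : E) : ‖envelopeGrad Y f ℓ x‖ ≤ G := by
  have : CompleteSpace E := FiniteDimensional.complete ℝ E
  have h1 := (h.hasGradientAt_envelope hℓ x).hasFDerivAt.le_of_lip' hG
    (Filter.Eventually.of_forall fun z => by
      rw [Real.norm_eq_abs, abs_le]
      have h1 := h.envelope_le_add_norm hℓ x z
      have h2 := h.envelope_le_add_norm hℓ z x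
      rw [norm_sub_rev] at h2
      constructor <;> linarith)
  simpa using h1

/-- A gradient step of length 1/(2ℓ) gains ‖∇‖²/(4ℓ), yet cannot reach below the infimum. -/
theorem norm_envelopeGrad_sq_le (h : IsNonconvexConcave Y f fx fy ℓ G D) (hℓ : 0 < ℓ)
    (hb : BddBelow (Set.range (envelope Y f ℓ))) (x : E) :
    ‖envelopeGrad Y f ℓ x‖ ^ 2 ≤ 4 * ℓ * (envelope Y f ℓ x - ⨅ u, envelope Y f ℓ u) := by
  set v := envelopeGrad Y f ℓ x with hv
  have h1 := h.envelope_le_add hℓ x (x - (1 / (2 * ℓ)) • v)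
  have h2 := ciInf_le hb (x - (1 / (2 * ℓ)) • v)
  rw [← hv, sub_sub_cancel_left, inner_neg_right, real_inner_smul_right,
    real_inner_self_eq_norm_sq, norm_neg, norm_smul, Real.norm_of_nonneg (by positivity)] at h1
  have e : -(1 / (2 * ℓ) * ‖v‖ ^ 2) + ℓ * (1 / (2 * ℓ) * ‖v‖) ^ 2 = - (‖v‖ ^ 2 / (4 * ℓ)) := by
    field_simp; ring
  have h3 : ‖v‖ ^ 2 / (4 * ℓ) ≤ envelope Y f ℓ x - ⨅ u, envelope Y f ℓ u := by linarith
  rw [div_le_iff₀ (by positivity)] at h3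
  linarith

/-- One step of an inexact gradient method decreases the Moreau envelope. -/
theorem envelope_step (h : IsNonconvexConcave Y f fx fy ℓ G D) (hℓ : 0 < ℓ)
    {η : ℝ} (hη : 0 ≤ η) (w z u : E) {y : F} (hy : y ∈ Y) :
    envelope Y f ℓ (w - η • u) ≤ envelope Y f ℓ w - η / 8 * ‖envelopeGrad Y f ℓ w‖ ^ 2
      + 2 * ℓ * η * (primal Y f z - f z y) - η * ⟪envelopeGrad Y f ℓ w, u - fx z y⟫
      + 4 * ℓ * G * η * ‖z - w‖ + 2 * ℓ ^ 2 * η * ‖z - w‖ ^ 2 + ℓ * η ^ 2 * ‖u‖ ^ 2 := by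
  have h1 := h.envelope_le_add hℓ w (w - η • u)
  -- With p the proximal point of `w`, f(w, y) + ⟪fx w y, p - w⟫ - ℓ/2 ‖p - w‖² ≤ f(p, y) ≤ Φ(p) ≤
  -- Φ(w) - ℓ‖p - w‖². So the estimated direction correlates with the envelope gradient, up to the
  -- dual gap and the displacement z - w.
  have h2 := h.quadratic_lower hℓ.le w (prox Y f ℓ w) hy
  have h3 := h.le_primal (prox Y f ℓ w) hy
  have h4 := h.prox_le hℓ w w
  have h5 := h.primal_le w z
  have h6 := (abs_le.1 (h.lipschitz w z y hy)).1
  have h7 := h.norm_fx_sub_le hℓ.le w z hy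
  have h8 := real_inner_le_norm (prox Y f ℓ w - w) (fx z y - fx w y)
  rw [sub_self, norm_zero] at h4
  rw [norm_sub_rev w z] at h5 h6 h7
  rw [norm_sub_rev (fx z y)] at h8
  rw [sub_sub_cancel_left, inner_neg_right, real_inner_smul_right, norm_neg, norm_smul,
    Real.norm_of_nonneg hη] at h1
  have e : ⟪envelopeGrad Y f ℓ w, u⟫ = ⟪envelopeGrad Y f ℓ w, u - fx z y⟫
      - 2 * ℓ * (⟪fx w y, prox Y f ℓ w - w⟫ + ⟪prox Y f ℓ w - w, fx z y - fx w y⟫) := by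
    rw [real_inner_comm (prox Y f ℓ w - w) (fx w y), ← inner_add_right, add_sub_cancel,
      inner_sub_right]
    nth_rw 3 [envelopeGrad]
    rw [real_inner_smul_left, ← neg_sub (prox Y f ℓ w) w, inner_neg_left]
    ring
  rw [norm_prox_sub_self hℓ] at h2 h4 h8
  rw [e] at h1
  set g := ‖envelopeGrad Y f ℓ w‖
  set r := ‖z - w‖
  set a := ⟪fx w y, prox Y f ℓ w - w⟫
  set b := ⟪prox Y f ℓ w - w, fx z y - fx w y⟫
  have hr : 0 ≤ r := norm_nonneg _
  have hg : 0 ≤ g := norm_nonneg _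
  have e1 : ℓ * (g / (2 * ℓ)) ^ 2 = g ^ 2 / (4 * ℓ) := by field_simp; ring
  have e2 : g / (2 * ℓ) * (ℓ * r) = g * r / 2 := by field_simp
  have h9 : b ≤ g * r / 2 := by
    rw [← e2]
    exact h8.trans (mul_le_mul_of_nonneg_left h7 (by positivity))
  have e3 : ℓ / 2 * (g / (2 * ℓ)) ^ 2 = g ^ 2 / (8 * ℓ) := by field_simp; ring
  -- Young's inequality is weighted to spend half of the available g²/(8ℓ) on the displacement; the
  -- other half becomes the decrease η/8 g².
  have h10 : g * r / 2 ≤ g ^ 2 / (16 * ℓ) + ℓ * r ^ 2 := by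
    have : g ^ 2 / (16 * ℓ) + ℓ * r ^ 2 - g * r / 2 = (g - 4 * ℓ * r) ^ 2 / (16 * ℓ) := by
      field_simp; ring
    have : 0 ≤ (g - 4 * ℓ * r) ^ 2 / (16 * ℓ) := by positivity
    linarith
  have h11 : a + b ≤ primal Y f z - f z y + 2 * G * r + ℓ * r ^ 2 - g ^ 2 / (16 * ℓ) := by
    rw [e3] at h2
    rw [e1] at h4
    have : g ^ 2 / (4 * ℓ) = 4 * (g ^ 2 / (16 * ℓ)) := by field_simp; ring
    have : g ^ 2 / (8 * ℓ) = 2 * (g ^ 2 / (16 * ℓ)) := by field_simp; ring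
    linarith
  have h12 := mul_le_mul_of_nonneg_left h11 (by positivity : 0 ≤ 2 * ℓ * η)
  have e4 : 2 * ℓ * η * (g ^ 2 / (16 * ℓ)) = η / 8 * g ^ 2 := by field_simp; ring
  nlinarith

end IsNonconvexConcave

/-! ### Norm inequalities, projections and regret of projected methods. -/

theorem two_mul_inner_le_sq_add_sq {F : Type*} [NormedAddCommGroup F] [InnerProductSpace ℝ F]
    (a b : F) (c : ℝ) :
    2 * c * ⟪a, b⟫ ≤ c ^ 2 * ‖a‖ ^ 2 + ‖b‖ ^ 2 := by
  have := norm_sub_sq_real (c • a) b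
  rw [norm_smul, mul_pow, Real.norm_eq_abs, sq_abs, real_inner_smul_left] at this
  nlinarith [sq_nonneg ‖c • a - b‖]

theorem norm_add_add_sq_le {F : Type*} [NormedAddCommGroup F] (a b c : F) :
    ‖a + b + c‖ ^ 2 ≤ 3 * (‖a‖ ^ 2 + ‖b‖ ^ 2 + ‖c‖ ^ 2) := by
  have h := norm_add₃_le (a := a) (b := b) (c := c)
  have h' : ‖a + b + c‖ ^ 2 ≤ (‖a‖ + ‖b‖ + ‖c‖) ^ 2 := by gcongr
  nlinarith [sq_nonneg (‖a‖ - ‖b‖), sq_nonneg (‖b‖ - ‖c‖), sq_nonneg (‖a‖ - ‖c‖)]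

theorem norm_sub_sq_le_of_noise {F : Type*} [NormedAddCommGroup F] (a b v w : F) :
    ‖v - w‖ ^ 2 ≤ 3 * (‖v - a‖ ^ 2 + ‖w - b‖ ^ 2 + ‖a - b‖ ^ 2) := by
  have h := norm_add_add_sq_le (v - a) (b - w) (a - b)
  rwa [norm_sub_rev b w, show v - a + (b - w) + (a - b) = v - w by abel] at h

section Projection

variable {F : Type*} [NormedAddCommGroup F] [InnerProductSpace ℝ F] [FiniteDimensional ℝ F]
  {Y : Set F}

theorem proj_mem (hne : Y.Nonempty) (hcl : IsClosed Y) (hcv : Convex ℝ Y) (u : F) :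
    proj Y u ∈ Y :=
  (proj_spec hne hcl hcv u).1

theorem inner_sub_proj_le_zero (hne : Y.Nonempty) (hcl : IsClosed Y) (hcv : Convex ℝ Y) (u : F)
    {w : F} (hw : w ∈ Y) : ⟪u - proj Y u, w - proj Y u⟫ ≤ 0 :=
  (norm_eq_iInf_iff_real_inner_le_zero hcv (proj_mem hne hcl hcv u)).1
    (proj_spec hne hcl hcv u).2 w hw

theorem proj_eq_self (hne : Y.Nonempty) (hcl : IsClosed Y) (hcv : Convex ℝ Y) {y : F}
    (hy : y ∈ Y) : proj Y y = y := by
  have := inner_sub_proj_le_zero hne hcl hcv y hy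
  rw [real_inner_self_eq_norm_sq] at this
  have h0 : ‖y - proj Y y‖ = 0 := by nlinarith [norm_nonneg (y - proj Y y)]
  exact (sub_eq_zero.1 (norm_eq_zero.1 h0)).symm

theorem norm_proj_sub_le (hne : Y.Nonempty) (hcl : IsClosed Y) (hcv : Convex ℝ Y) (u v : F) :
    ‖proj Y u - proj Y v‖ ≤ ‖u - v‖ := by
  have h1 := inner_sub_proj_le_zero hne hcl hcv u (proj_mem hne hcl hcv v)
  have h2 := inner_sub_proj_le_zero hne hcl hcv v (proj_mem hne hcl hcv u)
  set p := proj Y u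
  set q := proj Y v
  have h3 : ‖p - q‖ ^ 2 ≤ ⟪u - v, p - q⟫ := by
    rw [← real_inner_self_eq_norm_sq]
    simp only [inner_sub_left, inner_sub_right] at h1 h2 ⊢
    linarith [real_inner_comm p q]
  have h4 := real_inner_le_norm (u - v) (p - q)
  by_contra! hlt
  nlinarith [norm_nonneg (u - v)]

theorem continuous_proj (hne : Y.Nonempty) (hcl : IsClosed Y) (hcv : Convex ℝ Y) :
    Continuous (proj Y) := by
  refine (LipschitzWith.of_dist_le_mul (K := 1) fun u v => ?_).continuous
  simpa [dist_eq_norm] using norm_proj_sub_le hne hcl hcv u v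

/-- The three-point inequality for a projected step. -/
theorem two_mul_inner_proj_le (hne : Y.Nonempty) (hcl : IsClosed Y) (hcv : Convex ℝ Y)
    (y₀ g : F) {y : F} (hy : y ∈ Y) :
    2 * ⟪g, y - proj Y (y₀ + g)⟫ ≤ ‖y₀ - y‖ ^ 2 - ‖proj Y (y₀ + g) - y‖ ^ 2
      - ‖proj Y (y₀ + g) - y₀‖ ^ 2 := by
  have h1 := inner_sub_proj_le_zero hne hcl hcv (y₀ + g) hy
  set p := proj Y (y₀ + g)
  have h2 : ‖y₀ - y‖ ^ 2 - ‖p - y‖ ^ 2 - ‖p - y₀‖ ^ 2 = 2 * ⟪p - y₀, y - p⟫ := by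
    simp only [← real_inner_self_eq_norm_sq, inner_sub_left, inner_sub_right]
    linarith [real_inner_comm p y, real_inner_comm p y₀, real_inner_comm y y₀]
  have h3 : y₀ + g - p = g - (p - y₀) := by abel
  rw [h3, inner_sub_left] at h1
  linarith

/-- One projected extragradient step. -/
theorem extragradient_step (hne : Y.Nonempty) (hcl : IsClosed Y) (hcv : Convex ℝ Y)
    (τ : ℝ) (y₀ v v' : F) {y : F} (hy : y ∈ Y) :
    2 * τ * ⟪v', y - proj Y (y₀ + τ • v)⟫ ≤ ‖y₀ - y‖ ^ 2 - ‖proj Y (y₀ + τ • v') - y‖ ^ 2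
      - ‖proj Y (y₀ + τ • v) - y₀‖ ^ 2 + τ ^ 2 * ‖v' - v‖ ^ 2 := by
  have h1 := two_mul_inner_proj_le hne hcl hcv y₀ (τ • v') hy
  -- The half step is compared with the full step `p` rather than with `y`; its term -‖p - q‖² pays
  -- for the mismatch ⟪v' - v, p - q⟫.
  have h2 := two_mul_inner_proj_le hne hcl hcv y₀ (τ • v)
    (proj_mem hne hcl hcv (y₀ + τ • v'))
  set p := proj Y (y₀ + τ • v')
  set q := proj Y (y₀ + τ • v)
  have h3 := two_mul_inner_le_sq_add_sq (v' - v) (p - q) τ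
  have e : ⟪v', y - q⟫ = ⟪v', y - p⟫ + ⟪v, p - q⟫ + ⟪v' - v, p - q⟫ := by
    simp only [inner_sub_left, inner_sub_right]; ring
  rw [real_inner_smul_left] at h1 h2
  rw [norm_sub_rev y₀ p, norm_sub_rev q p] at h2
  rw [e]
  linarith

/-- One projected optimistic gradient step. -/
theorem optimistic_step (hne : Y.Nonempty) (hcl : IsClosed Y) (hcv : Convex ℝ Y)
    (τ : ℝ) (y₀ v₀ v v' : F) {y : F} (hy : y ∈ Y) :
    2 * τ * ⟪v', y - proj Y (y₀ + τ • v + τ • (v - v₀))⟫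
      ≤ ‖y₀ - y‖ ^ 2 - ‖proj Y (y₀ + τ • v + τ • (v - v₀)) - y‖ ^ 2
        - 1 / 2 * ‖proj Y (y₀ + τ • v + τ • (v - v₀)) - y₀‖ ^ 2
        + 2 * τ * ⟪v' - v, y - proj Y (y₀ + τ • v + τ • (v - v₀))⟫
        - 2 * τ * ⟪v - v₀, y - y₀⟫ + 2 * τ ^ 2 * ‖v - v₀‖ ^ 2 := by
  have h1 := two_mul_inner_proj_le hne hcl hcv y₀ (τ • v + τ • (v - v₀)) hy
  rw [← add_assoc] at h1
  set p := proj Y (y₀ + τ • v + τ • (v - v₀))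
  -- The factor 2τ makes this term consume exactly half of -‖p - y₀‖²; the other half is kept for
  -- the next step of the recursion.
  have h2 := two_mul_inner_le_sq_add_sq (v - v₀) (p - y₀) (2 * τ)
  rw [inner_add_left, real_inner_smul_left, real_inner_smul_left] at h1
  have e1 : ⟪v', y - p⟫ = ⟪v, y - p⟫ + ⟪v' - v, y - p⟫ := by
    simp only [inner_sub_left]; ring
  have e2 : ⟪v - v₀, p - y₀⟫ = ⟪v - v₀, y - y₀⟫ - ⟪v - v₀, y - p⟫ := by
    simp only [inner_sub_right]; ring
  rw [e1]
  rw [e2] at h2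
  linarith

/-- The regret of the projected extragradient method. -/
theorem extragradient_regret (hne : Y.Nonempty) (hcl : IsClosed Y) (hcv : Convex ℝ Y)
    {τ D : ℝ} {c : ℝ} (hD : ∀ y ∈ Y, ∀ y' ∈ Y, ‖y - y'‖ ≤ D) (hc : τ ^ 2 * c ≤ 1)
    (y v v' : ℕ → F) (e : ℕ → ℝ) (hy : ∀ t, y t ∈ Y)
    (hstep : ∀ t, y (t + 1) = proj Y (y t + τ • v' t))
    (he : ∀ t, ‖v' t - v t‖ ^ 2 ≤ e t + c * ‖proj Y (y t + τ • v t) - y t‖ ^ 2)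
    (s n : ℕ) {u : F} (hu : u ∈ Y) :
    2 * τ * ∑ i ∈ Finset.range n, ⟪v' (s + i), u - proj Y (y (s + i) + τ • v (s + i))⟫
      ≤ D ^ 2 + τ ^ 2 * ∑ i ∈ Finset.range n, e (s + i) := by
  have key : ∀ n, 2 * τ * ∑ i ∈ Finset.range n,
      ⟪v' (s + i), u - proj Y (y (s + i) + τ • v (s + i))⟫
      ≤ ‖y s - u‖ ^ 2 - ‖y (s + n) - u‖ ^ 2 + τ ^ 2 * ∑ i ∈ Finset.range n, e (s + i) := by
    intro n
    induction n with
    | zero => simp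
    | succ n ih =>
      rw [Finset.sum_range_succ, Finset.sum_range_succ]
      have h1 := extragradient_step hne hcl hcv τ (y (s + n)) (v (s + n)) (v' (s + n)) hu
      rw [← hstep] at h1
      have h2 := he (s + n)
      rw [show s + (n + 1) = s + n + 1 by ring]
      nlinarith [mul_le_mul_of_nonneg_left h2 (sq_nonneg τ),
        mul_le_mul_of_nonneg_right hc (sq_nonneg ‖proj Y (y (s + n) + τ • v (s + n)) - y (s + n)‖)]
  have h1 := hD _ (hy s) u hu
  nlinarith [key n, norm_nonneg (y s - u), sq_nonneg ‖y (s + n) - u‖]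

/-- The regret of the projected optimistic gradient method. -/
theorem optimistic_regret (hne : Y.Nonempty) (hcl : IsClosed Y) (hcv : Convex ℝ Y)
    {τ D : ℝ} {c : ℝ} (hD : ∀ y ∈ Y, ∀ y' ∈ Y, ‖y - y'‖ ≤ D) (hc : 4 * (τ ^ 2 * c) ≤ 1)
    (y v : ℕ → F) (e : ℕ → ℝ) (hy : ∀ t, y t ∈ Y)
    (hstep : ∀ t, y (t + 1) = proj Y (y t + τ • v (t + 1) + τ • (v (t + 1) - v t)))
    (he0 : ∀ t, 0 ≤ e t)
    (he : ∀ t, ‖v (t + 1) - v t‖ ^ 2 ≤ e t + c * ‖y t - y (t - 1)‖ ^ 2)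
    (s n : ℕ) {u : F} (hu : u ∈ Y) :
    2 * τ * ∑ i ∈ Finset.range n, ⟪v (s + i + 2), u - y (s + i + 1)⟫
      ≤ 4 * D ^ 2 + 3 * τ ^ 2 * ∑ i ∈ Finset.range (n + 1), e (s + i) := by
  let A : ℕ → ℝ := fun t => 2 * τ * ⟪v (t + 1) - v t, u - y t⟫
  -- The potential carries the optimistic cross term and half of the last squared step, which
  -- absorbs the gradient variation because 4τ²c ≤ 1. At t = 0 the truncated index t - 1 encodes y₋₁
  -- = y₀.
  let P : ℕ → ℝ := fun t => ‖y t - u‖ ^ 2 - A t + 1 / 2 * ‖y t - y (t - 1)‖ ^ 2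
  have key : ∀ n, 2 * τ * ∑ i ∈ Finset.range n, ⟪v (s + i + 2), u - y (s + i + 1)⟫
      ≤ P s - P (s + n) + 2 * τ ^ 2 * ∑ i ∈ Finset.range n, e (s + i) := by
    intro n
    induction n with
    | zero => simp
    | succ n ih =>
      rw [Finset.sum_range_succ, Finset.sum_range_succ]
      have h1 := optimistic_step hne hcl hcv τ (y (s + n)) (v (s + n)) (v (s + n + 1))
        (v (s + n + 2)) hu
      rw [← hstep] at h1
      have h2 := he (s + n)
      have h3 : P (s + (n + 1)) = ‖y (s + n + 1) - u‖ ^ 2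
          - 2 * τ * ⟪v (s + n + 2) - v (s + n + 1), u - y (s + n + 1)⟫
          + 1 / 2 * ‖y (s + n + 1) - y (s + n)‖ ^ 2 := rfl
      have h4 : P (s + n) = ‖y (s + n) - u‖ ^ 2
          - 2 * τ * ⟪v (s + n + 1) - v (s + n), u - y (s + n)⟫
          + 1 / 2 * ‖y (s + n) - y (s + n - 1)‖ ^ 2 := rfl
      rw [h3]
      rw [h4] at ih
      nlinarith [mul_le_mul_of_nonneg_left h2 (sq_nonneg τ),
        mul_le_mul_of_nonneg_right hc (sq_nonneg ‖y (s + n) - y (s + n - 1)‖)]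
  have hsq : ∀ y ∈ Y, ∀ y' ∈ Y, ‖y - y'‖ ^ 2 ≤ D ^ 2 := fun y hy y' hy' =>
    pow_le_pow_left₀ (norm_nonneg _) (hD y hy y' hy') 2
  -- The cross terms survive only at the two ends of the sum. The one at s + n involves e (s + n),
  -- which is why n + 1 errors appear in the conclusion.
  have hA : ∀ t, |A t| ≤ τ ^ 2 * e t + 5 / 4 * D ^ 2 := by
    intro t
    have h1 := two_mul_inner_le_sq_add_sq (v (t + 1) - v t) (u - y t) τ
    have h2 := two_mul_inner_le_sq_add_sq (v (t + 1) - v t) (u - y t) (-τ)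
    have h3 := mul_le_mul_of_nonneg_left (he t) (sq_nonneg τ)
    have h4 := hsq u hu _ (hy t)
    have h5 := hsq _ (hy t) _ (hy (t - 1))
    have h6 : τ ^ 2 * c * ‖y t - y (t - 1)‖ ^ 2 ≤ 1 / 4 * D ^ 2 :=
      mul_le_mul (by linarith) h5 (sq_nonneg _) (by norm_num)
    rw [abs_le]
    constructor <;> simp only [A] <;> nlinarith
  have h1 := abs_le.1 (hA s)
  have h2 := abs_le.1 (hA (s + n))
  have h3 := hsq _ (hy s) u hu
  have h4 := hsq _ (hy s) _ (hy (s - 1))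
  have h5 : P s ≤ 3 / 2 * D ^ 2 + (τ ^ 2 * e s + 5 / 4 * D ^ 2) := by
    simp only [P]; linarith
  have h6 : -P (s + n) ≤ τ ^ 2 * e (s + n) + 5 / 4 * D ^ 2 := by
    simp only [P]; nlinarith [sq_nonneg ‖y (s + n) - u‖, sq_nonneg ‖y (s + n) - y (s + n - 1)‖]
  have h7 : e s ≤ ∑ i ∈ Finset.range (n + 1), e (s + i) := by
    have := Finset.single_le_sum (f := fun i => e (s + i)) (fun i _ => he0 (s + i))
      (Finset.mem_range.2 (Nat.succ_pos n))
    simpa using this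
  have h8 := Finset.sum_range_succ (fun i => e (s + i)) n
  have h9 := he0 (s + n)
  nlinarith [key n, mul_le_mul_of_nonneg_left h7 (sq_nonneg τ), mul_nonneg (sq_nonneg τ) h9]

end Projection

/-! ### Square-integrable errors and fresh samples. -/

section SquareIntegrable

variable {Ω V : Type*} [MeasurableSpace Ω] {P : Measure Ω}
  [NormedAddCommGroup V] [InnerProductSpace ℝ V]

theorem integrable_inner_of_memLp {φ ψ : Ω → V} (hφ : MemLp φ 2 P) (hψ : MemLp ψ 2 P) :
    Integrable (fun ω => ⟪φ ω, ψ ω⟫) P := by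
  refine ((hφ.integrable_norm_pow two_ne_zero).add (hψ.integrable_norm_pow two_ne_zero)).mono'
    (hφ.aestronglyMeasurable.inner hψ.aestronglyMeasurable)
    (Filter.Eventually.of_forall fun ω => ?_)
  rw [Real.norm_eq_abs, Pi.add_apply]
  have := abs_real_inner_le_norm (φ ω) (ψ ω)
  nlinarith [sq_nonneg (‖φ ω‖ - ‖ψ ω‖), sq_nonneg ‖φ ω‖, sq_nonneg ‖ψ ω‖]

/-- Pointwise ‖φ‖ ≤ ‖φ‖²/(2M) + M/2, so Jensen's inequality is not needed. -/
theorem integral_norm_le_of_sq_le {V : Type*} [NormedAddCommGroup V] [IsProbabilityMeasure P]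
    {φ : Ω → V} (hφ : MemLp φ 2 P) {M : ℝ} (hM : 0 < M) (h : ∫ ω, ‖φ ω‖ ^ 2 ∂P ≤ M ^ 2) : ∫ ω, ‖φ ω‖ ∂P ≤ M := by
  have h1 : ∫ ω, ‖φ ω‖ ∂P ≤ ∫ ω, (‖φ ω‖ ^ 2 / (2 * M) + M / 2) ∂P := by
    refine integral_mono (hφ.integrable one_le_two).norm
      (((hφ.integrable_norm_pow two_ne_zero).div_const _).add (integrable_const _)) fun ω => ?_
    have : ‖φ ω‖ ^ 2 / (2 * M) + M / 2 - ‖φ ω‖ = (‖φ ω‖ - M) ^ 2 / (2 * M) := by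
      field_simp; ring
    have : 0 ≤ (‖φ ω‖ - M) ^ 2 / (2 * M) := by positivity
    simp only
    linarith
  rw [integral_add ((hφ.integrable_norm_pow two_ne_zero).div_const _) (integrable_const _),
    integral_div, integral_const, probReal_univ, one_smul] at h1
  have h2 : (∫ ω, ‖φ ω‖ ^ 2 ∂P) / (2 * M) ≤ M ^ 2 / (2 * M) := by gcongr
  have h3 : M ^ 2 / (2 * M) = M / 2 := by field_simp
  linarith

end SquareIntegrable

/-- This product law stands in for conditioning on the past: Fubini then integrates out the fresh
sample with everything earlier held fixed. -/
theorem map_prodMk_eq_of_indep {Ω Ξ α : Type*} {m₁ : MeasurableSpace Ω} [mΩ : MeasurableSpace Ω]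
    {P : Measure Ω} [IsProbabilityMeasure P] [MeasurableSpace Ξ] {ν : Measure Ξ} (hm : m₁ ≤ mΩ)
    {ξ : Ω → Ξ} (hξ : Measurable ξ) (hlaw : P.map ξ = ν)
    (hind : Indep m₁ (MeasurableSpace.comap ξ inferInstance) P) [MeasurableSpace α] {A : Ω → α}
    (hA : Measurable[m₁] A) : P.map (fun ω => (A ω, ξ ω)) = (P.map A).prod ν := by
  have hi : IndepFun A ξ P := by
    rw [IndepFun_iff_Indep]
    exact indep_of_indep_of_le_left hind hA.comap_le
  rw [← hlaw]
  exact (indepFun_iff_map_prod_eq_prod_map_map (hA.mono hm le_rfl).aemeasurable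
    hξ.aemeasurable).1 hi

/-- `N` is a square-integrable error with second moment at most `σ²` that is orthogonal to every
square-integrable variable determined by `m₁`. -/
structure IsNoise {Ω V : Type*} (m₁ : MeasurableSpace Ω) [mΩ : MeasurableSpace Ω] (P : Measure Ω)
    [NormedAddCommGroup V] [InnerProductSpace ℝ V] [MeasurableSpace V] (N : Ω → V) (σ : ℝ) :
    Prop where
  memLp : MemLp N 2 P
  sq_le : ∫ ω, ‖N ω‖ ^ 2 ∂P ≤ σ ^ 2
  integral_inner : ∀ φ : Ω → V, Measurable[m₁] φ → MemLp φ 2 P → ∫ ω, ⟪φ ω, N ω⟫ ∂P = 0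

section Oracle

variable {Ω E F V Ξ : Type*} [MeasurableSpace E]
  [NormedAddCommGroup F] [MeasurableSpace F] [BorelSpace F]
  [NormedAddCommGroup V] [InnerProductSpace ℝ V] [FiniteDimensional ℝ V] [MeasurableSpace V]
  [BorelSpace V] [MeasurableSpace Ξ]
  {Y : Set F} {h : E → F → V} {ν : Measure Ξ} {g : E → F → Ξ → V} {σ : ℝ}

/-- The oracle error at a random point `(X, Q)` independent of the sample `ξ`. -/
theorem IsUnbiasedOracle.noise {m₁ : MeasurableSpace Ω} [mΩ : MeasurableSpace Ω] {P : Measure Ω} [IsProbabilityMeasure P]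
    (hg : IsUnbiasedOracle Y h ν g σ) (hcl : IsClosed Y)
    (hproj : ∀ y ∈ Y, proj Y y = y)
    (hh : Measurable fun q : E × F => h q.1 (proj Y q.2))
    (hm : m₁ ≤ mΩ) {ξ : Ω → Ξ} (hξ : Measurable ξ) (hlaw : P.map ξ = ν)
    (hind : Indep m₁ (MeasurableSpace.comap ξ inferInstance) P)
    {X : Ω → E} {Q : Ω → F} (hX : Measurable[m₁] X) (hQ : Measurable[m₁] Q)
    (hQY : ∀ ω, Q ω ∈ Y) :
    IsNoise m₁ P (fun ω => g (X ω) (Q ω) (ξ ω) - h (X ω) (Q ω)) σ := by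
  have : CompleteSpace V := FiniteDimensional.complete ℝ V
  have : ProperSpace V := FiniteDimensional.proper ℝ V
  have : IsProbabilityMeasure ν := hlaw ▸ Measure.isProbabilityMeasure_map hξ.aemeasurable
  let N : (E × F) × Ξ → V := fun q => g q.1.1 q.1.2 q.2 - h q.1.1 (proj Y q.1.2)
  have hN : Measurable N := (hg.measurable.comp (by fun_prop :
    Measurable fun q : (E × F) × Ξ => (q.1.1, q.1.2, q.2))).sub (hh.comp measurable_fst)
  have hNY : ∀ a : E × F, a.2 ∈ Y → ∀ ζ, N (a, ζ) = g a.1 a.2 ζ - h a.1 a.2 := by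
    intro a ha ζ
    simp only [N, hproj a.2 ha]
  have hNω : ∀ ω, g (X ω) (Q ω) (ξ ω) - h (X ω) (Q ω) = N ((X ω, Q ω), ξ ω) := fun ω =>
    (hNY (X ω, Q ω) (hQY ω) (ξ ω)).symm
  have hX' : Measurable X := hX.mono hm le_rfl
  have hQ' : Measurable Q := hQ.mono hm le_rfl
  have hsq : ∫⁻ ω, ENNReal.ofReal (‖N ((X ω, Q ω), ξ ω)‖ ^ 2) ∂P ≤ ENNReal.ofReal (σ ^ 2) := by
    have hA : Measurable[m₁] fun ω => (X ω, Q ω) := hX.prodMk hQ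
    have hA' := hA.mono hm le_rfl
    have hNm : Measurable fun q => ENNReal.ofReal (‖N q‖ ^ 2) := by fun_prop
    rw [← lintegral_map (f := fun q => ENNReal.ofReal (‖N q‖ ^ 2)) hNm (hA'.prodMk hξ), map_prodMk_eq_of_indep hm hξ hlaw hind hA,
      lintegral_prod _ hNm.aemeasurable]
    have : IsProbabilityMeasure (P.map fun ω => (X ω, Q ω)) :=
      Measure.isProbabilityMeasure_map hA'.aemeasurable
    have hYae : ∀ᵐ a ∂(P.map fun ω => (X ω, Q ω)), a.2 ∈ Y := by
      rw [ae_map_iff hA'.aemeasurable (measurable_snd hcl.measurableSet)]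
      exact Filter.Eventually.of_forall hQY
    calc _ ≤ ∫⁻ _, ENNReal.ofReal (σ ^ 2) ∂(P.map fun ω => (X ω, Q ω)) := by
          refine lintegral_mono_ae (hYae.mono fun a ha => ?_)
          simp only [hNY a ha]
          rw [← ofReal_integral_eq_lintegral_ofReal (hg.integrable a.1 a.2 ha)
            (Filter.Eventually.of_forall fun _ => by positivity)]
          exact ENNReal.ofReal_le_ofReal (hg.variance_le a.1 a.2 ha)
      _ = ENNReal.ofReal (σ ^ 2) := by simp
  simp only [hNω]
  have hmeas : Measurable fun ω => N ((X ω, Q ω), ξ ω) := hN.comp ((hX'.prodMk hQ').prodMk hξ)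
  have hint : Integrable (fun ω => ‖N ((X ω, Q ω), ξ ω)‖ ^ 2) P := by
    refine ⟨(by fun_prop : Measurable _).aestronglyMeasurable, ?_⟩
    rw [hasFiniteIntegral_iff_ofReal (Filter.Eventually.of_forall fun _ => by positivity)]
    exact hsq.trans_lt ENNReal.ofReal_lt_top
  have hmem : MemLp (fun ω => N ((X ω, Q ω), ξ ω)) 2 P :=
    (memLp_two_iff_integrable_sq_norm hmeas.aestronglyMeasurable).2 hint
  refine ⟨hmem, ?_, fun φ hφ hφ2 => ?_⟩
  · rw [integral_eq_lintegral_of_nonneg_ae (Filter.Eventually.of_forall fun _ => by positivity)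
      hint.aestronglyMeasurable]
    exact ENNReal.toReal_le_of_le_ofReal (sq_nonneg σ) hsq
  · have hA : Measurable[m₁] fun ω => ((X ω, Q ω), φ ω) := (hX.prodMk hQ).prodMk hφ
    have hA' := hA.mono hm le_rfl
    let K : ((E × F) × V) × Ξ → ℝ := fun q => ⟪q.1.2, N (q.1.1, q.2)⟫
    have hK : Measurable K := by
      have : Measurable fun q : ((E × F) × V) × Ξ => N (q.1.1, q.2) := hN.comp (by fun_prop)
      exact Measurable.inner (by fun_prop) this
    have hKint : Integrable K (P.map fun ω => (((X ω, Q ω), φ ω), ξ ω)) := by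
      rw [integrable_map_measure hK.aestronglyMeasurable (hA'.prodMk hξ).aemeasurable]
      exact integrable_inner_of_memLp hφ2 hmem
    have e : ∫ ω, ⟪φ ω, N ((X ω, Q ω), ξ ω)⟫ ∂P
        = ∫ q, K q ∂(P.map fun ω => (((X ω, Q ω), φ ω), ξ ω)) :=
      (integral_map (hA'.prodMk hξ).aemeasurable hK.aestronglyMeasurable).symm
    rw [map_prodMk_eq_of_indep hm hξ hlaw hind hA] at e hKint
    rw [e, integral_prod _ hKint]
    have hYae : ∀ᵐ a ∂(P.map fun ω => ((X ω, Q ω), φ ω)), a.1.2 ∈ Y := by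
      have hYm : MeasurableSet {a : (E × F) × V | a.1.2 ∈ Y} :=
        (measurable_snd.comp measurable_fst) hcl.measurableSet
      exact (ae_map_iff hA'.aemeasurable hYm).2 (Filter.Eventually.of_forall hQY)
    refine integral_eq_zero_of_ae (hYae.mono fun a ha => ?_)
    simp only [K, hNY a.1 ha, Pi.zero_apply]
    have hgm : Measurable fun ζ => g a.1.1 a.1.2 ζ - h a.1.1 a.1.2 :=
      (hg.measurable.comp (by fun_prop : Measurable fun ζ : Ξ => (a.1.1, a.1.2, ζ))).sub_const _
    have hgi : Integrable (fun ζ => g a.1.1 a.1.2 ζ - h a.1.1 a.1.2) ν :=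
      ((memLp_two_iff_integrable_sq_norm hgm.aestronglyMeasurable).2
        (hg.integrable a.1.1 a.1.2 ha)).integrable one_le_two
    have hgi' : Integrable (fun ζ => g a.1.1 a.1.2 ζ) ν := by
      refine (hgi.add (integrable_const (h a.1.1 a.1.2))).congr (Filter.Eventually.of_forall ?_)
      intro ζ
      simp
    have := (innerSL ℝ a.2).integral_comp_comm hgi
    simp only [innerSL_apply_apply] at this
    rw [this, integral_sub hgi' (integrable_const _), hg.unbiased _ _ ha]
    simp

end Oracle

/-! ### The filtration generated by the samples. -/

section Sampling

variable {Ω Ξx Ξy : Type*} [MeasurableSpace Ξx] [MeasurableSpace Ξy] {ξx : ℕ → Ω → Ξx} {ξy : ℕ → Ω → Ξy}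

/-- The σ-algebra generated by the first `k` pairs of samples. -/
abbrev past (ξx : ℕ → Ω → Ξx) (ξy : ℕ → Ω → Ξy) (k : ℕ) : MeasurableSpace Ω :=
  ⨆ i ∈ Set.Iio k, MeasurableSpace.comap (fun ω => (ξx i ω, ξy i ω)) inferInstance

theorem past_mono {j k : ℕ} (hjk : j ≤ k) : past ξx ξy j ≤ past ξx ξy k :=
  biSup_mono fun _ hi => lt_of_lt_of_le hi hjk

theorem measurable_past_pair {i k : ℕ} (hik : i < k) :
    Measurable[past ξx ξy k] fun ω => (ξx i ω, ξy i ω) :=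
  Measurable.of_comap_le (le_biSup
    (fun i => MeasurableSpace.comap (fun ω => (ξx i ω, ξy i ω)) inferInstance) hik)

theorem measurable_past_left {i k : ℕ} (hik : i < k) : Measurable[past ξx ξy k] (ξx i) :=
  measurable_fst.comp (measurable_past_pair hik)

theorem measurable_past_right {i k : ℕ} (hik : i < k) : Measurable[past ξx ξy k] (ξy i) :=
  measurable_snd.comp (measurable_past_pair hik)

namespace IsSampling

variable [mΩ : MeasurableSpace Ω] {P : Measure Ω} {νx : Measure Ξx} {νy : Measure Ξy}

theorem past_le (hs : IsSampling P νx νy ξx ξy) (k : ℕ) : past ξx ξy k ≤ mΩ :=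
  iSup₂_le fun i _ => ((hs.measurable_x i).prodMk (hs.measurable_y i)).comap_le

theorem indep_past (hs : IsSampling P νx νy ξx ξy) (k : ℕ) :
    Indep (past ξx ξy k)
      (MeasurableSpace.comap (fun ω => (ξx k ω, ξy k ω)) inferInstance) P := by
  have := indep_iSup_of_disjoint
    (fun i => ((hs.measurable_x i).prodMk (hs.measurable_y i)).comap_le) hs.indep.iIndep
    (S := Set.Iio k) (T := {k}) (by simp)
  rwa [iSup_singleton] at this

theorem indep_past_left (hs : IsSampling P νx νy ξx ξy) (k : ℕ) :
    Indep (past ξx ξy k) (MeasurableSpace.comap (ξx k) inferInstance) P := by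
  refine indep_of_indep_of_le_right (hs.indep_past k) ?_
  exact (measurable_fst.comp (comap_measurable fun ω => (ξx k ω, ξy k ω))).comap_le

theorem indep_past_right (hs : IsSampling P νx νy ξx ξy) (k : ℕ) :
    Indep (past ξx ξy k) (MeasurableSpace.comap (ξy k) inferInstance) P := by
  refine indep_of_indep_of_le_right (hs.indep_past k) ?_
  exact (measurable_snd.comp (comap_measurable fun ω => (ξx k ω, ξy k ω))).comap_le

end IsSampling

end Sampling

namespace IsNonconvexConcave

variable {E F : Type*} [NormedAddCommGroup E] [InnerProductSpace ℝ E]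
  [NormedAddCommGroup F] [InnerProductSpace ℝ F] [FiniteDimensional ℝ F]
  {Y : Set F} {f : E → F → ℝ} {fx : E → F → E} {fy : E → F → F} {ℓ G D : ℝ}

theorem proj_mem (h : IsNonconvexConcave Y f fx fy ℓ G D) (u : F) : proj Y u ∈ Y :=
  NCC.proj_mem h.nonempty h.isClosed h.convex u

theorem proj_eq_self (h : IsNonconvexConcave Y f fx fy ℓ G D) {y : F} (hy : y ∈ Y) :
    proj Y y = y :=
  NCC.proj_eq_self h.nonempty h.isClosed h.convex hy

theorem continuous_proj (h : IsNonconvexConcave Y f fx fy ℓ G D) : Continuous (proj Y) :=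
  NCC.continuous_proj h.nonempty h.isClosed h.convex

/-- Composition with the projection extends a field from E × Y to a continuous one on E × F;
measurability of the exact gradients along the iterates rests on this. -/
theorem continuous_of_sq_le (h : IsNonconvexConcave Y f fx fy ℓ G D) {V : Type*}
    [NormedAddCommGroup V] (v : E → F → V)
    (hv : ∀ x₁ x₂ : E, ∀ y₁ ∈ Y, ∀ y₂ ∈ Y,
      ‖v x₁ y₁ - v x₂ y₂‖ ^ 2 ≤ ℓ ^ 2 * ‖x₁ - x₂‖ ^ 2 + ℓ ^ 2 * ‖y₁ - y₂‖ ^ 2) :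
    Continuous fun q : E × F => v q.1 (proj Y q.2) := by
  refine (LipschitzWith.of_dist_le_mul (K := (2 * |ℓ|).toNNReal) fun p q => ?_).continuous
  rw [Real.coe_toNNReal _ (by positivity), dist_eq_norm]
  have h1 := hv p.1 q.1 _ (h.proj_mem p.2) _ (h.proj_mem q.2)
  have h2 : ‖p.1 - q.1‖ ≤ dist p q := by
    rw [← dist_eq_norm, Prod.dist_eq]; exact le_max_left _ _
  have h3 : ‖proj Y p.2 - proj Y q.2‖ ≤ dist p q := by
    refine (norm_proj_sub_le h.nonempty h.isClosed h.convex _ _).trans ?_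
    rw [← dist_eq_norm, Prod.dist_eq]; exact le_max_right _ _
  refine abs_le_of_sq_le_sq' ?_ (by positivity) |>.2
  rw [mul_pow, mul_pow, sq_abs]
  have h4 := pow_le_pow_left₀ (norm_nonneg _) h2 2
  have h5 := pow_le_pow_left₀ (norm_nonneg _) h3 2
  nlinarith [mul_le_mul_of_nonneg_left h4 (sq_nonneg ℓ), mul_le_mul_of_nonneg_left h5 (sq_nonneg ℓ),
    mul_nonneg (sq_nonneg ℓ) (sq_nonneg (dist p q))]

theorem continuous_fx_proj (h : IsNonconvexConcave Y f fx fy ℓ G D) :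
    Continuous fun q : E × F => fx q.1 (proj Y q.2) :=
  h.continuous_of_sq_le fx fun _ _ _ h₁ _ h₂ => h.fx_sub_sq_le _ _ h₁ h₂

theorem continuous_fy_proj (h : IsNonconvexConcave Y f fx fy ℓ G D) :
    Continuous fun q : E × F => fy q.1 (proj Y q.2) :=
  h.continuous_of_sq_le fy fun _ _ _ h₁ _ h₂ => h.fy_sub_sq_le _ _ h₁ h₂

end IsNonconvexConcave

/-! ### Abstract schemes and the primal-dual gap in blocks. -/

/-- A stochastic first-order scheme: the points `(Z t, Q t)` at which the oracle is evaluated, the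
estimates `U t` and `V t` it returns there, and the anchors `W t`, which follow exact steps
`W (t + 1) = W t - η U t` and stay close to `Z t`. The dual points `Q t` have small regret. -/
structure IsScheme {Ω E F : Type*} [mΩ : MeasurableSpace Ω]
    [NormedAddCommGroup E] [InnerProductSpace ℝ E] [MeasurableSpace E]
    [NormedAddCommGroup F] [InnerProductSpace ℝ F] [MeasurableSpace F]
    (P : Measure Ω) (m : ℕ → MeasurableSpace Ω) (Y : Set F) (fx : E → F → E) (fy : E → F → F)
    (η σ M K₁ K₂ : ℝ) (x₀ : E) (W Z H U : ℕ → Ω → E) (Q V : ℕ → Ω → F) : Prop where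
  le : ∀ t, m t ≤ mΩ
  mono : Monotone m
  measurable_W : ∀ t, Measurable[m t] (W t)
  measurable_Z : ∀ t, Measurable[m t] (Z t)
  measurable_Q : ∀ t, Measurable[m t] (Q t)
  measurable_V : ∀ t, Measurable[m (t + 1)] (V t)
  mem : ∀ t ω, Q t ω ∈ Y
  W_succ : ∀ t ω, W (t + 1) ω = W t ω - η • U t ω
  Z_eq : ∀ t ω, Z t ω = W t ω - η • H t ω
  noise_x : ∀ t, IsNoise (m t) P (fun ω => U t ω - fx (Z t ω) (Q t ω)) σ
  noise_y : ∀ t, IsNoise (m t) P (fun ω => V t ω - fy (Z t ω) (Q t ω)) σ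
  memLp_H : ∀ t, MemLp (H t) 2 P
  sq_H : ∀ t, ∫ ω, ‖H t ω‖ ^ 2 ∂P ≤ 2 * M ^ 2
  memLp_zero : MemLp (fun ω => W 0 ω - x₀) 2 P
  sq_zero : ∫ ω, ‖W 0 ω - x₀‖ ^ 2 ∂P ≤ 4 * η ^ 2 * σ ^ 2
  integral_inner_zero : ∀ c : E, ∫ ω, ⟪c, W 0 ω - x₀⟫ ∂P = 0
  regret : ∀ s n : ℕ, ∃ R : Ω → ℝ, Integrable R P ∧
    (∀ ω, ∀ u ∈ Y, ∑ i ∈ Finset.range n, ⟪V (s + i) ω, u - Q (s + i) ω⟫ ≤ R ω) ∧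
    ∫ ω, R ω ∂P ≤ K₁ + (n + 1) * K₂

section Bounded

variable {Ω E F : Type*} {m₁ : MeasurableSpace Ω}
  [NormedAddCommGroup E] [InnerProductSpace ℝ E] [FiniteDimensional ℝ E] [MeasurableSpace E]
  [BorelSpace E]
  [NormedAddCommGroup F] [InnerProductSpace ℝ F] [FiniteDimensional ℝ F] [MeasurableSpace F]
  [BorelSpace F]
  {Y : Set F} {f : E → F → ℝ} {fx : E → F → E} {fy : E → F → F} {ℓ G D σ : ℝ}

theorem IsNonconvexConcave.measurable_fx (h : IsNonconvexConcave Y f fx fy ℓ G D)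
    {Z : Ω → E} {Q : Ω → F} (hZ : Measurable[m₁] Z) (hQ : Measurable[m₁] Q) (hY : ∀ ω, Q ω ∈ Y) :
    Measurable[m₁] fun ω => fx (Z ω) (Q ω) := by
  have : ProperSpace E := FiniteDimensional.proper ℝ E
  have h1 := h.continuous_fx_proj.measurable.comp (hZ.prodMk hQ)
  refine (congrArg (Measurable[m₁]) (funext fun ω => ?_)).mp h1
  simp only [Function.comp_apply, h.proj_eq_self (hY ω)]

theorem IsNonconvexConcave.measurable_fy (h : IsNonconvexConcave Y f fx fy ℓ G D)
    {Z : Ω → E} {Q : Ω → F} (hZ : Measurable[m₁] Z) (hQ : Measurable[m₁] Q) (hY : ∀ ω, Q ω ∈ Y) :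
    Measurable[m₁] fun ω => fy (Z ω) (Q ω) := by
  have : ProperSpace E := FiniteDimensional.proper ℝ E
  have h1 := h.continuous_fy_proj.measurable.comp (hZ.prodMk hQ)
  refine (congrArg (Measurable[m₁]) (funext fun ω => ?_)).mp h1
  simp only [Function.comp_apply, h.proj_eq_self (hY ω)]

/-- Second moment of a stochastic gradient in `x`. -/
theorem IsNoise.memLp_fx [mΩ : MeasurableSpace Ω] {P : Measure Ω} [IsProbabilityMeasure P]
    (h : IsNonconvexConcave Y f fx fy ℓ G D) (hG : 0 ≤ G)
    (hm : m₁ ≤ mΩ) {Z U : Ω → E} {Q : Ω → F} (hZ : Measurable[m₁] Z) (hQ : Measurable[m₁] Q)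
    (hY : ∀ ω, Q ω ∈ Y) (hN : IsNoise m₁ P (fun ω => U ω - fx (Z ω) (Q ω)) σ) :
    MemLp U 2 P ∧ ∫ ω, ‖U ω‖ ^ 2 ∂P ≤ 2 * (G ^ 2 + σ ^ 2) := by
  have : ProperSpace E := FiniteDimensional.proper ℝ E
  have h1 : MemLp (fun ω => fx (Z ω) (Q ω)) 2 P :=
    MemLp.of_bound ((h.measurable_fx hZ hQ hY).mono hm le_rfl).aestronglyMeasurable G
      (Filter.Eventually.of_forall fun ω => h.norm_fx_le hG _ (hY ω))
  have h2 : MemLp U 2 P := by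
    refine (hN.memLp.add h1).ae_eq (Filter.Eventually.of_forall fun ω => ?_)
    simp
  refine ⟨h2, ?_⟩
  have hNi := hN.memLp.integrable_norm_pow two_ne_zero
  calc ∫ ω, ‖U ω‖ ^ 2 ∂P
      ≤ ∫ ω, (2 * G ^ 2 + 2 * ‖U ω - fx (Z ω) (Q ω)‖ ^ 2) ∂P := by
        refine integral_mono (h2.integrable_norm_pow two_ne_zero)
          ((integrable_const _).add (hNi.const_mul 2)) fun ω => ?_
        have e := norm_le_norm_add_norm_sub (fx (Z ω) (Q ω)) (U ω)
        rw [norm_sub_rev] at e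
        have e2 := h.norm_fx_le hG (Z ω) (hY ω)
        have e3 := norm_nonneg (U ω)
        have e4 := norm_nonneg (fx (Z ω) (Q ω))
        simp only
        nlinarith [sq_nonneg (‖fx (Z ω) (Q ω)‖ - ‖U ω - fx (Z ω) (Q ω)‖)]
    _ = 2 * G ^ 2 + 2 * ∫ ω, ‖U ω - fx (Z ω) (Q ω)‖ ^ 2 ∂P := by
        rw [integral_add (integrable_const _) (hNi.const_mul 2), integral_const, probReal_univ,
          one_smul, integral_const_mul]
    _ ≤ 2 * (G ^ 2 + σ ^ 2) := by linarith [hN.sq_le]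

end Bounded

namespace IsScheme

variable {Ω E F : Type*} [mΩ : MeasurableSpace Ω]
  [NormedAddCommGroup E] [InnerProductSpace ℝ E] [FiniteDimensional ℝ E] [MeasurableSpace E]
  [BorelSpace E]
  [NormedAddCommGroup F] [InnerProductSpace ℝ F] [FiniteDimensional ℝ F] [MeasurableSpace F]
  [BorelSpace F]
  {P : Measure Ω} [IsProbabilityMeasure P] {m : ℕ → MeasurableSpace Ω}
  {Y : Set F} {f : E → F → ℝ} {fx : E → F → E} {fy : E → F → F} {ℓ G D η σ M K₁ K₂ : ℝ}
  {x₀ : E} {W Z H U : ℕ → Ω → E} {Q V : ℕ → Ω → F}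

theorem memLp_U (S : IsScheme P m Y fx fy η σ M K₁ K₂ x₀ W Z H U Q V)
    (h : IsNonconvexConcave Y f fx fy ℓ G D) (hG : 0 ≤ G) (t : ℕ) : MemLp (U t) 2 P :=
  ((S.noise_x t).memLp_fx h hG (S.le t) (S.measurable_Z t) (S.measurable_Q t) (S.mem t)).1

theorem sq_U (S : IsScheme P m Y fx fy η σ M K₁ K₂ x₀ W Z H U Q V)
    (h : IsNonconvexConcave Y f fx fy ℓ G D) (hG : 0 ≤ G) (hM : G ^ 2 + σ ^ 2 = M ^ 2) (t : ℕ) :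
    ∫ ω, ‖U t ω‖ ^ 2 ∂P ≤ 2 * M ^ 2 :=
  hM ▸ ((S.noise_x t).memLp_fx h hG (S.le t) (S.measurable_Z t) (S.measurable_Q t) (S.mem t)).2

theorem integral_norm_U (S : IsScheme P m Y fx fy η σ M K₁ K₂ x₀ W Z H U Q V)
    (h : IsNonconvexConcave Y f fx fy ℓ G D) (hG : 0 ≤ G) (hM : G ^ 2 + σ ^ 2 = M ^ 2)
    (hM0 : 0 < M) (t : ℕ) : ∫ ω, ‖U t ω‖ ∂P ≤ 2 * M :=
  integral_norm_le_of_sq_le (S.memLp_U h hG t) (by positivity)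
    ((S.sq_U h hG hM t).trans (by nlinarith))

omit [FiniteDimensional ℝ E] [BorelSpace E] [FiniteDimensional ℝ F] [BorelSpace F] in
theorem integral_norm_H (S : IsScheme P m Y fx fy η σ M K₁ K₂ x₀ W Z H U Q V)
    (hM0 : 0 < M) (t : ℕ) : ∫ ω, ‖H t ω‖ ∂P ≤ 2 * M :=
  integral_norm_le_of_sq_le (S.memLp_H t) (by positivity) ((S.sq_H t).trans (by nlinarith))

omit [FiniteDimensional ℝ E] [BorelSpace E] [FiniteDimensional ℝ F] [BorelSpace F]
  [IsProbabilityMeasure P] in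
theorem norm_W_sub_le (S : IsScheme P m Y fx fy η σ M K₁ K₂ x₀ W Z H U Q V) (hη : 0 ≤ η)
    (s n : ℕ) (ω : Ω) :
    ‖W (s + n) ω - W s ω‖ ≤ η * ∑ i ∈ Finset.range n, ‖U (s + i) ω‖ := by
  induction n with
  | zero => simp
  | succ n ih =>
    rw [Finset.sum_range_succ, ← add_assoc, S.W_succ]
    have e : W (s + n) ω - η • U (s + n) ω - W s ω = (W (s + n) ω - W s ω) - η • U (s + n) ω := by
      abel
    rw [e]
    refine (norm_sub_le _ _).trans ?_
    rw [norm_smul, Real.norm_of_nonneg hη]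
    linarith

omit [FiniteDimensional ℝ E] [BorelSpace E] [FiniteDimensional ℝ F] [BorelSpace F]
  [IsProbabilityMeasure P] in
theorem norm_Z_sub_W (S : IsScheme P m Y fx fy η σ M K₁ K₂ x₀ W Z H U Q V) (hη : 0 ≤ η)
    (t : ℕ) (ω : Ω) : ‖Z t ω - W t ω‖ = η * ‖H t ω‖ := by
  rw [S.Z_eq, sub_sub_cancel_left, norm_neg, norm_smul, Real.norm_of_nonneg hη]

omit [FiniteDimensional ℝ E] [BorelSpace E] [FiniteDimensional ℝ F] [BorelSpace F]
  [IsProbabilityMeasure P] in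
theorem norm_Z_sub_le (S : IsScheme P m Y fx fy η σ M K₁ K₂ x₀ W Z H U Q V) (hη : 0 ≤ η)
    (s n : ℕ) {i : ℕ} (hi : i < n) (ω : Ω) :
    ‖Z (s + i) ω - Z s ω‖
      ≤ η * (∑ j ∈ Finset.range n, ‖U (s + j) ω‖ + ‖H (s + i) ω‖ + ‖H s ω‖) := by
  have h1 := S.norm_W_sub_le hη s i ω
  have h2 := S.norm_Z_sub_W hη (s + i) ω
  have h3 := S.norm_Z_sub_W hη s ω
  have h4 : ∑ j ∈ Finset.range i, ‖U (s + j) ω‖ ≤ ∑ j ∈ Finset.range n, ‖U (s + j) ω‖ :=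
    Finset.sum_le_sum_of_subset_of_nonneg (Finset.range_mono hi.le) fun _ _ _ => norm_nonneg _
  have e : Z (s + i) ω - Z s ω
      = (Z (s + i) ω - W (s + i) ω) + (W (s + i) ω - W s ω) - (Z s ω - W s ω) := by abel
  rw [e]
  have h5 := norm_sub_le ((Z (s + i) ω - W (s + i) ω) + (W (s + i) ω - W s ω)) (Z s ω - W s ω)
  have h6 := norm_add_le (Z (s + i) ω - W (s + i) ω) (W (s + i) ω - W s ω)
  nlinarith [mul_le_mul_of_nonneg_left h4 hη]

omit [IsProbabilityMeasure P] in
/-- Partial sums of the dual errors have small second moment. -/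
theorem sum_noise (S : IsScheme P m Y fx fy η σ M K₁ K₂ x₀ W Z H U Q V)
    (h : IsNonconvexConcave Y f fx fy ℓ G D) (s n : ℕ) :
    MemLp (fun ω => ∑ i ∈ Finset.range n, (V (s + i) ω - fy (Z (s + i) ω) (Q (s + i) ω))) 2 P ∧
    ∫ ω, ‖∑ i ∈ Finset.range n, (V (s + i) ω - fy (Z (s + i) ω) (Q (s + i) ω))‖ ^ 2 ∂P
      ≤ n * σ ^ 2 := by
  have : ProperSpace F := FiniteDimensional.proper ℝ F
  set N : ℕ → Ω → F := fun t ω => V t ω - fy (Z t ω) (Q t ω) with hN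
  have hNm : ∀ t, Measurable[m (t + 1)] (N t) := fun t =>
    (S.measurable_V t).sub (h.measurable_fy ((S.measurable_Z t).mono (S.mono t.le_succ) le_rfl)
      ((S.measurable_Q t).mono (S.mono t.le_succ) le_rfl) (S.mem t))
  have hmeas : ∀ n, Measurable[m (s + n)] fun ω => ∑ i ∈ Finset.range n, N (s + i) ω := fun n =>
    Finset.measurable_sum _ fun i hi =>
      (hNm (s + i)).mono (S.mono (by have := Finset.mem_range.1 hi; omega)) le_rfl
  have hmem : ∀ n, MemLp (fun ω => ∑ i ∈ Finset.range n, N (s + i) ω) 2 P := fun n =>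
    memLp_finsetSum _ fun i _ => (S.noise_y (s + i)).memLp
  refine ⟨hmem n, ?_⟩
  change ∫ ω, ‖∑ i ∈ Finset.range n, N (s + i) ω‖ ^ 2 ∂P ≤ n * σ ^ 2
  induction n with
  | zero => simp
  | succ n ih =>
    -- The earlier errors are determined by the past of step s + n, so the new error is orthogonal
    -- to their sum and second moments add.
    have h1 := (S.noise_y (s + n)).integral_inner _ (hmeas n) (hmem n)
    have h2 := (S.noise_y (s + n)).sq_le
    have i1 := (hmem n).integrable_norm_pow two_ne_zero
    have i2 : Integrable (fun ω => 2 * ⟪∑ i ∈ Finset.range n, N (s + i) ω, N (s + n) ω⟫) P :=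
      (integrable_inner_of_memLp (hmem n) (S.noise_y (s + n)).memLp).const_mul 2
    have i3 : Integrable (fun ω => ‖N (s + n) ω‖ ^ 2) P :=
      (S.noise_y (s + n)).memLp.integrable_norm_pow two_ne_zero
    have i12 : Integrable (fun ω => ‖∑ i ∈ Finset.range n, N (s + i) ω‖ ^ 2
      + 2 * ⟪∑ i ∈ Finset.range n, N (s + i) ω, N (s + n) ω⟫) P := i1.add i2
    simp only [Finset.sum_range_succ, norm_add_sq_real]
    rw [integral_add i12 i3, integral_add i1 i2, integral_const_mul]
    push_cast
    simp only [hN] at h1 h2 ih ⊢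
    linarith

/-- The primal-dual gap over a block. -/
theorem gap_block (S : IsScheme P m Y fx fy η σ M K₁ K₂ x₀ W Z H U Q V)
    (h : IsNonconvexConcave Y f fx fy ℓ G D) (hG : 0 < G) (hM : G ^ 2 + σ ^ 2 = M ^ 2)
    (hM0 : 0 < M) (hη : 0 ≤ η) {τ : ℝ} (hτ : 0 < τ) (s n : ℕ) :
    ∃ R : Ω → ℝ, Integrable R P ∧
      (∀ ω, ∑ i ∈ Finset.range n,
        (primal Y f (Z (s + i) ω) - f (Z (s + i) ω) (Q (s + i) ω)) ≤ R ω) ∧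
      ∫ ω, R ω ∂P ≤ K₁ + (n + 1) * K₂ + D ^ 2 / (2 * τ) + n * (τ * σ ^ 2 / 2)
        + 4 * G * M * η * (n * (n + 2)) := by
  obtain ⟨R, hRi, hR, hRint⟩ := S.regret s n
  obtain ⟨y₀, hy₀⟩ := h.nonempty
  set N : ℕ → Ω → F := fun t ω => V t ω - fy (Z t ω) (Q t ω) with hN
  obtain ⟨hSm, hSsq⟩ := S.sum_noise h s n
  have hQm : ∀ t, MemLp (fun ω => Q t ω - y₀) 2 P := fun t =>
    MemLp.of_bound (((S.measurable_Q t).mono (S.le t) le_rfl).sub_const y₀).aestronglyMeasurable D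
      (Filter.Eventually.of_forall fun ω => h.norm_sub_le (S.mem t ω) hy₀)
  have hI : ∀ t, Integrable (fun ω => ⟪Q t ω - y₀, N t ω⟫) P := fun t =>
    integrable_inner_of_memLp (hQm t) (S.noise_y t).memLp
  have hI0 : ∀ t, ∫ ω, ⟪Q t ω - y₀, N t ω⟫ ∂P = 0 := fun t =>
    (S.noise_y t).integral_inner _ ((S.measurable_Q t).sub_const y₀) (hQm t)
  have hU : ∀ t, Integrable (fun ω => ‖U t ω‖) P := fun t =>
    ((S.memLp_U h hG.le t).integrable one_le_two).norm
  have hH : ∀ t, Integrable (fun ω => ‖H t ω‖) P := fun t =>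
    ((S.memLp_H t).integrable one_le_two).norm
  let R₁ : Ω → ℝ := fun ω =>
    τ / 2 * ‖∑ i ∈ Finset.range n, N (s + i) ω‖ ^ 2 + D ^ 2 / (2 * τ)
  let R₂ : Ω → ℝ := fun ω => ∑ i ∈ Finset.range n, ⟪Q (s + i) ω - y₀, N (s + i) ω⟫
  let R₃ : Ω → ℝ := fun ω => n * ∑ j ∈ Finset.range n, ‖U (s + j) ω‖
    + ∑ i ∈ Finset.range n, ‖H (s + i) ω‖ + n * ‖H s ω‖
  have i1' : Integrable (fun ω => τ / 2 * ‖∑ i ∈ Finset.range n, N (s + i) ω‖ ^ 2) P :=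
    (hSm.integrable_norm_pow two_ne_zero).const_mul _
  have i1 : Integrable R₁ P := i1'.add (integrable_const _)
  have i2 : Integrable R₂ P := integrable_finsetSum _ fun i _ => hI _
  have i3a : Integrable (fun ω => n * ∑ j ∈ Finset.range n, ‖U (s + j) ω‖) P :=
    (integrable_finsetSum _ fun i _ => hU _).const_mul _
  have i3b : Integrable (fun ω => ∑ j ∈ Finset.range n, ‖H (s + j) ω‖) P :=
    integrable_finsetSum _ fun i _ => hH _
  have i3c : Integrable (fun ω => n * ‖H s ω‖) P := (hH s).const_mul _
  have i3ab : Integrable (fun ω => n * ∑ j ∈ Finset.range n, ‖U (s + j) ω‖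
    + ∑ j ∈ Finset.range n, ‖H (s + j) ω‖) P := i3a.add i3b
  have i3 : Integrable R₃ P := i3ab.add i3c
  have i01 : Integrable (fun ω => R ω + R₁ ω) P := hRi.add i1
  have i012 : Integrable (fun ω => R ω + R₁ ω + R₂ ω) P := i01.add i2
  refine ⟨fun ω => R ω + R₁ ω + R₂ ω + 2 * G * η * R₃ ω, i012.add (i3.const_mul _),
    fun ω => ?_, ?_⟩
  -- The comparator for the whole block is a maximizer at its first point, chosen for each ω. Moving
  -- both Φ and f(·, u) between Z s and Z (s + i) accounts for the factor 2G.
  · obtain ⟨u, hu, hu1, -⟩ := h.exists_primal_eq (Z s ω)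
    have h1 : ∀ i ∈ Finset.range n,
        primal Y f (Z (s + i) ω) - f (Z (s + i) ω) (Q (s + i) ω)
          ≤ ⟪V (s + i) ω, u - Q (s + i) ω⟫
            + (⟪Q (s + i) ω - y₀, N (s + i) ω⟫ - ⟪u - y₀, N (s + i) ω⟫)
            + 2 * G * η * (∑ j ∈ Finset.range n, ‖U (s + j) ω‖ + ‖H (s + i) ω‖ + ‖H s ω‖) := by
      intro i hi
      have a1 := h.primal_le (Z (s + i) ω) (Z s ω)
      have a2 := (abs_le.1 (h.lipschitz (Z s ω) (Z (s + i) ω) u hu)).2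
      rw [norm_sub_rev] at a2
      have a3 := h.concave_upper (Z (s + i) ω) (S.mem (s + i) ω) hu
      have a4 := S.norm_Z_sub_le hη s n (Finset.mem_range.1 hi) ω
      have a5 : ⟪fy (Z (s + i) ω) (Q (s + i) ω), u - Q (s + i) ω⟫
          = ⟪V (s + i) ω, u - Q (s + i) ω⟫
            + (⟪Q (s + i) ω - y₀, N (s + i) ω⟫ - ⟪u - y₀, N (s + i) ω⟫) := by
        have e : N (s + i) ω = V (s + i) ω - fy (Z (s + i) ω) (Q (s + i) ω) := rfl
        rw [← inner_sub_left, sub_sub_sub_cancel_right, ← neg_sub u, e, inner_neg_left,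
          real_inner_comm (V (s + i) ω - fy (Z (s + i) ω) (Q (s + i) ω)), inner_sub_left (V (s + i) ω)]
        ring
      rw [hu1] at a1
      nlinarith [mul_le_mul_of_nonneg_left a4 hG.le]
    have h2 := Finset.sum_le_sum h1
    simp only [Finset.sum_add_distrib, Finset.sum_sub_distrib, ← Finset.mul_sum, Finset.sum_const,
      Finset.card_range, nsmul_eq_mul, ← inner_sum] at h2
    have h3 := hR ω u hu
    -- The choice of `u` need not be measurable in ω, so orthogonality cannot be used here. Bounding
    -- by D times the norm of the summed noise is uniform in `u`, and the second moment of that sum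
    -- grows only linearly in `n`.
    have h4 : -⟪u - y₀, ∑ i ∈ Finset.range n, N (s + i) ω⟫ ≤ R₁ ω := by
      have b1 := neg_le_of_abs_le (abs_real_inner_le_norm (u - y₀)
        (∑ i ∈ Finset.range n, N (s + i) ω))
      have b2 := h.norm_sub_le hu hy₀
      set q := ‖∑ i ∈ Finset.range n, N (s + i) ω‖ with hq
      have b3 : ‖u - y₀‖ * q ≤ D * q := mul_le_mul_of_nonneg_right b2 (norm_nonneg _)
      have b4 : τ / 2 * q ^ 2 + D ^ 2 / (2 * τ) - D * q = (τ * q - D) ^ 2 / (2 * τ) := by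
        field_simp; ring
      have b5 : 0 ≤ (τ * q - D) ^ 2 / (2 * τ) := by positivity
      simp only [R₁, ← hq]
      linarith
    simp only [R₂, R₃, Finset.sum_sub_distrib]
    linarith
  · rw [integral_add i012 (i3.const_mul _), integral_add i01 i2,
      integral_add hRi i1, integral_const_mul]
    have e1 : ∫ ω, R₁ ω ∂P ≤ n * (τ * σ ^ 2 / 2) + D ^ 2 / (2 * τ) := by
      simp only [R₁]
      rw [integral_add i1' (integrable_const _), integral_const_mul, integral_const, probReal_univ,
        one_smul]
      have := mul_le_mul_of_nonneg_left hSsq (by positivity : 0 ≤ τ / 2)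
      linarith
    have e2 : ∫ ω, R₂ ω ∂P = 0 := by
      simp only [R₂]
      rw [integral_finsetSum _ fun i _ => hI _]
      simp [hI0]
    have e3 : ∫ ω, R₃ ω ∂P ≤ 2 * M * (n * (n + 2)) := by
      simp only [R₃]
      rw [integral_add i3ab i3c, integral_add i3a i3b, integral_const_mul,
        integral_const_mul, integral_finsetSum _ fun i _ => hU _,
        integral_finsetSum _ fun i _ => hH _]
      have c1 := Finset.sum_le_sum fun i (_ : i ∈ Finset.range n) =>
        S.integral_norm_U h hG.le hM hM0 (s + i)
      have c2 := Finset.sum_le_sum fun i (_ : i ∈ Finset.range n) => S.integral_norm_H hM0 (s + i)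
      have c3 := S.integral_norm_H hM0 s
      rw [Finset.sum_const, Finset.card_range, nsmul_eq_mul] at c1 c2
      have hn : (0 : ℝ) ≤ n := n.cast_nonneg
      nlinarith [mul_le_mul_of_nonneg_left c1 hn, mul_le_mul_of_nonneg_left c3 hn]
    rw [e2]
    have e4 := mul_le_mul_of_nonneg_left e3 (by positivity : 0 ≤ 2 * G * η)
    linarith

/-- The primal-dual gap over any number of steps. -/
theorem gap_sum (S : IsScheme P m Y fx fy η σ M K₁ K₂ x₀ W Z H U Q V)
    (h : IsNonconvexConcave Y f fx fy ℓ G D) (hG : 0 < G) (hM : G ^ 2 + σ ^ 2 = M ^ 2)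
    (hM0 : 0 < M) (hη : 0 ≤ η) {τ : ℝ} (hτ : 0 < τ) (hK₁ : 0 ≤ K₁) (hK₂ : 0 ≤ K₂)
    {B : ℕ} (hB : 1 ≤ B) (n : ℕ) :
    ∃ R : Ω → ℝ, Integrable R P ∧
      (∀ ω, ∑ i ∈ Finset.range n, (primal Y f (Z i ω) - f (Z i ω) (Q i ω)) ≤ R ω) ∧
      ∫ ω, R ω ∂P ≤ (n / B + 1) * (K₁ + D ^ 2 / (2 * τ))
        + n * (2 * K₂ + τ * σ ^ 2 / 2 + 12 * G * M * η * B) := by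
  have hB0 : (0 : ℝ) < B := by exact_mod_cast hB
  have hC : 0 ≤ K₁ + D ^ 2 / (2 * τ) := by positivity
  have block : ∀ s n : ℕ, n ≤ B → ∃ R : Ω → ℝ, Integrable R P ∧
      (∀ ω, ∑ i ∈ Finset.range n,
        (primal Y f (Z (s + i) ω) - f (Z (s + i) ω) (Q (s + i) ω)) ≤ R ω) ∧
      ∫ ω, R ω ∂P ≤ (K₁ + D ^ 2 / (2 * τ))
        + n * (2 * K₂ + τ * σ ^ 2 / 2 + 12 * G * M * η * B) := by
    intro s n hn
    -- For n ≥ 1 one has n + 1 ≤ 2n and n + 2 ≤ 3B, which yields the factors 2 and 12.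
    rcases Nat.eq_zero_or_pos n with rfl | hn0
    · exact ⟨0, integrable_zero _ _ _, fun ω => by simp, by simpa using hC⟩
    · obtain ⟨R, h1, h2, h3⟩ := S.gap_block h hG hM hM0 hη hτ s n
      refine ⟨R, h1, h2, h3.trans ?_⟩
      have hn1 : (1 : ℝ) ≤ n := by exact_mod_cast hn0
      have hnB : (n : ℝ) ≤ B := by exact_mod_cast hn
      have a1 : (n : ℝ) * (n + 2) ≤ n * (3 * B) := by
        apply mul_le_mul_of_nonneg_left _ (by positivity); linarith
      have a2 := mul_le_mul_of_nonneg_left a1 (by positivity : 0 ≤ 4 * G * M * η)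
      nlinarith
  induction n using Nat.strong_induction_on with
  | _ n ih =>
    by_cases hn : n ≤ B
    · obtain ⟨R, h1, h2, h3⟩ := block 0 n hn
      refine ⟨R, h1, fun ω => by simpa using h2 ω, h3.trans ?_⟩
      have : 0 ≤ (n : ℝ) / B * (K₁ + D ^ 2 / (2 * τ)) := by positivity
      linarith
    · push Not at hn
      -- Splitting off a last full block lowers n/B by exactly one.
      obtain ⟨R, h1, h2, h3⟩ := ih (n - B) (by omega)
      obtain ⟨R', h1', h2', h3'⟩ := block (n - B) B le_rfl
      refine ⟨fun ω => R ω + R' ω, h1.add h1', fun ω => ?_, ?_⟩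
      · have e : n = (n - B) + B := by omega
        conv_lhs => rw [e, Finset.sum_range_add]
        exact add_le_add (h2 ω) (h2' ω)
      · rw [integral_add h1 h1']
        rw [Nat.cast_sub hn.le] at h3
        have e : ((n : ℝ) - B) / B = n / B - 1 := by field_simp
        rw [e] at h3
        linarith

end IsScheme

theorem IsNonconvexConcave.integrable_envelopeGrad_sq {Ω E F : Type*} [MeasurableSpace Ω]
    [NormedAddCommGroup E] [InnerProductSpace ℝ E] [FiniteDimensional ℝ E] [MeasurableSpace E]
    [BorelSpace E] [NormedAddCommGroup F] [InnerProductSpace ℝ F] [FiniteDimensional ℝ F]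
    {P : Measure Ω} [IsFiniteMeasure P] {Y : Set F} {f : E → F → ℝ} {fx : E → F → E}
    {fy : E → F → F} {ℓ G D : ℝ} (h : IsNonconvexConcave Y f fx fy ℓ G D) (hℓ : 0 < ℓ)
    (hG : 0 ≤ G) {X : Ω → E} (hX : Measurable X) :
    Integrable (fun ω => ‖envelopeGrad Y f ℓ (X ω)‖ ^ 2) P := by
  have hc := (h.continuous_envelopeGrad hℓ).measurable.comp hX
  refine Integrable.of_bound (hc.norm.pow_const 2).aestronglyMeasurable (G ^ 2)
    (Filter.Eventually.of_forall fun ω => ?_)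
  rw [norm_pow, norm_norm]
  exact pow_le_pow_left₀ (norm_nonneg _) (h.norm_envelopeGrad_le hℓ hG _) 2

/-! ### Average stationarity of abstract schemes. -/

namespace IsScheme

variable {Ω E F : Type*} [mΩ : MeasurableSpace Ω]
  [NormedAddCommGroup E] [InnerProductSpace ℝ E] [FiniteDimensional ℝ E] [MeasurableSpace E]
  [BorelSpace E]
  [NormedAddCommGroup F] [InnerProductSpace ℝ F] [FiniteDimensional ℝ F] [MeasurableSpace F]
  [BorelSpace F]
  {P : Measure Ω} [IsProbabilityMeasure P] {m : ℕ → MeasurableSpace Ω}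
  {Y : Set F} {f : E → F → ℝ} {fx : E → F → E} {fy : E → F → F} {ℓ G D η σ M K₁ K₂ : ℝ}
  {x₀ : E} {W Z H U : ℕ → Ω → E} {Q V : ℕ → Ω → F}

/-- The descent inequality summed over the first `n` steps. -/
theorem grad_W_sum_le (S : IsScheme P m Y fx fy η σ M K₁ K₂ x₀ W Z H U Q V)
    (h : IsNonconvexConcave Y f fx fy ℓ G D) (hℓ : 0 < ℓ) (hG : 0 < G)
    (hM : G ^ 2 + σ ^ 2 = M ^ 2) (hM0 : 0 < M) (hη : 0 < η) (hℓη : ℓ * η ≤ 1)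
    (hb : BddBelow (Set.range (envelope Y f ℓ))) (n : ℕ) {R : Ω → ℝ} (hRi : Integrable R P)
    (hR : ∀ ω, ∑ i ∈ Finset.range n, (primal Y f (Z i ω) - f (Z i ω) (Q i ω)) ≤ R ω) :
    η / 8 * ∑ t ∈ Finset.range n, ∫ ω, ‖envelopeGrad Y f ℓ (W t ω)‖ ^ 2 ∂P
      ≤ initialGap Y f ℓ x₀ + 4 * ℓ * η ^ 2 * M ^ 2 + 2 * ℓ * η * ∫ ω, R ω ∂P
        + n * (14 * ℓ * η ^ 2 * M ^ 2) := by
  set Ψ := envelope Y f ℓ with hΨ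
  set v := envelopeGrad Y f ℓ with hv
  have hWm : ∀ t, Measurable (W t) := fun t => (S.measurable_W t).mono (S.le t) le_rfl
  have iv : ∀ t, Integrable (fun ω => ‖v (W t ω)‖ ^ 2) P := fun t =>
    h.integrable_envelopeGrad_sq hℓ hG.le (hWm t)
  have hvm : ∀ t, Measurable[m t] fun ω => v (W t ω) := fun t =>
    (h.continuous_envelopeGrad hℓ).measurable.comp (S.measurable_W t)
  have hv2 : ∀ t, MemLp (fun ω => v (W t ω)) 2 P := fun t =>
    (memLp_two_iff_integrable_sq_norm ((hvm t).mono (S.le t) le_rfl).aestronglyMeasurable).2 (iv t)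
  set N : ℕ → Ω → E := fun t ω => U t ω - fx (Z t ω) (Q t ω) with hN
  have iN : ∀ t, Integrable (fun ω => ⟪v (W t ω), N t ω⟫) P := fun t =>
    integrable_inner_of_memLp (hv2 t) (S.noise_x t).memLp
  have iN0 : ∀ t, ∫ ω, ⟪v (W t ω), N t ω⟫ ∂P = 0 := fun t =>
    (S.noise_x t).integral_inner _ (hvm t) (hv2 t)
  have iH : ∀ t, Integrable (fun ω => ‖H t ω‖) P := fun t =>
    ((S.memLp_H t).integrable one_le_two).norm
  have iH2 : ∀ t, Integrable (fun ω => ‖H t ω‖ ^ 2) P := fun t =>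
    (S.memLp_H t).integrable_norm_pow two_ne_zero
  have iU2 : ∀ t, Integrable (fun ω => ‖U t ω‖ ^ 2) P := fun t =>
    (S.memLp_U h hG.le t).integrable_norm_pow two_ne_zero
  let err : ℕ → Ω → ℝ := fun t ω => -η * ⟪v (W t ω), N t ω⟫ + 4 * ℓ * G * η ^ 2 * ‖H t ω‖
    + 2 * ℓ ^ 2 * η ^ 3 * ‖H t ω‖ ^ 2 + ℓ * η ^ 2 * ‖U t ω‖ ^ 2
  have ie1 : ∀ t, Integrable (fun ω => -η * ⟪v (W t ω), N t ω⟫ + 4 * ℓ * G * η ^ 2 * ‖H t ω‖) P :=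
    fun t => ((iN t).const_mul _).add ((iH t).const_mul _)
  have ie2 : ∀ t, Integrable (fun ω => -η * ⟪v (W t ω), N t ω⟫ + 4 * ℓ * G * η ^ 2 * ‖H t ω‖
      + 2 * ℓ ^ 2 * η ^ 3 * ‖H t ω‖ ^ 2) P :=
    fun t => (ie1 t).add ((iH2 t).const_mul _)
  have ie : ∀ t, Integrable (err t) P := fun t => (ie2 t).add ((iU2 t).const_mul _)
  have herr : ∀ t, ∫ ω, err t ω ∂P ≤ 14 * ℓ * η ^ 2 * M ^ 2 := by
    intro t
    simp only [err]
    rw [integral_add (ie2 t) ((iU2 t).const_mul _), integral_add (ie1 t) ((iH2 t).const_mul _),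
      integral_add ((iN t).const_mul _) ((iH t).const_mul _), integral_const_mul,
      integral_const_mul, integral_const_mul, integral_const_mul, iN0]
    have c1 := S.integral_norm_H hM0 t
    have c2 := S.sq_H t
    have c3 := S.sq_U h hG.le hM t
    have c4 : G ≤ M := by nlinarith [sq_nonneg σ]
    have d1 : 4 * ℓ * G * η ^ 2 * ∫ ω, ‖H t ω‖ ∂P ≤ 4 * ℓ * M * η ^ 2 * (2 * M) := by
      have : 0 ≤ ∫ ω, ‖H t ω‖ ∂P := integral_nonneg fun _ => norm_nonneg _
      gcongr
    have d2 : 2 * ℓ ^ 2 * η ^ 3 * ∫ ω, ‖H t ω‖ ^ 2 ∂P ≤ 2 * ℓ * η ^ 2 * 1 * (2 * M ^ 2) := by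
      have e : 2 * ℓ ^ 2 * η ^ 3 = 2 * ℓ * η ^ 2 * (ℓ * η) := by ring
      have : 0 ≤ ∫ ω, ‖H t ω‖ ^ 2 ∂P := integral_nonneg fun _ => sq_nonneg _
      rw [e]
      gcongr
    have d3 := mul_le_mul_of_nonneg_left c3 (by positivity : 0 ≤ ℓ * η ^ 2)
    linarith
  have path : ∀ n ω, η / 8 * ∑ t ∈ Finset.range n, ‖v (W t ω)‖ ^ 2
      ≤ Ψ (W 0 ω) - Ψ (W n ω)
        + 2 * ℓ * η * ∑ t ∈ Finset.range n, (primal Y f (Z t ω) - f (Z t ω) (Q t ω))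
        + ∑ t ∈ Finset.range n, err t ω := by
    intro n ω
    induction n with
    | zero => simp
    | succ n ih =>
      rw [Finset.sum_range_succ, Finset.sum_range_succ, Finset.sum_range_succ, S.W_succ n]
      have h1 := h.envelope_step hℓ hη.le (W n ω) (Z n ω) (U n ω) (S.mem n ω)
      rw [S.norm_Z_sub_W hη.le n ω] at h1
      simp only [err, hN, hΨ, hv] at ih ⊢
      linarith
  have i0 : Integrable (fun ω => Ψ x₀ - (⨅ u, Ψ u) + ⟪v x₀, W 0 ω - x₀⟫
      + ℓ * ‖W 0 ω - x₀‖ ^ 2) P :=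
    ((integrable_const _).add (integrable_inner_of_memLp (memLp_const _) S.memLp_zero)).add
      ((S.memLp_zero.integrable_norm_pow two_ne_zero).const_mul _)
  have i0' : Integrable (fun ω => Ψ x₀ - (⨅ u, Ψ u) + ⟪v x₀, W 0 ω - x₀⟫) P :=
    (integrable_const _).add (integrable_inner_of_memLp (memLp_const _) S.memLp_zero)
  have ierr : Integrable (fun ω => ∑ t ∈ Finset.range n, err t ω) P :=
    integrable_finsetSum _ fun t _ => ie t
  have i1 : Integrable (fun ω => Ψ x₀ - (⨅ u, Ψ u) + ⟪v x₀, W 0 ω - x₀⟫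
      + ℓ * ‖W 0 ω - x₀‖ ^ 2 + 2 * ℓ * η * R ω) P := i0.add (hRi.const_mul _)
  have key : ∫ ω, η / 8 * ∑ t ∈ Finset.range n, ‖v (W t ω)‖ ^ 2 ∂P
      ≤ ∫ ω, (Ψ x₀ - (⨅ u, Ψ u) + ⟪v x₀, W 0 ω - x₀⟫ + ℓ * ‖W 0 ω - x₀‖ ^ 2
        + 2 * ℓ * η * R ω + ∑ t ∈ Finset.range n, err t ω) ∂P := by
    refine integral_mono ((integrable_finsetSum _ fun t _ => iv t).const_mul _) (i1.add ierr)
      fun ω => ?_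
    have h1 := path n ω
    -- The first anchor may differ from x₀. Its offset has mean zero, so the linear term integrates
    -- to zero and only O(ℓη²M²) remains.
    have h2 := h.envelope_le_add hℓ x₀ (W 0 ω)
    have h3 := ciInf_le hb (W n ω)
    have h4 := mul_le_mul_of_nonneg_left (hR ω) (by positivity : 0 ≤ 2 * ℓ * η)
    simp only [hΨ, hv] at h1 ⊢
    linarith
  rw [integral_const_mul, integral_finsetSum _ fun t _ => iv t, integral_add i1 ierr,
    integral_add i0 (hRi.const_mul _), integral_add i0'
      ((S.memLp_zero.integrable_norm_pow two_ne_zero).const_mul _), integral_add (integrable_const _)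
      (integrable_inner_of_memLp (memLp_const _) S.memLp_zero), S.integral_inner_zero,
    integral_const, probReal_univ, one_smul, integral_const_mul, integral_const_mul,
    integral_finsetSum _ fun t _ => ie t] at key
  have h5 := Finset.sum_le_sum fun t (_ : t ∈ Finset.range n) => herr t
  rw [Finset.sum_const, Finset.card_range, nsmul_eq_mul] at h5
  have h6 : ℓ * ∫ ω, ‖W 0 ω - x₀‖ ^ 2 ∂P ≤ 4 * ℓ * η ^ 2 * M ^ 2 := by
    have h7 := mul_le_mul_of_nonneg_left S.sq_zero hℓ.le
    have h8 : σ ^ 2 ≤ M ^ 2 := by nlinarith [sq_nonneg G]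
    nlinarith [mul_le_mul_of_nonneg_left h8 (by positivity : 0 ≤ 4 * ℓ * η ^ 2)]
  have h9 : initialGap Y f ℓ x₀ = Ψ x₀ - ⨅ u, Ψ u := rfl
  rw [h9]
  linarith

/-- Stationarity of the points `Z t`, on average. -/
theorem grad_Z_sum_le (S : IsScheme P m Y fx fy η σ M K₁ K₂ x₀ W Z H U Q V)
    (h : IsNonconvexConcave Y f fx fy ℓ G D) (hℓ : 0 < ℓ) (hG : 0 < G)
    (hM : G ^ 2 + σ ^ 2 = M ^ 2) (hM0 : 0 < M) (hη : 0 < η) (hℓη : ℓ * η ≤ 1)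
    (hb : BddBelow (Set.range (envelope Y f ℓ))) {n : ℕ} (hn : 1 ≤ n) {R : Ω → ℝ}
    (hRi : Integrable R P)
    (hR : ∀ ω, ∑ i ∈ Finset.range n, (primal Y f (Z i ω) - f (Z i ω) (Q i ω)) ≤ R ω) :
    ∑ t ∈ Finset.range n, ∫ ω, ‖envelopeGrad Y f ℓ (Z t ω)‖ ^ 2 ∂P
      ≤ 16 * initialGap Y f ℓ x₀ / η + 32 * ℓ * ∫ ω, R ω ∂P + n * (432 * ℓ * η * M ^ 2) := by
  have h1 := S.grad_W_sum_le h hℓ hG hM hM0 hη hℓη hb n hRi hR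
  -- The stationary points are the Z t, not the anchors; the 6ℓ-Lipschitz gradient transfers the
  -- bound across the distance η‖H t‖.
  have hZW : ∀ t, ∫ ω, ‖envelopeGrad Y f ℓ (Z t ω)‖ ^ 2 ∂P
      ≤ 2 * ∫ ω, ‖envelopeGrad Y f ℓ (W t ω)‖ ^ 2 ∂P + 144 * ℓ * η * M ^ 2 := by
    intro t
    have iW := h.integrable_envelopeGrad_sq (P := P) hℓ hG.le
      ((S.measurable_W t).mono (S.le t) le_rfl)
    have iZ := h.integrable_envelopeGrad_sq (P := P) hℓ hG.le
      ((S.measurable_Z t).mono (S.le t) le_rfl)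
    have iH := (S.memLp_H t).integrable_norm_pow two_ne_zero
    have h2 : ∫ ω, ‖envelopeGrad Y f ℓ (Z t ω)‖ ^ 2 ∂P
        ≤ ∫ ω, (2 * ‖envelopeGrad Y f ℓ (W t ω)‖ ^ 2 + 72 * ℓ ^ 2 * η ^ 2 * ‖H t ω‖ ^ 2) ∂P := by
      refine integral_mono iZ ((iW.const_mul _).add (iH.const_mul _)) fun ω => ?_
      have a1 := h.norm_envelopeGrad_sub_le hℓ (Z t ω) (W t ω)
      rw [S.norm_Z_sub_W hη.le t ω] at a1
      have a2 := norm_le_norm_add_norm_sub (envelopeGrad Y f ℓ (W t ω))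
        (envelopeGrad Y f ℓ (Z t ω))
      rw [norm_sub_rev] at a2
      have a3 := norm_nonneg (envelopeGrad Y f ℓ (Z t ω))
      have a4 : ‖envelopeGrad Y f ℓ (Z t ω)‖ ^ 2
          ≤ (‖envelopeGrad Y f ℓ (W t ω)‖ + 6 * ℓ * (η * ‖H t ω‖)) ^ 2 :=
        pow_le_pow_left₀ a3 (by linarith) 2
      simp only
      nlinarith [sq_nonneg (‖envelopeGrad Y f ℓ (W t ω)‖ - 6 * ℓ * (η * ‖H t ω‖))]
    rw [integral_add (iW.const_mul _) (iH.const_mul _), integral_const_mul,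
      integral_const_mul] at h2
    have h3 : 72 * ℓ ^ 2 * η ^ 2 * ∫ ω, ‖H t ω‖ ^ 2 ∂P ≤ 72 * (ℓ * η) * 1 * (2 * M ^ 2) := by
      have e : 72 * ℓ ^ 2 * η ^ 2 = 72 * (ℓ * η) * (ℓ * η) := by ring
      have : 0 ≤ ∫ ω, ‖H t ω‖ ^ 2 ∂P := integral_nonneg fun _ => sq_nonneg _
      rw [e]
      gcongr
      exact S.sq_H t
    linarith
  have h4 := Finset.sum_le_sum fun t (_ : t ∈ Finset.range n) => hZW t
  rw [Finset.sum_add_distrib, ← Finset.mul_sum, Finset.sum_const, Finset.card_range,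
    nsmul_eq_mul] at h4
  set A := ∑ t ∈ Finset.range n, ∫ ω, ‖envelopeGrad Y f ℓ (W t ω)‖ ^ 2 ∂P
  set Δ := initialGap Y f ℓ x₀
  set r := ∫ ω, R ω ∂P
  have h5 : A ≤ 8 * Δ / η + 32 * ℓ * η * M ^ 2 + 16 * ℓ * r + n * (112 * ℓ * η * M ^ 2) := by
    refine le_of_mul_le_mul_left ?_ (by positivity : 0 < η / 8)
    refine h1.trans (le_of_eq ?_)
    field_simp
    ring
  have hn1 : (1 : ℝ) ≤ n := by exact_mod_cast hn
  have h6 : ℓ * η * M ^ 2 ≤ n * (ℓ * η * M ^ 2) :=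
    le_mul_of_one_le_left (by positivity) hn1
  have e : 16 * Δ / η = 2 * (8 * Δ / η) := by ring
  rw [e]
  linarith

/-- The points `Z t` stay close to the starting point for a while. -/
theorem grad_Z_le (S : IsScheme P m Y fx fy η σ M K₁ K₂ x₀ W Z H U Q V)
    (h : IsNonconvexConcave Y f fx fy ℓ G D) (hℓ : 0 < ℓ) (hG : 0 < G)
    (hM : G ^ 2 + σ ^ 2 = M ^ 2) (hM0 : 0 < M) (hη : 0 < η)
    (hb : BddBelow (Set.range (envelope Y f ℓ))) (t : ℕ) :
    ∫ ω, ‖envelopeGrad Y f ℓ (Z t ω)‖ ^ 2 ∂P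
      ≤ 4 * ℓ * initialGap Y f ℓ x₀ + 8 * ℓ * G * η * M * (t + 2) := by
  have iZ := h.integrable_envelopeGrad_sq (P := P) hℓ hG.le
    ((S.measurable_Z t).mono (S.le t) le_rfl)
  have iU : ∀ t, Integrable (fun ω => ‖U t ω‖) P := fun t =>
    ((S.memLp_U h hG.le t).integrable one_le_two).norm
  have iH := ((S.memLp_H t).integrable one_le_two).norm
  have iW := (S.memLp_zero.integrable one_le_two).norm
  have iUs : Integrable (fun ω => ∑ i ∈ Finset.range t, ‖U i ω‖) P :=
    integrable_finsetSum _ fun i _ => iU i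
  have i1 : Integrable (fun ω => ‖W 0 ω - x₀‖ + η * ∑ i ∈ Finset.range t, ‖U i ω‖) P :=
    iW.add (iUs.const_mul _)
  have i2 : Integrable (fun ω => ‖W 0 ω - x₀‖ + η * ∑ i ∈ Finset.range t, ‖U i ω‖
    + η * ‖H t ω‖) P := i1.add (iH.const_mul _)
  have h1 : ∫ ω, ‖envelopeGrad Y f ℓ (Z t ω)‖ ^ 2 ∂P
      ≤ ∫ ω, (4 * ℓ * initialGap Y f ℓ x₀ + 4 * ℓ * G * (‖W 0 ω - x₀‖
        + η * ∑ i ∈ Finset.range t, ‖U i ω‖ + η * ‖H t ω‖)) ∂P := by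
    refine integral_mono iZ ((integrable_const _).add (i2.const_mul _)) fun ω => ?_
    -- The squared gradient is at most 4ℓ times the suboptimality, which grows at rate at most G
    -- with the distance from x₀.
    have a1 := h.norm_envelopeGrad_sq_le hℓ hb (Z t ω)
    have a2 := h.envelope_le_add_norm hℓ x₀ (Z t ω)
    have a3 := S.norm_W_sub_le hη.le 0 t ω
    have a4 := S.norm_Z_sub_W hη.le t ω
    simp only [zero_add] at a3
    have a5 : ‖Z t ω - x₀‖ ≤ ‖W 0 ω - x₀‖ + η * ∑ i ∈ Finset.range t, ‖U i ω‖ + η * ‖H t ω‖ := by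
      have e : Z t ω - x₀ = (Z t ω - W t ω) + (W t ω - W 0 ω) + (W 0 ω - x₀) := by abel
      rw [e]
      refine (norm_add₃_le).trans ?_
      linarith
    have a6 : envelope Y f ℓ (Z t ω) - ⨅ u, envelope Y f ℓ u ≤ initialGap Y f ℓ x₀
        + G * (‖W 0 ω - x₀‖ + η * ∑ i ∈ Finset.range t, ‖U i ω‖ + η * ‖H t ω‖) := by
      unfold initialGap
      linarith [mul_le_mul_of_nonneg_left a5 hG.le]
    have a7 := mul_le_mul_of_nonneg_left a6 (by positivity : 0 ≤ 4 * ℓ)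
    simp only
    linarith
  rw [integral_add (integrable_const _) (i2.const_mul _), integral_const, probReal_univ, one_smul,
    integral_const_mul, integral_add i1 (iH.const_mul _), integral_add iW (iUs.const_mul _),
    integral_const_mul, integral_const_mul, integral_finsetSum _ fun i _ => iU i] at h1
  have b1 := Finset.sum_le_sum fun i (_ : i ∈ Finset.range t) => S.integral_norm_U h hG.le hM hM0 i
  rw [Finset.sum_const, Finset.card_range, nsmul_eq_mul] at b1
  have b2 := S.integral_norm_H hM0 t
  have b3 : ∫ ω, ‖W 0 ω - x₀‖ ∂P ≤ 2 * (η * M) := by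
    refine integral_norm_le_of_sq_le S.memLp_zero (by positivity) (S.sq_zero.trans ?_)
    have h8 : σ ^ 2 ≤ M ^ 2 := by nlinarith [sq_nonneg G]
    nlinarith [mul_le_mul_of_nonneg_left h8 (by positivity : 0 ≤ 4 * η ^ 2)]
  have b4 : ∫ ω, ‖W 0 ω - x₀‖ ∂P + η * ∑ i ∈ Finset.range t, ∫ ω, ‖U i ω‖ ∂P
      + η * ∫ ω, ‖H t ω‖ ∂P ≤ 2 * (η * M) * (t + 2) := by
    linarith [mul_le_mul_of_nonneg_left b1 hη.le, mul_le_mul_of_nonneg_left b2 hη.le]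
  linarith [mul_le_mul_of_nonneg_left b4 (by positivity : 0 ≤ 4 * ℓ * G)]

end IsScheme

/-! ### Stochastic EG as a scheme. -/

theorem IsUnbiasedOracle.measurable_comp {Ω E F V Ξ : Type*} [MeasurableSpace E]
    [MeasurableSpace F] [NormedAddCommGroup V] [NormedSpace ℝ V] [MeasurableSpace V]
    [MeasurableSpace Ξ] {Y : Set F} {h : E → F → V} {ν : Measure Ξ} {g : E → F → Ξ → V} {σ : ℝ}
    (hg : IsUnbiasedOracle Y h ν g σ) {m₁ : MeasurableSpace Ω} {X : Ω → E} {Q : Ω → F} {ξ : Ω → Ξ}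
    (hX : Measurable[m₁] X) (hQ : Measurable[m₁] Q) (hξ : Measurable[m₁] ξ) :
    Measurable[m₁] fun ω => g (X ω) (Q ω) (ξ ω) :=
  hg.measurable.comp (hX.prodMk (hQ.prodMk hξ))

section Sampling

variable {Ω E F Ξx Ξy : Type*} [mΩ : MeasurableSpace Ω]
  [NormedAddCommGroup E] [InnerProductSpace ℝ E] [FiniteDimensional ℝ E] [MeasurableSpace E]
  [BorelSpace E]
  [NormedAddCommGroup F] [InnerProductSpace ℝ F] [FiniteDimensional ℝ F] [MeasurableSpace F]
  [BorelSpace F] [MeasurableSpace Ξx] [MeasurableSpace Ξy]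
  {P : Measure Ω} [IsProbabilityMeasure P] {νx : Measure Ξx} {νy : Measure Ξy}
  {ξx : ℕ → Ω → Ξx} {ξy : ℕ → Ω → Ξy}
  {Y : Set F} {f : E → F → ℝ} {fx : E → F → E} {fy : E → F → F} {ℓ G D σ : ℝ}
  {gx : E → F → Ξx → E} {gy : E → F → Ξy → F} {X : Ω → E} {Q : Ω → F}

theorem IsSampling.noise_left (hs : IsSampling P νx νy ξx ξy)
    (h : IsNonconvexConcave Y f fx fy ℓ G D) (hg : IsUnbiasedOracle Y fx νx gx σ) (k : ℕ)
    (hX : Measurable[past ξx ξy k] X) (hQ : Measurable[past ξx ξy k] Q) (hY : ∀ ω, Q ω ∈ Y) :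
    IsNoise (past ξx ξy k) P (fun ω => gx (X ω) (Q ω) (ξx k ω) - fx (X ω) (Q ω)) σ := by
  have : ProperSpace E := FiniteDimensional.proper ℝ E
  exact hg.noise h.isClosed (fun y hy => h.proj_eq_self hy) h.continuous_fx_proj.measurable
    (hs.past_le k) (hs.measurable_x k) (hs.law_x k) (hs.indep_past_left k) hX hQ hY

theorem IsSampling.noise_right (hs : IsSampling P νx νy ξx ξy)
    (h : IsNonconvexConcave Y f fx fy ℓ G D) (hg : IsUnbiasedOracle Y fy νy gy σ) (k : ℕ)
    (hX : Measurable[past ξx ξy k] X) (hQ : Measurable[past ξx ξy k] Q) (hY : ∀ ω, Q ω ∈ Y) :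
    IsNoise (past ξx ξy k) P (fun ω => gy (X ω) (Q ω) (ξy k ω) - fy (X ω) (Q ω)) σ := by
  have : ProperSpace E := FiniteDimensional.proper ℝ E
  exact hg.noise h.isClosed (fun y hy => h.proj_eq_self hy) h.continuous_fy_proj.measurable
    (hs.past_le k) (hs.measurable_y k) (hs.law_y k) (hs.indep_past_right k) hX hQ hY

variable {η τ : ℝ} {x₀ : E} {y₀ : F}

/-- The half step of EG as a random point. -/
noncomputable def egHalfAt (Y : Set F) (gx : E → F → Ξx → E) (gy : E → F → Ξy → F) (η τ : ℝ) (x₀ : E) (y₀ : F)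
    (ξx : ℕ → Ω → Ξx) (ξy : ℕ → Ω → Ξy) (t : ℕ) (ω : Ω) : E × F :=
  egHalf Y gx gy η τ (fun k => ξx k ω) (fun k => ξy k ω) t
    (eg Y gx gy η τ x₀ y₀ (fun k => ξx k ω) (fun k => ξy k ω) t)

/-- EG as a random sequence. -/
noncomputable def egAt (Y : Set F) (gx : E → F → Ξx → E) (gy : E → F → Ξy → F) (η τ : ℝ) (x₀ : E) (y₀ : F)
    (ξx : ℕ → Ω → Ξx) (ξy : ℕ → Ω → Ξy) (t : ℕ) (ω : Ω) : E × F :=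
  eg Y gx gy η τ x₀ y₀ (fun k => ξx k ω) (fun k => ξy k ω) t

omit mΩ in
theorem measurable_egHalfAt (h : IsNonconvexConcave Y f fx fy ℓ G D)
    (hgx : IsUnbiasedOracle Y fx νx gx σ) (hgy : IsUnbiasedOracle Y fy νy gy σ) (t : ℕ)
    (ht : Measurable[past ξx ξy (2 * t)] (egAt Y gx gy η τ x₀ y₀ ξx ξy t)) :
    Measurable[past ξx ξy (2 * t + 1)] (egHalfAt Y gx gy η τ x₀ y₀ ξx ξy t) := by
  have : ProperSpace E := FiniteDimensional.proper ℝ E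
  have : ProperSpace F := FiniteDimensional.proper ℝ F
  have ht' := ht.mono (past_mono (ξx := ξx) (ξy := ξy) (2 * t).le_succ) le_rfl
  have h1 := measurable_fst.comp ht'
  have h2 := measurable_snd.comp ht'
  have hx := hgx.measurable_comp h1 h2 (measurable_past_left (ξy := ξy) (2 * t).lt_succ_self)
  have hy := hgy.measurable_comp h1 h2 (measurable_past_right (ξx := ξx) (2 * t).lt_succ_self)
  exact (h1.sub (hx.const_smul η)).prodMk
    (h.continuous_proj.measurable.comp (h2.add (hy.const_smul τ)))

omit mΩ in
theorem measurable_egAt (h : IsNonconvexConcave Y f fx fy ℓ G D)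
    (hgx : IsUnbiasedOracle Y fx νx gx σ) (hgy : IsUnbiasedOracle Y fy νy gy σ) (t : ℕ) :
    Measurable[past ξx ξy (2 * t)] (egAt Y gx gy η τ x₀ y₀ ξx ξy t) := by
  have : ProperSpace E := FiniteDimensional.proper ℝ E
  have : ProperSpace F := FiniteDimensional.proper ℝ F
  induction t with
  | zero => exact measurable_const
  | succ t ih =>
    have hw := (measurable_egHalfAt h hgx hgy t ih).mono
      (past_mono (ξx := ξx) (ξy := ξy) (2 * t + 1).le_succ) le_rfl
    have ht' := ih.mono (past_mono (ξx := ξx) (ξy := ξy) (by omega : 2 * t ≤ 2 * t + 2)) le_rfl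
    have h1 := measurable_fst.comp hw
    have h2 := measurable_snd.comp hw
    have hx := hgx.measurable_comp h1 h2
      (measurable_past_left (ξy := ξy) (2 * t + 1).lt_succ_self)
    have hy := hgy.measurable_comp h1 h2
      (measurable_past_right (ξx := ξx) (2 * t + 1).lt_succ_self)
    exact ((measurable_fst.comp ht').sub (hx.const_smul η)).prodMk
      (h.continuous_proj.measurable.comp ((measurable_snd.comp ht').add (hy.const_smul τ)))

/-- Stochastic EG is a stochastic first-order scheme. -/
theorem isScheme_eg (hs : IsSampling P νx νy ξx ξy)
    (h : IsNonconvexConcave Y f fx fy ℓ G D) (hG : 0 ≤ G)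
    (hgx : IsUnbiasedOracle Y fx νx gx σ) (hgy : IsUnbiasedOracle Y fy νy gy σ)
    (hy₀ : y₀ ∈ Y) {M : ℝ} (hM : G ^ 2 + σ ^ 2 = M ^ 2) (hτ : 0 < τ)
    (hτℓ : 12 * (τ ^ 2 * ℓ ^ 2) ≤ 1) :
    IsScheme P (fun t => past ξx ξy (2 * t + 1)) Y fx fy η σ M (2 * D ^ 2 / τ)
      (9 * τ * σ ^ 2 + 90 * τ * ℓ ^ 2 * η ^ 2 * M ^ 2) x₀
      (fun t ω => (egAt Y gx gy η τ x₀ y₀ ξx ξy t ω).1)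
      (fun t ω => (egHalfAt Y gx gy η τ x₀ y₀ ξx ξy t ω).1)
      (fun t ω => gx (egAt Y gx gy η τ x₀ y₀ ξx ξy t ω).1 (egAt Y gx gy η τ x₀ y₀ ξx ξy t ω).2
        (ξx (2 * t) ω))
      (fun t ω => gx (egHalfAt Y gx gy η τ x₀ y₀ ξx ξy t ω).1
        (egHalfAt Y gx gy η τ x₀ y₀ ξx ξy t ω).2 (ξx (2 * t + 1) ω))
      (fun t ω => (egHalfAt Y gx gy η τ x₀ y₀ ξx ξy t ω).2)
      (fun t ω => gy (egHalfAt Y gx gy η τ x₀ y₀ ξx ξy t ω).1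
        (egHalfAt Y gx gy η τ x₀ y₀ ξx ξy t ω).2 (ξy (2 * t + 1) ω)) := by
  have hz := fun t => measurable_egAt (ξx := ξx) (ξy := ξy) (η := η) (τ := τ) (x₀ := x₀) (y₀ := y₀)
    h hgx hgy t
  have hw := fun t => measurable_egHalfAt h hgx hgy t (hz t)
  have hzY : ∀ t ω, (egAt Y gx gy η τ x₀ y₀ ξx ξy t ω).2 ∈ Y := fun t ω => by
    cases t with
    | zero => exact hy₀
    | succ t => exact h.proj_mem _
  have hwY : ∀ t ω, (egHalfAt Y gx gy η τ x₀ y₀ ξx ξy t ω).2 ∈ Y := fun t ω => h.proj_mem _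
  have hZ : ∀ t ω, (egHalfAt Y gx gy η τ x₀ y₀ ξx ξy t ω).1
      = (egAt Y gx gy η τ x₀ y₀ ξx ξy t ω).1 - η • gx (egAt Y gx gy η τ x₀ y₀ ξx ξy t ω).1
        (egAt Y gx gy η τ x₀ y₀ ξx ξy t ω).2 (ξx (2 * t) ω) := fun t ω => rfl
  have hQ : ∀ t ω, (egHalfAt Y gx gy η τ x₀ y₀ ξx ξy t ω).2
      = proj Y ((egAt Y gx gy η τ x₀ y₀ ξx ξy t ω).2 + τ • gy (egAt Y gx gy η τ x₀ y₀ ξx ξy t ω).1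
        (egAt Y gx gy η τ x₀ y₀ ξx ξy t ω).2 (ξy (2 * t) ω)) := fun t ω => rfl
  have hzs : ∀ t ω, egAt Y gx gy η τ x₀ y₀ ξx ξy (t + 1) ω
      = ((egAt Y gx gy η τ x₀ y₀ ξx ξy t ω).1 - η • gx (egHalfAt Y gx gy η τ x₀ y₀ ξx ξy t ω).1
          (egHalfAt Y gx gy η τ x₀ y₀ ξx ξy t ω).2 (ξx (2 * t + 1) ω),
        proj Y ((egAt Y gx gy η τ x₀ y₀ ξx ξy t ω).2
          + τ • gy (egHalfAt Y gx gy η τ x₀ y₀ ξx ξy t ω).1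
          (egHalfAt Y gx gy η τ x₀ y₀ ξx ξy t ω).2 (ξy (2 * t + 1) ω))) := fun t ω => rfl
  have hz0 : ∀ ω, egAt Y gx gy η τ x₀ y₀ ξx ξy 0 ω = (x₀, y₀) := fun ω => rfl
  -- From here on only the recursions, membership in `Y` and measurability recorded above are used.
  generalize egAt Y gx gy η τ x₀ y₀ ξx ξy = z at *
  generalize egHalfAt Y gx gy η τ x₀ y₀ ξx ξy = w at *
  have nx := fun t => hs.noise_left h hgx (2 * t + 1) (measurable_fst.comp (hw t))
    (measurable_snd.comp (hw t)) (hwY t)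
  have ny := fun t => hs.noise_right h hgy (2 * t + 1) (measurable_fst.comp (hw t))
    (measurable_snd.comp (hw t)) (hwY t)
  have nx0 := fun t => hs.noise_left h hgx (2 * t) (measurable_fst.comp (hz t))
    (measurable_snd.comp (hz t)) (hzY t)
  have ny0 := fun t => hs.noise_right h hgy (2 * t) (measurable_fst.comp (hz t))
    (measurable_snd.comp (hz t)) (hzY t)
  have hH := fun t => (nx0 t).memLp_fx h hG (hs.past_le _) (measurable_fst.comp (hz t))
    (measurable_snd.comp (hz t)) (hzY t)
  simp only [hM, Function.comp_apply] at hH nx ny nx0 ny0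
  refine
    { le := fun t => hs.past_le _
      mono := fun s t hst => past_mono (by omega)
      measurable_W := fun t => (measurable_fst.comp (hz t)).mono (past_mono (by omega)) le_rfl
      measurable_Z := fun t => measurable_fst.comp (hw t)
      measurable_Q := fun t => measurable_snd.comp (hw t)
      measurable_V := fun t => ?_
      mem := hwY
      W_succ := fun t ω => by rw [hzs]
      Z_eq := hZ
      noise_x := nx
      noise_y := ny
      memLp_H := fun t => (hH t).1
      sq_H := fun t => (hH t).2
      memLp_zero := ?_
      sq_zero := ?_
      integral_inner_zero := ?_
      regret := fun s n => ?_ }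
  · have hw' := (hw t).mono (past_mono (ξx := ξx) (ξy := ξy)
      (by omega : 2 * t + 1 ≤ 2 * (t + 1) + 1)) le_rfl
    exact hgy.measurable_comp (measurable_fst.comp hw') (measurable_snd.comp hw')
      (measurable_past_right (by omega))
  · simp [hz0]
  · simp only [hz0, sub_self, norm_zero]
    simp only [ne_eq, OfNat.ofNat_ne_zero, not_false_eq_true, zero_pow, integral_zero]
    positivity
  · simp [hz0]
  -- The gradient variation splits into two oracle errors, the primal half step of length η‖H‖, and
  -- the dual half step, which the regret bound absorbs. The resulting constants are below K₁ and
  -- K₂, whose size is dictated by OGDA.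
  · let n1 : ℕ → Ω → F := fun t ω =>
      gy (w t ω).1 (w t ω).2 (ξy (2 * t + 1) ω) - fy (w t ω).1 (w t ω).2
    let n0 : ℕ → Ω → F := fun t ω =>
      gy (z t ω).1 (z t ω).2 (ξy (2 * t) ω) - fy (z t ω).1 (z t ω).2
    let H : ℕ → Ω → E := fun t ω => gx (z t ω).1 (z t ω).2 (ξx (2 * t) ω)
    let e : ℕ → Ω → ℝ := fun t ω =>
      3 * (‖n1 t ω‖ ^ 2 + ‖n0 t ω‖ ^ 2 + ℓ ^ 2 * (η ^ 2 * ‖H t ω‖ ^ 2))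
    have i1 : ∀ t, Integrable (fun ω => ‖n1 t ω‖ ^ 2) P := fun t =>
      (ny t).memLp.integrable_norm_pow two_ne_zero
    have i0 : ∀ t, Integrable (fun ω => ‖n0 t ω‖ ^ 2) P := fun t =>
      (ny0 t).memLp.integrable_norm_pow two_ne_zero
    have iH : ∀ t, Integrable (fun ω => ℓ ^ 2 * (η ^ 2 * ‖H t ω‖ ^ 2)) P := fun t =>
      (((hH t).1.integrable_norm_pow two_ne_zero).const_mul _).const_mul _
    have i10 : ∀ t, Integrable (fun ω => ‖n1 t ω‖ ^ 2 + ‖n0 t ω‖ ^ 2) P := fun t =>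
      (i1 t).add (i0 t)
    have ie : ∀ t, Integrable (e t) P := fun t => ((i10 t).add (iH t)).const_mul 3
    have ies : Integrable (fun ω => ∑ i ∈ Finset.range n, e (s + i) ω) P :=
      integrable_finsetSum _ fun i _ => ie _
    have he : ∀ t, ∫ ω, e t ω ∂P ≤ 6 * σ ^ 2 + 6 * ℓ ^ 2 * η ^ 2 * M ^ 2 := by
      intro t
      simp only [e]
      rw [integral_const_mul, integral_add (i10 t) (iH t), integral_add (i1 t) (i0 t),
        integral_const_mul, integral_const_mul]
      have b1 := (ny t).sq_le
      have b0 := (ny0 t).sq_le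
      have bH := mul_le_mul_of_nonneg_left (hH t).2 (by positivity : 0 ≤ ℓ ^ 2 * η ^ 2)
      simp only [n1, n0, H]
      linarith
    refine ⟨fun ω => (D ^ 2 + τ ^ 2 * ∑ i ∈ Finset.range n, e (s + i) ω) / (2 * τ),
      ((integrable_const _).add (ies.const_mul _)).div_const _, fun ω u hu => ?_, ?_⟩
    · have hr := extragradient_regret h.nonempty h.isClosed h.convex (τ := τ) (D := D)
        (c := 3 * ℓ ^ 2) (fun y hy y' hy' => h.norm_sub_le hy hy')
        (by linarith [mul_nonneg (sq_nonneg τ) (sq_nonneg ℓ)]) (fun t => (z t ω).2)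
        (fun t => gy (z t ω).1 (z t ω).2 (ξy (2 * t) ω))
        (fun t => gy (w t ω).1 (w t ω).2 (ξy (2 * t + 1) ω)) (fun t => e t ω)
        (fun t => hzY t ω) (fun t => by rw [hzs]) ?_ s n hu
      · simp only [← hQ] at hr
        rw [le_div_iff₀ (by positivity)]
        linarith
      · intro t
        simp only [← hQ]
        have a1 := norm_sub_sq_le_of_noise (fy (w t ω).1 (w t ω).2) (fy (z t ω).1 (z t ω).2)
          (gy (w t ω).1 (w t ω).2 (ξy (2 * t + 1) ω)) (gy (z t ω).1 (z t ω).2 (ξy (2 * t) ω))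
        have a2 := h.fy_sub_sq_le (w t ω).1 (z t ω).1 (hwY t ω) (hzY t ω)
        have a3 : ‖(w t ω).1 - (z t ω).1‖ ^ 2 = η ^ 2 * ‖H t ω‖ ^ 2 := by
          rw [hZ, sub_sub_cancel_left, norm_neg, norm_smul, mul_pow, Real.norm_eq_abs, sq_abs]
        rw [a3] at a2
        simp only [e, n1, n0]
        linarith
    · rw [integral_div, integral_add (integrable_const _) (ies.const_mul _), integral_const,
        probReal_univ, one_smul, integral_const_mul, integral_finsetSum _ fun i _ => ie _]
      have b1 := Finset.sum_le_sum fun i (_ : i ∈ Finset.range n) => he (s + i)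
      rw [Finset.sum_const, Finset.card_range, nsmul_eq_mul] at b1
      have b2 := mul_le_mul_of_nonneg_left b1 (sq_nonneg τ)
      rw [div_le_iff₀ (by positivity)]
      have e1 : 2 * D ^ 2 / τ * (2 * τ) = 4 * D ^ 2 := by field_simp; ring
      rw [add_mul, e1]
      have hn : (0 : ℝ) ≤ n := n.cast_nonneg
      have p1 : 0 ≤ τ ^ 2 * σ ^ 2 := by positivity
      have p2 : 0 ≤ τ ^ 2 * (ℓ ^ 2 * η ^ 2 * M ^ 2) := by positivity
      nlinarith [mul_nonneg hn p1, mul_nonneg hn p2, sq_nonneg D]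

end Sampling

/-! ### Stochastic OGDA as a scheme. -/

section Sampling

variable {Ω E F Ξx Ξy : Type*} [mΩ : MeasurableSpace Ω]
  [NormedAddCommGroup E] [InnerProductSpace ℝ E] [FiniteDimensional ℝ E] [MeasurableSpace E]
  [BorelSpace E]
  [NormedAddCommGroup F] [InnerProductSpace ℝ F] [FiniteDimensional ℝ F] [MeasurableSpace F]
  [BorelSpace F] [MeasurableSpace Ξx] [MeasurableSpace Ξy]
  {P : Measure Ω} [IsProbabilityMeasure P] {νx : Measure Ξx} {νy : Measure Ξy}
  {ξx : ℕ → Ω → Ξx} {ξy : ℕ → Ω → Ξy}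
  {Y : Set F} {f : E → F → ℝ} {fx : E → F → E} {fy : E → F → F} {ℓ G D σ : ℝ}
  {gx : E → F → Ξx → E} {gy : E → F → Ξy → F} {η τ : ℝ} {x₀ : E} {y₀ : F}

/-- OGDA as a random sequence. -/
noncomputable def ogdaAt (Y : Set F) (gx : E → F → Ξx → E) (gy : E → F → Ξy → F) (η τ : ℝ) (x₀ : E)
    (y₀ : F) (ξx : ℕ → Ω → Ξx) (ξy : ℕ → Ω → Ξy) (t : ℕ) (ω : Ω) : OGDAState E F :=
  ogda Y gx gy η τ x₀ y₀ (fun k => ξx k ω) (fun k => ξy k ω) t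

omit mΩ in
theorem measurable_ogdaAt (h : IsNonconvexConcave Y f fx fy ℓ G D)
    (hgx : IsUnbiasedOracle Y fx νx gx σ) (hgy : IsUnbiasedOracle Y fy νy gy σ) (t : ℕ) :
    (Measurable[past ξx ξy (t + 1)] fun ω => (ogdaAt Y gx gy η τ x₀ y₀ ξx ξy t ω).x) ∧
    (Measurable[past ξx ξy (t + 1)] fun ω => (ogdaAt Y gx gy η τ x₀ y₀ ξx ξy t ω).y) ∧
    (Measurable[past ξx ξy (t + 1)] fun ω => (ogdaAt Y gx gy η τ x₀ y₀ ξx ξy t ω).gx) ∧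
    (Measurable[past ξx ξy (t + 1)] fun ω => (ogdaAt Y gx gy η τ x₀ y₀ ξx ξy t ω).gy) := by
  have : ProperSpace E := FiniteDimensional.proper ℝ E
  have : ProperSpace F := FiniteDimensional.proper ℝ F
  induction t with
  | zero =>
    exact ⟨measurable_const, measurable_const,
      hgx.measurable_comp measurable_const measurable_const (measurable_past_left zero_lt_one),
      hgy.measurable_comp measurable_const measurable_const (measurable_past_right zero_lt_one)⟩
  | succ t ih =>
    obtain ⟨h1, h2, h3, h4⟩ := ih
    have hle := past_mono (ξx := ξx) (ξy := ξy) (t + 1).le_succ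
    replace h1 := h1.mono hle le_rfl
    replace h2 := h2.mono hle le_rfl
    replace h3 := h3.mono hle le_rfl
    replace h4 := h4.mono hle le_rfl
    have hx := hgx.measurable_comp h1 h2 (measurable_past_left (ξy := ξy) (t + 1).lt_succ_self)
    have hy := hgy.measurable_comp h1 h2 (measurable_past_right (ξx := ξx) (t + 1).lt_succ_self)
    exact ⟨(h1.sub (hx.const_smul η)).sub ((hx.sub h3).const_smul η),
      h.continuous_proj.measurable.comp
        ((h2.add (hy.const_smul τ)).add ((hy.sub h4).const_smul τ)), hx, hy⟩

/-- Stochastic OGDA is a stochastic first-order scheme. -/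
theorem isScheme_ogda (hs : IsSampling P νx νy ξx ξy)
    (h : IsNonconvexConcave Y f fx fy ℓ G D) (hG : 0 ≤ G)
    (hgx : IsUnbiasedOracle Y fx νx gx σ) (hgy : IsUnbiasedOracle Y fy νy gy σ)
    (hy₀ : y₀ ∈ Y) {M : ℝ} (hM : G ^ 2 + σ ^ 2 = M ^ 2) (hτ : 0 < τ)
    (hτℓ : 12 * (τ ^ 2 * ℓ ^ 2) ≤ 1) :
    IsScheme P (fun t => past ξx ξy (t + 2)) Y fx fy η σ M (2 * D ^ 2 / τ)
      (9 * τ * σ ^ 2 + 90 * τ * ℓ ^ 2 * η ^ 2 * M ^ 2) x₀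
      (fun t ω => (ogdaAt Y gx gy η τ x₀ y₀ ξx ξy (t + 1) ω).x
        + η • (ogdaAt Y gx gy η τ x₀ y₀ ξx ξy (t + 1) ω).gx)
      (fun t ω => (ogdaAt Y gx gy η τ x₀ y₀ ξx ξy (t + 1) ω).x)
      (fun t ω => (ogdaAt Y gx gy η τ x₀ y₀ ξx ξy (t + 1) ω).gx)
      (fun t ω => (ogdaAt Y gx gy η τ x₀ y₀ ξx ξy (t + 2) ω).gx)
      (fun t ω => (ogdaAt Y gx gy η τ x₀ y₀ ξx ξy (t + 1) ω).y)
      (fun t ω => (ogdaAt Y gx gy η τ x₀ y₀ ξx ξy (t + 2) ω).gy) := by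
  have : ProperSpace E := FiniteDimensional.proper ℝ E
  have hz := fun t => measurable_ogdaAt (ξx := ξx) (ξy := ξy) (η := η) (τ := τ) (x₀ := x₀)
    (y₀ := y₀) h hgx hgy t
  have hY : ∀ t ω, (ogdaAt Y gx gy η τ x₀ y₀ ξx ξy t ω).y ∈ Y := fun t ω => by
    cases t with
    | zero => exact hy₀
    | succ t => exact h.proj_mem _
  have hxs : ∀ t ω, (ogdaAt Y gx gy η τ x₀ y₀ ξx ξy (t + 1) ω).x
      = (ogdaAt Y gx gy η τ x₀ y₀ ξx ξy t ω).x
        - η • (ogdaAt Y gx gy η τ x₀ y₀ ξx ξy (t + 1) ω).gx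
        - η • ((ogdaAt Y gx gy η τ x₀ y₀ ξx ξy (t + 1) ω).gx
          - (ogdaAt Y gx gy η τ x₀ y₀ ξx ξy t ω).gx) := fun t ω => rfl
  have hys : ∀ t ω, (ogdaAt Y gx gy η τ x₀ y₀ ξx ξy (t + 1) ω).y
      = proj Y ((ogdaAt Y gx gy η τ x₀ y₀ ξx ξy t ω).y
        + τ • (ogdaAt Y gx gy η τ x₀ y₀ ξx ξy (t + 1) ω).gy
        + τ • ((ogdaAt Y gx gy η τ x₀ y₀ ξx ξy (t + 1) ω).gy
          - (ogdaAt Y gx gy η τ x₀ y₀ ξx ξy t ω).gy)) := fun t ω => rfl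
  -- State `t` stores the gradient taken at state t - 1. Truncated subtraction makes this correct at
  -- t = 0 as well, since the initial estimate is taken at (x₀, y₀).
  have hgxs : ∀ t ω, (ogdaAt Y gx gy η τ x₀ y₀ ξx ξy t ω).gx
      = gx (ogdaAt Y gx gy η τ x₀ y₀ ξx ξy (t - 1) ω).x
        (ogdaAt Y gx gy η τ x₀ y₀ ξx ξy (t - 1) ω).y (ξx t ω) := fun t ω => by
    cases t <;> rfl
  have hgys : ∀ t ω, (ogdaAt Y gx gy η τ x₀ y₀ ξx ξy t ω).gy
      = gy (ogdaAt Y gx gy η τ x₀ y₀ ξx ξy (t - 1) ω).x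
        (ogdaAt Y gx gy η τ x₀ y₀ ξx ξy (t - 1) ω).y (ξy t ω) := fun t ω => by
    cases t <;> rfl
  have hx0 : ∀ ω, (ogdaAt Y gx gy η τ x₀ y₀ ξx ξy 0 ω).x = x₀ := fun ω => rfl
  have hprev : ∀ t, (Measurable[past ξx ξy t] fun ω => (ogdaAt Y gx gy η τ x₀ y₀ ξx ξy (t - 1) ω).x)
      ∧ Measurable[past ξx ξy t] fun ω => (ogdaAt Y gx gy η τ x₀ y₀ ξx ξy (t - 1) ω).y := by
    intro t
    cases t with
    | zero => exact ⟨measurable_const, measurable_const⟩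
    | succ t => exact ⟨(hz t).1, (hz t).2.1⟩
  generalize ogdaAt Y gx gy η τ x₀ y₀ ξx ξy = z at *
  have nx : ∀ t, IsNoise (past ξx ξy t) P
      (fun ω => (z t ω).gx - fx (z (t - 1) ω).x (z (t - 1) ω).y) σ := by
    intro t
    simp only [hgxs]
    exact hs.noise_left h hgx t (hprev t).1 (hprev t).2 (hY (t - 1))
  have ny : ∀ t, IsNoise (past ξx ξy t) P
      (fun ω => (z t ω).gy - fy (z (t - 1) ω).x (z (t - 1) ω).y) σ := by
    intro t
    simp only [hgys]
    exact hs.noise_right h hgy t (hprev t).1 (hprev t).2 (hY (t - 1))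
  have hg := fun t => (nx t).memLp_fx h hG (hs.past_le _) (hprev t).1 (hprev t).2 (hY (t - 1))
  rw [hM] at hg
  -- Both estimates are taken at (x₀, y₀), so the exact gradient cancels and the offset of the first
  -- anchor is pure noise. This is why the scheme starts from state 1.
  have hW0 : ∀ ω, (z 1 ω).x + η • (z 1 ω).gx - x₀
      = (-η) • (((z 1 ω).gx - fx (z 0 ω).x (z 0 ω).y) - ((z 0 ω).gx - fx (z 0 ω).x (z 0 ω).y)) := by
    intro ω
    rw [hxs 0, hx0]
    module
  have m1 : MemLp (fun ω => (z 1 ω).gx - fx (z 0 ω).x (z 0 ω).y) 2 P := (nx 1).memLp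
  have m0 : MemLp (fun ω => (z 0 ω).gx - fx (z 0 ω).x (z 0 ω).y) 2 P := (nx 0).memLp
  have mW : MemLp (fun ω => (z 1 ω).x + η • (z 1 ω).gx - x₀) 2 P := by
    simp only [hW0]
    exact (m1.sub m0).const_smul (-η)
  refine
    { le := fun t => hs.past_le _
      mono := fun s t hst => past_mono (by omega)
      measurable_W := fun t => (hz (t + 1)).1.add ((hz (t + 1)).2.2.1.const_smul η)
      measurable_Z := fun t => (hz (t + 1)).1
      measurable_Q := fun t => (hz (t + 1)).2.1
      measurable_V := fun t => (hz (t + 2)).2.2.2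
      mem := fun t => hY (t + 1)
      W_succ := fun t ω => by rw [hxs (t + 1)]; module
      Z_eq := fun t ω => by abel
      noise_x := fun t => nx (t + 2)
      noise_y := fun t => ny (t + 2)
      memLp_H := fun t => (hg (t + 1)).1
      sq_H := fun t => (hg (t + 1)).2
      memLp_zero := mW
      sq_zero := ?_
      integral_inner_zero := fun c => ?_
      regret := fun s n => ?_ }
  · have i1 := m1.integrable_norm_pow two_ne_zero
    have i0 := m0.integrable_norm_pow two_ne_zero
    calc ∫ ω, ‖(z 1 ω).x + η • (z 1 ω).gx - x₀‖ ^ 2 ∂P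
        ≤ ∫ ω, (2 * η ^ 2 * ‖(z 1 ω).gx - fx (z 0 ω).x (z 0 ω).y‖ ^ 2
          + 2 * η ^ 2 * ‖(z 0 ω).gx - fx (z 0 ω).x (z 0 ω).y‖ ^ 2) ∂P := by
          refine integral_mono (mW.integrable_norm_pow two_ne_zero)
            ((i1.const_mul _).add (i0.const_mul _)) fun ω => ?_
          simp only
          rw [hW0, norm_smul, mul_pow, norm_neg, Real.norm_eq_abs, sq_abs]
          set p := (z 1 ω).gx - fx (z 0 ω).x (z 0 ω).y
          set q := (z 0 ω).gx - fx (z 0 ω).x (z 0 ω).y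
          have e1 : ‖p - q‖ ^ 2 ≤ 2 * ‖p‖ ^ 2 + 2 * ‖q‖ ^ 2 := by
            have := norm_sub_le p q
            nlinarith [sq_nonneg (‖p‖ - ‖q‖), norm_nonneg (p - q)]
          nlinarith [mul_le_mul_of_nonneg_left e1 (sq_nonneg η)]
      _ ≤ 4 * η ^ 2 * σ ^ 2 := by
          rw [integral_add (i1.const_mul _) (i0.const_mul _), integral_const_mul,
            integral_const_mul]
          have b1 : ∫ ω, ‖(z 1 ω).gx - fx (z 0 ω).x (z 0 ω).y‖ ^ 2 ∂P ≤ σ ^ 2 := (nx 1).sq_le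
          have b0 : ∫ ω, ‖(z 0 ω).gx - fx (z 0 ω).x (z 0 ω).y‖ ^ 2 ∂P ≤ σ ^ 2 := (nx 0).sq_le
          nlinarith [mul_le_mul_of_nonneg_left b1 (sq_nonneg η),
            mul_le_mul_of_nonneg_left b0 (sq_nonneg η)]
  · have b1 : ∫ ω, ⟪c, (z 1 ω).gx - fx (z 0 ω).x (z 0 ω).y⟫ ∂P = 0 :=
      (nx 1).integral_inner (fun _ => c) measurable_const (memLp_const c)
    have b0 : ∫ ω, ⟪c, (z 0 ω).gx - fx (z 0 ω).x (z 0 ω).y⟫ ∂P = 0 :=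
      (nx 0).integral_inner (fun _ => c) measurable_const (memLp_const c)
    simp only [zero_add, hW0, real_inner_smul_right]
    rw [integral_const_mul]
    simp only [inner_sub_right c ((z 1 _).gx - _)]
    rw [integral_sub (integrable_inner_of_memLp (memLp_const c) m1)
      (integrable_inner_of_memLp (memLp_const c) m0), b1, b0]
    simp
  · let N : ℕ → Ω → F := fun t ω => (z t ω).gy - fy (z (t - 1) ω).x (z (t - 1) ω).y
    let d : ℕ → Ω → E := fun t ω => (z t ω).x - (z (t - 1) ω).x
    let e : ℕ → Ω → ℝ := fun t ω =>
      3 * (‖N (t + 1) ω‖ ^ 2 + ‖N t ω‖ ^ 2 + ℓ ^ 2 * ‖d t ω‖ ^ 2)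
    have hd : ∀ t, MemLp (d t) 2 P ∧ ∫ ω, ‖d t ω‖ ^ 2 ∂P ≤ 20 * η ^ 2 * M ^ 2 := by
      intro t
      cases t with
      | zero =>
        have e0 : d 0 = fun _ => 0 := funext fun ω => sub_self _
        rw [e0]
        refine ⟨memLp_const 0, ?_⟩
        simp only [norm_zero, ne_eq, OfNat.ofNat_ne_zero, not_false_eq_true, zero_pow,
          integral_zero]
        positivity
      | succ t =>
        have e0 : ∀ ω, d (t + 1) ω = (-η) • ((2 : ℝ) • (z (t + 1) ω).gx - (z t ω).gx) := by
          intro ω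
          simp only [d, add_tsub_cancel_right, hxs t]
          module
        have md : MemLp (d (t + 1)) 2 P := by
          refine ((((hg (t + 1)).1.const_smul (2 : ℝ)).sub (hg t).1).const_smul (-η)).ae_eq ?_
          exact Filter.Eventually.of_forall fun ω => (e0 ω).symm
        have i1 := (hg (t + 1)).1.integrable_norm_pow two_ne_zero
        have i0 := (hg t).1.integrable_norm_pow two_ne_zero
        refine ⟨md, ?_⟩
        calc ∫ ω, ‖d (t + 1) ω‖ ^ 2 ∂P
            ≤ ∫ ω, (8 * η ^ 2 * ‖(z (t + 1) ω).gx‖ ^ 2 + 2 * η ^ 2 * ‖(z t ω).gx‖ ^ 2) ∂P := by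
              refine integral_mono (md.integrable_norm_pow two_ne_zero)
                ((i1.const_mul _).add (i0.const_mul _)) fun ω => ?_
              simp only
              rw [e0, norm_smul, mul_pow, norm_neg, Real.norm_eq_abs, sq_abs]
              have e1 := norm_sub_le ((2 : ℝ) • (z (t + 1) ω).gx) (z t ω).gx
              rw [norm_smul, Real.norm_eq_abs, abs_two] at e1
              have e2 : ‖(2 : ℝ) • (z (t + 1) ω).gx - (z t ω).gx‖ ^ 2
                  ≤ 8 * ‖(z (t + 1) ω).gx‖ ^ 2 + 2 * ‖(z t ω).gx‖ ^ 2 := by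
                nlinarith [sq_nonneg (2 * ‖(z (t + 1) ω).gx‖ - ‖(z t ω).gx‖),
                  norm_nonneg ((2 : ℝ) • (z (t + 1) ω).gx - (z t ω).gx)]
              nlinarith [mul_le_mul_of_nonneg_left e2 (sq_nonneg η)]
          _ ≤ 20 * η ^ 2 * M ^ 2 := by
              rw [integral_add (i1.const_mul _) (i0.const_mul _), integral_const_mul,
                integral_const_mul]
              nlinarith [mul_le_mul_of_nonneg_left (hg (t + 1)).2 (sq_nonneg η),
                mul_le_mul_of_nonneg_left (hg t).2 (sq_nonneg η)]
    have iN : ∀ t, Integrable (fun ω => ‖N t ω‖ ^ 2) P := fun t =>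
      (ny t).memLp.integrable_norm_pow two_ne_zero
    have iD : ∀ t, Integrable (fun ω => ℓ ^ 2 * ‖d t ω‖ ^ 2) P := fun t =>
      ((hd t).1.integrable_norm_pow two_ne_zero).const_mul _
    have iNN : ∀ t, Integrable (fun ω => ‖N (t + 1) ω‖ ^ 2 + ‖N t ω‖ ^ 2) P := fun t =>
      (iN (t + 1)).add (iN t)
    have ie : ∀ t, Integrable (e t) P := fun t => ((iNN t).add (iD t)).const_mul 3
    have ies : Integrable (fun ω => ∑ i ∈ Finset.range (n + 1), e (s + i) ω) P :=
      integrable_finsetSum _ fun i _ => ie _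
    have he : ∀ t, ∫ ω, e t ω ∂P ≤ 6 * σ ^ 2 + 60 * ℓ ^ 2 * η ^ 2 * M ^ 2 := by
      intro t
      simp only [e]
      rw [integral_const_mul, integral_add (iNN t) (iD t), integral_add (iN (t + 1)) (iN t),
        integral_const_mul]
      have b1 : ∫ ω, ‖N (t + 1) ω‖ ^ 2 ∂P ≤ σ ^ 2 := (ny (t + 1)).sq_le
      have b0 : ∫ ω, ‖N t ω‖ ^ 2 ∂P ≤ σ ^ 2 := (ny t).sq_le
      have bd := mul_le_mul_of_nonneg_left (hd t).2 (sq_nonneg ℓ)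
      linarith
    -- The mean of this majorant is the source of K₁ and K₂: (4D² + 3τ²(n + 1)(6σ² + 60ℓ²η²M²)) /
    -- (2τ).
    refine ⟨fun ω => (4 * D ^ 2 + 3 * τ ^ 2 * ∑ i ∈ Finset.range (n + 1), e (s + i) ω) / (2 * τ),
      ((integrable_const _).add (ies.const_mul _)).div_const _, fun ω u hu => ?_, ?_⟩
    · have hr := optimistic_regret h.nonempty h.isClosed h.convex (τ := τ) (D := D)
        (c := 3 * ℓ ^ 2) (fun y hy y' hy' => h.norm_sub_le hy hy')
        (by linarith) (fun t => (z t ω).y)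
        (fun t => (z t ω).gy) (fun t => e t ω)
        (fun t => hY t ω) (fun t => hys t ω) (fun t => by simp only [e]; positivity) ?_ s n hu
      · rw [le_div_iff₀ (by positivity)]
        linarith
      · intro t
        have a1 := norm_sub_sq_le_of_noise (fy (z t ω).x (z t ω).y)
          (fy (z (t - 1) ω).x (z (t - 1) ω).y) (z (t + 1) ω).gy (z t ω).gy
        have a2 := h.fy_sub_sq_le (z t ω).x (z (t - 1) ω).x (hY t ω) (hY (t - 1) ω)
        simp only [e, N, d, add_tsub_cancel_right]
        linarith
    · rw [integral_div, integral_add (integrable_const _) (ies.const_mul _), integral_const,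
        probReal_univ, one_smul, integral_const_mul, integral_finsetSum _ fun i _ => ie _]
      have b1 := Finset.sum_le_sum fun i (_ : i ∈ Finset.range (n + 1)) => he (s + i)
      rw [Finset.sum_const, Finset.card_range, nsmul_eq_mul] at b1
      have b2 := mul_le_mul_of_nonneg_left b1 (by positivity : 0 ≤ 3 * τ ^ 2)
      rw [div_le_iff₀ (by positivity)]
      have e1 : 2 * D ^ 2 / τ * (2 * τ) = 4 * D ^ 2 := by field_simp; ring
      rw [add_mul, e1]
      push_cast at b2
      linarith

end Sampling

/-! ### The prescribed step sizes. -/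

section StepSizes

variable {ℓ G D σ ε : ℝ}

/-- The last two entries differ by the factor σ²/ε², so they merge into one through max {1, σ²/ε²};
this also removes the case distinction on σ. -/
theorem primalStep_eq (hℓ : 0 < ℓ) (hG : 0 < G) (hD : 0 < D) (hσ : 0 ≤ σ) (hε : 0 < ε) :
    primalStep ℓ G D σ ε = min (ε ^ 2 / (ℓ * (G ^ 2 + σ ^ 2)))
      (ε ^ 4 / (D ^ 2 * ℓ ^ 3 * G * √(G ^ 2 + σ ^ 2) * max 1 (σ ^ 2 / ε ^ 2))) := by
  have hM : 0 < √(G ^ 2 + σ ^ 2) := Real.sqrt_pos.2 (by positivity)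
  unfold primalStep
  simp only
  split_ifs with h0
  · subst h0
    simp
  · have hσ' : 0 < σ := lt_of_le_of_ne hσ (Ne.symm h0)
    rw [min_assoc]
    congr 1
    set A := D ^ 2 * ℓ ^ 3 * G * √(G ^ 2 + σ ^ 2) with hA
    have hA0 : 0 < A := by positivity
    have e : ε ^ 6 / (D ^ 2 * ℓ ^ 3 * σ ^ 2 * G * √(G ^ 2 + σ ^ 2))
        = ε ^ 4 / (A * (σ ^ 2 / ε ^ 2)) := by
      rw [hA]; field_simp
    rw [e]
    rcases le_total (σ ^ 2 / ε ^ 2) 1 with h1 | h1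
    · rw [max_eq_left h1, mul_one, min_eq_left]
      gcongr
      exact mul_le_of_le_one_right hA0.le h1
    · rw [max_eq_right h1, min_eq_right]
      gcongr
      exact le_mul_of_one_le_right hA0.le h1

/-- The lower bound keeps the regret term D²/τ in check; the upper bounds give stability of the dual
method and small dual noise. -/
theorem dualStep_bounds (hℓ : 0 < ℓ) (hσ : 0 ≤ σ) (hε : 0 < ε) :
    1 ≤ 4 * ℓ * max 1 (σ ^ 2 / ε ^ 2) * dualStep ℓ σ ε ∧ 4 * ℓ * dualStep ℓ σ ε ≤ 1 ∧
      ℓ * dualStep ℓ σ ε * σ ^ 2 ≤ ε ^ 2 := by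
  unfold dualStep
  have e1 : 4 * ℓ * (1 / (4 * ℓ)) = 1 := by field_simp
  split_ifs with h0
  · subst h0
    refine ⟨?_, e1.le, by simp; positivity⟩
    rw [mul_assoc, mul_comm (max _ _), ← mul_assoc, e1, one_mul]
    exact le_max_left _ _
  · have hσ' : 0 < σ := lt_of_le_of_ne hσ (Ne.symm h0)
    refine ⟨?_, ?_, ?_⟩
    · rcases min_choice (1 / (4 * ℓ)) (ε ^ 2 / (ℓ * σ ^ 2)) with h1 | h1 <;> rw [h1]
      · rw [mul_assoc, mul_comm (max _ _), ← mul_assoc, e1, one_mul]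
        exact le_max_left _ _
      · have e2 : 4 * ℓ * (σ ^ 2 / ε ^ 2) * (ε ^ 2 / (ℓ * σ ^ 2)) = 4 := by field_simp
        have e3 : 4 * ℓ * (σ ^ 2 / ε ^ 2) * (ε ^ 2 / (ℓ * σ ^ 2))
            ≤ 4 * ℓ * max 1 (σ ^ 2 / ε ^ 2) * (ε ^ 2 / (ℓ * σ ^ 2)) := by
          gcongr
          exact le_max_right _ _
        linarith
    · exact (mul_le_mul_of_nonneg_left (min_le_left _ _) (by positivity)).trans e1.le
    · have e2 : ℓ * (ε ^ 2 / (ℓ * σ ^ 2)) * σ ^ 2 = ε ^ 2 := by field_simp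
      exact (mul_le_mul_of_nonneg_right (mul_le_mul_of_nonneg_left (min_le_right _ _) hℓ.le)
        (sq_nonneg σ)).trans e2.le

end StepSizes

/-! ### From step sizes to the complexity bound. -/

namespace IsScheme

variable {Ω E F : Type*} [mΩ : MeasurableSpace Ω]
  [NormedAddCommGroup E] [InnerProductSpace ℝ E] [FiniteDimensional ℝ E] [MeasurableSpace E]
  [BorelSpace E]
  [NormedAddCommGroup F] [InnerProductSpace ℝ F] [FiniteDimensional ℝ F] [MeasurableSpace F]
  [BorelSpace F]
  {P : Measure Ω} [IsProbabilityMeasure P] {m : ℕ → MeasurableSpace Ω}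
  {Y : Set F} {f : E → F → ℝ} {fx : E → F → E} {fy : E → F → F} {ℓ G D η σ M τ ε κ cx cy : ℝ}
  {x₀ : E} {W Z H U : ℕ → Ω → E} {Q V : ℕ → Ω → F}

/-- Stationarity over a number of steps in which the scheme cannot move far. -/
theorem grad_sum_le_of_short {K₁ K₂ : ℝ}
    (S : IsScheme P m Y fx fy η σ M K₁ K₂ x₀ W Z H U Q V)
    (h : IsNonconvexConcave Y f fx fy ℓ G D) (hℓ : 0 < ℓ) (hG : 0 < G)
    (hM : G ^ 2 + σ ^ 2 = M ^ 2) (hM0 : 0 < M) (hη : 0 < η)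
    (hεM : ε ^ 2 ≤ M * G) (hb : BddBelow (Set.range (envelope Y f ℓ)))
    {T : ℕ} (hT : 80 * initialGap Y f ℓ x₀ ≤ η * ε ^ 2 * (T + 1))
    (hshort : 6144 * (ℓ * η * (M * G)) * (T + 1) ≤ ε ^ 2) :
    ‖envelopeGrad Y f ℓ x₀‖ ^ 2
      + ∑ t ∈ Finset.range T, ∫ ω, ‖envelopeGrad Y f ℓ (Z t ω)‖ ^ 2 ∂P ≤ (T + 1) * ε ^ 2 := by
  have hε2 := sq_nonneg ε
  -- A horizon that is at least 80Δ/(ηε²) and yet short forces Δ itself to be small.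
  have hΔ : 4 * ℓ * initialGap Y f ℓ x₀ ≤ ε ^ 2 / 4 := by
    have c0 := mul_le_mul_of_nonneg_left hT hℓ.le
    have c1 : ℓ * η * ε ^ 2 * (T + 1) ≤ ℓ * η * (M * G) * (T + 1) := by gcongr
    linarith
  have hterm : ∀ t ∈ Finset.range T, ∫ ω, ‖envelopeGrad Y f ℓ (Z t ω)‖ ^ 2 ∂P ≤ ε ^ 2 := by
    intro t ht
    have c1 := S.grad_Z_le h hℓ hG hM hM0 hη hb t
    have c2 : (t : ℝ) + 2 ≤ T + 1 := by
      have := Finset.mem_range.1 ht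
      exact_mod_cast (by omega : t + 2 ≤ T + 1)
    have c3 := mul_le_mul_of_nonneg_left c2 (by positivity : 0 ≤ 8 * (ℓ * η * (M * G)))
    linarith
  have hsum := Finset.sum_le_sum hterm
  rw [Finset.sum_const, Finset.card_range, nsmul_eq_mul] at hsum
  have h0 := h.norm_envelopeGrad_sq_le hℓ hb x₀
  unfold initialGap at hΔ
  linarith

/-- Stationarity over a number of steps that is not less than the block length `B`. -/
theorem grad_sum_le_of_long {K₁ K₂ : ℝ}
    (S : IsScheme P m Y fx fy η σ M K₁ K₂ x₀ W Z H U Q V)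
    (h : IsNonconvexConcave Y f fx fy ℓ G D) (hℓ : 0 < ℓ) (hG : 0 < G)
    (hM : G ^ 2 + σ ^ 2 = M ^ 2) (hM0 : 0 < M) (hη : 0 < η) (hτ : 0 < τ)
    (hb : BddBelow (Set.range (envelope Y f ℓ))) (hK₁ : 0 ≤ K₁) (hK₂ : 0 ≤ K₂) (hℓη : ℓ * η ≤ 1)
    (hstep : 432 * (ℓ * η * M ^ 2) ≤ ε ^ 2 / 8) {B : ℕ} (hB : 1 ≤ B)
    (hnoise : ℓ * (2 * K₂ + τ * σ ^ 2 / 2 + 12 * G * M * η * B) ≤ ε ^ 2 / 256)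
    {T : ℕ} (hBT : B ≤ T) (hT : 80 * initialGap Y f ℓ x₀ ≤ η * ε ^ 2 * (T + 1))
    (hregret : ℓ * (((T : ℝ) / B + 1) * (K₁ + D ^ 2 / (2 * τ))) ≤ T * ε ^ 2 / 256) :
    ‖envelopeGrad Y f ℓ x₀‖ ^ 2
      + ∑ t ∈ Finset.range T, ∫ ω, ‖envelopeGrad Y f ℓ (Z t ω)‖ ^ 2 ∂P ≤ (T + 1) * ε ^ 2 := by
  obtain ⟨R, hRi, hR, hRint⟩ := S.gap_sum h hG hM hM0 hη.le hτ hK₁ hK₂ hB T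
  have hmain := S.grad_Z_sum_le h hℓ hG hM hM0 hη hℓη hb (hB.trans hBT) hRi hR
  have h0 : ‖envelopeGrad Y f ℓ x₀‖ ^ 2 ≤ 4 * ℓ * initialGap Y f ℓ x₀ :=
    h.norm_envelopeGrad_sq_le hℓ hb x₀
  have hΔ0 : 0 ≤ initialGap Y f ℓ x₀ := sub_nonneg.2 (ciInf_le hb x₀)
  have d1 : initialGap Y f ℓ x₀ / η ≤ ε ^ 2 * (T + 1) / 80 := by
    rw [div_le_iff₀ hη]; linarith
  have d2 : ℓ * initialGap Y f ℓ x₀ ≤ initialGap Y f ℓ x₀ / η := by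
    rw [le_div_iff₀ hη]
    have := mul_le_mul_of_nonneg_right hℓη hΔ0
    linarith
  have e : 16 * initialGap Y f ℓ x₀ / η = 16 * (initialGap Y f ℓ x₀ / η) := by ring
  rw [e] at hmain
  have c5 := mul_le_mul_of_nonneg_left hRint hℓ.le
  have hT0 : (0 : ℝ) ≤ T := T.cast_nonneg
  have c6 := mul_le_mul_of_nonneg_left hnoise hT0
  have c7 := mul_le_mul_of_nonneg_left hstep hT0
  have c8 := mul_nonneg hT0 (sq_nonneg ε)
  have c9 := sq_nonneg ε
  -- Shares of ε² per step: at most 1/20 for x₀, 1/5 for the initial gap, 1/8 each for regret and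
  -- dual noise with drift, 1/8 for the primal step; together less than 1.
  linarith

/-- Average stationarity of a scheme whose step sizes are small enough. -/
theorem grad_sum_le (S : IsScheme P m Y fx fy η σ M (2 * D ^ 2 / τ)
      (9 * τ * σ ^ 2 + 90 * τ * ℓ ^ 2 * η ^ 2 * M ^ 2) x₀ W Z H U Q V)
    (h : IsNonconvexConcave Y f fx fy ℓ G D) (hℓ : 0 < ℓ) (hG : 0 < G)
    (hM : G ^ 2 + σ ^ 2 = M ^ 2) (hM0 : 0 < M) (hη : 0 < η) (hτ : 0 < τ) (hε : 0 < ε)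
    (hεG : ε ≤ G) (hb : BddBelow (Set.range (envelope Y f ℓ)))
    (hcy : 0 < cy) (hcy' : cy ≤ 1 / 20000) (hcx : 0 < cx) (hcx' : cx ≤ cy / 62914560)
    (h₁ : ℓ * η * M ^ 2 ≤ cx * ε ^ 2) (h₂ : η * (D ^ 2 * ℓ ^ 3 * G * M * κ) ≤ cx * ε ^ 4)
    (h₃ : cy ≤ 4 * ℓ * κ * τ) (h₄ : 4 * ℓ * τ ≤ cy) (h₅ : ℓ * τ * σ ^ 2 ≤ cy * ε ^ 2)
    {T : ℕ} (hT : 80 * initialGap Y f ℓ x₀ ≤ η * ε ^ 2 * (T + 1)) :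
    ‖envelopeGrad Y f ℓ x₀‖ ^ 2
      + ∑ t ∈ Finset.range T, ∫ ω, ‖envelopeGrad Y f ℓ (Z t ω)‖ ^ 2 ∂P ≤ (T + 1) * ε ^ 2 := by
  have hε2 : 0 < ε ^ 2 := by positivity
  have hGM : G ≤ M := by nlinarith [sq_nonneg σ]
  have hεM : ε ^ 2 ≤ M * G := by nlinarith
  have hcx1 : cx ≤ 1 / 1000000 := by linarith
  have hℓη : ℓ * η ≤ cx := by
    have h1 : ℓ * η * M ^ 2 ≤ cx * M ^ 2 :=
      h₁.trans (mul_le_mul_of_nonneg_left (by nlinarith) hcx.le)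
    exact le_of_mul_le_mul_right h1 (by positivity)
  have hcxε : cx * ε ^ 2 ≤ 1 / 1000000 * ε ^ 2 := mul_le_mul_of_nonneg_right hcx1 hε2.le
  have hcyε : cy * ε ^ 2 ≤ 1 / 20000 * ε ^ 2 := mul_le_mul_of_nonneg_right hcy' hε2.le
  obtain ⟨q, hq⟩ : ∃ q, q = ℓ * η * (M * G) := ⟨_, rfl⟩
  have hq0 : 0 < q := by rw [hq]; positivity
  have hqε : q ≤ cx * ε ^ 2 := by
    refine le_trans ?_ h₁
    rw [hq, sq]
    gcongr
  -- The ideal block length: the drift term 12qb is then ε²/512, half of the ε²/256 allowed for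
  -- noise and drift.
  obtain ⟨b, hbdef⟩ : ∃ b, b = ε ^ 2 / (6144 * q) := ⟨_, rfl⟩
  have hb1 : 1 ≤ b := by
    rw [hbdef, le_div_iff₀ (by positivity)]
    linarith
  obtain ⟨B, hB⟩ : ∃ B, B = ⌊b⌋₊ := ⟨_, rfl⟩
  have hBb : (B : ℝ) ≤ b := hB ▸ Nat.floor_le (by linarith)
  have hB1 : 1 ≤ B := hB ▸ Nat.le_floor (by simpa using hb1)
  have hB1' : (1 : ℝ) ≤ B := by exact_mod_cast hB1
  have hBb2 : b ≤ 2 * B := by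
    have := Nat.lt_floor_add_one b
    rw [← hB] at this
    linarith
  have hqb : 6144 * q * b = ε ^ 2 := by rw [hbdef]; field_simp
  have hqB : 6144 * q * B ≤ ε ^ 2 := by
    rw [← hqb]; gcongr
  rcases lt_or_ge T B with hTB | hTB
  · refine S.grad_sum_le_of_short h hℓ hG hM hM0 hη hεM hb hT (le_trans ?_ hqB)
    rw [← hq]
    gcongr
    exact_mod_cast hTB
  · have hT0 : (0 : ℝ) ≤ T := T.cast_nonneg
    have hTB' : (B : ℝ) ≤ T := by exact_mod_cast hTB
    refine S.grad_sum_le_of_long h hℓ hG hM hM0 hη hτ hb (by positivity) (by positivity)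
      (by linarith) (by linarith) hB1 ?_ hTB hT ?_
    · have d1 : ℓ * τ * (ℓ * η) * (ℓ * η * M ^ 2) ≤ 1 * 1 * (cx * ε ^ 2) := by
        gcongr
        · linarith
        · linarith
      have d5 : ℓ * (2 * (9 * τ * σ ^ 2 + 90 * τ * ℓ ^ 2 * η ^ 2 * M ^ 2) + τ * σ ^ 2 / 2
        + 12 * G * M * η * B) = 37 / 2 * (ℓ * τ * σ ^ 2)
          + 180 * (ℓ * τ * (ℓ * η) * (ℓ * η * M ^ 2)) + 12 * q * B := by
        rw [hq]; ring
      rw [d5]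
      linarith
    · have hκ : 0 < κ := by
        by_contra! hκ
        have h1 : 4 * ℓ * τ * κ ≤ 0 :=
          mul_nonpos_of_nonneg_of_nonpos (by positivity) hκ
        linarith
      -- Since T ≥ B, the extra block costs a factor two, and rounding `b` down to `B` costs at most
      -- another.
      have d1 : (T : ℝ) / B + 1 ≤ 4 * T * (6144 * q) / ε ^ 2 := by
        have e0 : 1 ≤ (T : ℝ) / B := by rw [le_div_iff₀ (by linarith)]; linarith
        have e1 : (T : ℝ) / B + 1 ≤ 2 * (T / B) := by linarith
        refine e1.trans ?_
        rw [le_div_iff₀ hε2, ← hqb]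
        have e2 : (T : ℝ) / B * b ≤ 2 * T := by
          rw [div_mul_eq_mul_div, div_le_iff₀ (by linarith)]
          have := mul_le_mul_of_nonneg_left hBb2 hT0
          linarith
        have e3 := mul_le_mul_of_nonneg_left e2 hq0.le
        linarith
      have d2 : 2 * D ^ 2 / τ + D ^ 2 / (2 * τ) ≤ 10 * ℓ * κ * D ^ 2 / cy := by
        have e1 : 2 * D ^ 2 / τ + D ^ 2 / (2 * τ) = 5 / 2 * D ^ 2 / τ := by field_simp; ring
        rw [e1, div_le_div_iff₀ hτ hcy]
        have := mul_le_mul_of_nonneg_left h₃ (sq_nonneg D)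
        linarith
      -- Here 62914560 = 245760 · 256 with 245760 = 4 · 6144 · 10, the constants of `d1` and `d2`.
      have d3 : η * (D ^ 2 * ℓ ^ 3 * G * M * κ) ≤ cy / 62914560 * ε ^ 4 :=
        h₂.trans (mul_le_mul_of_nonneg_right hcx' (by positivity))
      calc ℓ * (((T : ℝ) / B + 1) * (2 * D ^ 2 / τ + D ^ 2 / (2 * τ)))
          ≤ ℓ * (4 * T * (6144 * q) / ε ^ 2 * (10 * ℓ * κ * D ^ 2 / cy)) := by gcongr
        _ = 245760 * T / (ε ^ 2 * cy) * (η * (D ^ 2 * ℓ ^ 3 * G * M * κ)) := by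
            rw [hq]; field_simp; ring
        _ ≤ 245760 * T / (ε ^ 2 * cy) * (cy / 62914560 * ε ^ 4) :=
            mul_le_mul_of_nonneg_left d3 (by positivity)
        _ = T * ε ^ 2 / 256 := by field_simp; ring

/-- A scheme run with the prescribed step sizes reaches stationarity. -/
theorem reachesStationarity [CompleteSpace E]
    (h : IsNonconvexConcave Y f fx fy ℓ G D) (hℓ : 0 < ℓ) (hG : 0 < G) (hD : 0 < D) (hσ : 0 ≤ σ)
    (hε : 0 < ε) (hb : BddBelow (Set.range (envelope Y f ℓ)))
    (hcy : 0 < cy) (hcy' : cy ≤ 1 / 20000) (hcx : 0 < cx) (hcx' : cx ≤ cy / 62914560)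
    (hη : η = cx * primalStep ℓ G D σ ε) (hτ : τ = cy * dualStep ℓ σ ε)
    (S : IsScheme P m Y fx fy η σ (√(G ^ 2 + σ ^ 2)) (2 * D ^ 2 / τ)
      (9 * τ * σ ^ 2 + 90 * τ * ℓ ^ 2 * η ^ 2 * √(G ^ 2 + σ ^ 2) ^ 2) x₀ W Z H U Q V)
    {z : ℕ → Ω → E} (hz0 : ∀ ω, z 0 ω = x₀) (hz : ∀ t ω, z (t + 1) ω = Z t ω)
    {evals : ℕ → ℕ} (hev : ∀ T, evals T ≤ 4 * T) :
    ReachesStationarity P (envelope Y f ℓ) z evals (320 / cx) ℓ G D σ ε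
      (initialGap Y f ℓ x₀) := by
  set M := √(G ^ 2 + σ ^ 2) with hMdef
  have hM : G ^ 2 + σ ^ 2 = M ^ 2 := (Real.sq_sqrt (by positivity)).symm
  have hM0 : 0 < M := Real.sqrt_pos.2 (by positivity)
  set κ := max 1 (σ ^ 2 / ε ^ 2) with hκ
  have hκ1 : 1 ≤ κ := le_max_left _ _
  have hκ0 : 0 < κ := by linarith
  set Δ := initialGap Y f ℓ x₀ with hΔ
  have hΔ0 : 0 ≤ Δ := sub_nonneg.2 (ciInf_le hb x₀)
  have hps := primalStep_eq hℓ hG hD hσ hε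
  rw [← hMdef, ← hκ, hM] at hps
  have hps0 : 0 < primalStep ℓ G D σ ε := by rw [hps]; positivity
  have hη0 : 0 < η := by rw [hη]; positivity
  have hzm : ∀ t, Measurable (z t) := by
    intro t
    cases t with
    | zero => exact (funext hz0 : z 0 = fun _ => x₀) ▸ measurable_const
    | succ t => exact (funext (hz t) : z (t + 1) = Z t) ▸ (S.measurable_Z t).mono (S.le t) le_rfl
  simp only [ReachesStationarity, h.gradient_envelope hℓ]
  -- Rounding down leaves no additive constant in the cost, which must vanish when Δ = 0; averaging
  -- over T + 1 points makes up for the rounding. The factor 320 is 4 evaluations times 80.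
  refine ⟨fun t => h.integrable_envelopeGrad_sq hℓ hG.le (hzm t),
    ⌊80 * Δ / (η * ε ^ 2)⌋₊, ?_, ?_, ?_⟩
  all_goals
    have hcost : ((evals ⌊80 * Δ / (η * ε ^ 2)⌋₊ : ℕ) : ℝ)
        ≤ 320 / cx * max (complexity ℓ G D σ ε Δ) (ℓ * (G ^ 2 + σ ^ 2) * Δ / ε ^ 4) := by
      have c1 : ((evals ⌊80 * Δ / (η * ε ^ 2)⌋₊ : ℕ) : ℝ)
          ≤ 4 * (⌊80 * Δ / (η * ε ^ 2)⌋₊ : ℕ) := by exact_mod_cast hev _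
      have c2 : ((⌊80 * Δ / (η * ε ^ 2)⌋₊ : ℕ) : ℝ) ≤ 80 * Δ / (η * ε ^ 2) :=
        Nat.floor_le (by positivity)
      have c3 : 4 * (80 * Δ / (η * ε ^ 2)) = 320 / cx * (Δ / (primalStep ℓ G D σ ε * ε ^ 2)) := by
        rw [hη]; field_simp; ring
      have c4 : Δ / (primalStep ℓ G D σ ε * ε ^ 2)
          ≤ max (complexity ℓ G D σ ε Δ) (ℓ * (G ^ 2 + σ ^ 2) * Δ / ε ^ 4) := by
        rw [hM, hps]
        rcases min_choice (ε ^ 2 / (ℓ * M ^ 2)) (ε ^ 4 / (D ^ 2 * ℓ ^ 3 * G * M * κ)) with h1 | h1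
        · refine le_trans (le_of_eq ?_) (le_max_right _ _)
          rw [h1]; field_simp
        · refine le_trans (le_of_eq ?_) (le_max_left _ _)
          rw [h1, complexity, ← hMdef, ← hκ]; field_simp
      calc _ ≤ 4 * (80 * Δ / (η * ε ^ 2)) := by linarith
        _ ≤ _ := by rw [c3]; gcongr
  · exact hcost
  · intro hreg
    refine hcost.trans (le_of_eq ?_)
    congr 1
    refine max_eq_left ?_
    rw [hM, complexity, ← hMdef, ← hκ]
    have e1 : ℓ * M ^ 2 * Δ / ε ^ 4 = ℓ * M * Δ / ε ^ 6 * (ε ^ 2 * M) := by field_simp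
    have e2 : D ^ 2 * ℓ ^ 3 * G * M * Δ / ε ^ 6 * κ
        = ℓ * M * Δ / ε ^ 6 * (D ^ 2 * ℓ ^ 2 * G * κ) := by field_simp
    rw [e1, e2]
    gcongr
  · intro T hT
    have hT' : 80 * Δ ≤ η * ε ^ 2 * (T + 1) := by
      have c1 := Nat.lt_floor_add_one (80 * Δ / (η * ε ^ 2))
      have c2 : ((⌊80 * Δ / (η * ε ^ 2)⌋₊ : ℕ) : ℝ) ≤ T := by exact_mod_cast hT
      have c3 : 80 * Δ / (η * ε ^ 2) ≤ T + 1 := by linarith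
      rw [div_le_iff₀ (by positivity)] at c3
      linarith
    have hsum : ∑ t ∈ Finset.range (T + 1), ∫ ω, ‖envelopeGrad Y f ℓ (z t ω)‖ ^ 2 ∂P
        ≤ (T + 1) * ε ^ 2 := by
      -- The block argument needs ε² ≤ MG; if ε > G, the bound G on the envelope gradient suffices.
      rcases le_or_gt ε G with hεG | hεG
      · rw [Finset.sum_range_succ']
        simp only [hz, hz0, integral_const, probReal_univ, one_smul]
        rw [add_comm]
        obtain ⟨d1, d2, d3⟩ := dualStep_bounds hℓ hσ hε
        rw [← hκ] at d1
        have hds0 : 0 < dualStep ℓ σ ε := by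
          by_contra! hn
          have : 4 * ℓ * κ * dualStep ℓ σ ε ≤ 0 :=
            mul_nonpos_of_nonneg_of_nonpos (by positivity) hn
          linarith
        refine S.grad_sum_le (κ := κ) (cx := cx) (cy := cy) h hℓ hG hM hM0 hη0
          (by rw [hτ]; positivity) hε hεG hb hcy hcy' hcx hcx' ?_ ?_ ?_ ?_ ?_ hT'
        · have c1 : primalStep ℓ G D σ ε ≤ ε ^ 2 / (ℓ * M ^ 2) := hps ▸ min_le_left _ _
          rw [le_div_iff₀ (by positivity)] at c1
          rw [hη]
          nlinarith [mul_le_mul_of_nonneg_left c1 hcx.le]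
        · have c1 : primalStep ℓ G D σ ε ≤ ε ^ 4 / (D ^ 2 * ℓ ^ 3 * G * M * κ) :=
            hps ▸ min_le_right _ _
          rw [le_div_iff₀ (by positivity)] at c1
          rw [hη, mul_assoc]
          exact mul_le_mul_of_nonneg_left c1 hcx.le
        · rw [hτ]; nlinarith [mul_le_mul_of_nonneg_left d1 hcy.le]
        · rw [hτ]; nlinarith [mul_le_mul_of_nonneg_left d2 hcy.le]
        · rw [hτ]; nlinarith [mul_le_mul_of_nonneg_left d3 hcy.le]
      · have hterm : ∀ t ∈ Finset.range (T + 1),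
            ∫ ω, ‖envelopeGrad Y f ℓ (z t ω)‖ ^ 2 ∂P ≤ ε ^ 2 := by
          intro t _
          calc ∫ ω, ‖envelopeGrad Y f ℓ (z t ω)‖ ^ 2 ∂P ≤ ∫ _, ε ^ 2 ∂P := by
                refine integral_mono (h.integrable_envelopeGrad_sq hℓ hG.le (hzm t))
                  (integrable_const _) fun ω => ?_
                exact pow_le_pow_left₀ (norm_nonneg _)
                  ((h.norm_envelopeGrad_le hℓ hG.le _).trans hεG.le) 2
            _ = ε ^ 2 := by simp
        have := Finset.sum_le_sum hterm
        rw [Finset.sum_const, Finset.card_range, nsmul_eq_mul] at this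
        push_cast at this
        exact this
    rw [one_div, inv_mul_le_iff₀ (by positivity)]
    exact hsum

end IsScheme

end NCC

theorem mainTheorem4 :
    -- absolute constants: all sufficiently small step size factors `cy`, `cx` are allowed
    ∃ cy₀ > (0 : ℝ), ∀ cy : ℝ, 0 < cy → cy ≤ cy₀ →
    ∃ cx₀ > (0 : ℝ), ∀ cx : ℝ, 0 < cx → cx ≤ cx₀ →
    ∃ C > (0 : ℝ),
    ∀ (m n : ℕ) (Y : Set (EuclideanSpace ℝ (Fin n)))
      (f : EuclideanSpace ℝ (Fin m) → EuclideanSpace ℝ (Fin n) → ℝ)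
      (fx : EuclideanSpace ℝ (Fin m) → EuclideanSpace ℝ (Fin n) → EuclideanSpace ℝ (Fin m))
      (fy : EuclideanSpace ℝ (Fin m) → EuclideanSpace ℝ (Fin n) → EuclideanSpace ℝ (Fin n))
      (ℓ G D σ ε : ℝ), 0 < ℓ → 0 < G → 0 < D → 0 ≤ σ → 0 < ε →
    NCC.IsNonconvexConcave Y f fx fy ℓ G D →
    -- the initial gap is finite
    BddBelow (Set.range (NCC.envelope Y f ℓ)) →
    ∀ (Ξx Ξy Ω : Type*) [MeasurableSpace Ξx] [MeasurableSpace Ξy] [MeasurableSpace Ω]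
      (P : Measure Ω) [IsProbabilityMeasure P] (νx : Measure Ξx) (νy : Measure Ξy)
      (ξx : ℕ → Ω → Ξx) (ξy : ℕ → Ω → Ξy)
      (gx : EuclideanSpace ℝ (Fin m) → EuclideanSpace ℝ (Fin n) → Ξx → EuclideanSpace ℝ (Fin m))
      (gy : EuclideanSpace ℝ (Fin m) → EuclideanSpace ℝ (Fin n) → Ξy → EuclideanSpace ℝ (Fin n)),
    NCC.IsUnbiasedOracle Y fx νx gx σ →
    NCC.IsUnbiasedOracle Y fy νy gy σ →
    NCC.IsSampling P νx νy ξx ξy →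
    ∀ (x₀ : EuclideanSpace ℝ (Fin m)), ∀ y₀ ∈ Y,
    Differentiable ℝ (NCC.envelope Y f ℓ) ∧
    -- stochastic OGDA, iterates `x_t`
    NCC.ReachesStationarity P (NCC.envelope Y f ℓ)
      (fun t ω => (NCC.ogda Y gx gy (cx * NCC.primalStep ℓ G D σ ε) (cy * NCC.dualStep ℓ σ ε)
        x₀ y₀ (fun k => ξx k ω) (fun k => ξy k ω) t).x)
      NCC.ogdaEvals C ℓ G D σ ε (NCC.initialGap Y f ℓ x₀) ∧
    -- stochastic EG, mid-points `x_{t-1/2}`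
    NCC.ReachesStationarity P (NCC.envelope Y f ℓ)
      (fun t ω => NCC.egMid Y gx gy (cx * NCC.primalStep ℓ G D σ ε) (cy * NCC.dualStep ℓ σ ε)
        x₀ y₀ (fun k => ξx k ω) (fun k => ξy k ω) t)
      NCC.egEvals C ℓ G D σ ε (NCC.initialGap Y f ℓ x₀) := by
  refine ⟨1 / 20000, by norm_num, fun cy hcy hcy' => ⟨cy / 62914560, by positivity,
    fun cx hcx hcx' => ⟨320 / cx, by positivity, ?_⟩⟩⟩
  intro m n Y f fx fy ℓ G D σ ε hℓ hG hD hσ hε h hb Ξx Ξy Ω _ _ _ P _ νx νy ξx ξy gx gy hgx hgy hs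
    x₀ y₀ hy₀
  have hM : G ^ 2 + σ ^ 2 = √(G ^ 2 + σ ^ 2) ^ 2 := (Real.sq_sqrt (by positivity)).symm
  obtain ⟨d1, d2, -⟩ := NCC.dualStep_bounds hℓ hσ hε
  have hds0 : 0 < NCC.dualStep ℓ σ ε := by
    by_contra! hn
    have : 4 * ℓ * max 1 (σ ^ 2 / ε ^ 2) * NCC.dualStep ℓ σ ε ≤ 0 :=
      mul_nonpos_of_nonneg_of_nonpos (by positivity) hn
    linarith
  have hτ : 0 < cy * NCC.dualStep ℓ σ ε := by positivity
  have hτℓ : 12 * ((cy * NCC.dualStep ℓ σ ε) ^ 2 * ℓ ^ 2) ≤ 1 := by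
    have c1 : 4 * (cy * NCC.dualStep ℓ σ ε * ℓ) ≤ 1 := by nlinarith
    have c2 : 0 ≤ cy * NCC.dualStep ℓ σ ε * ℓ := by positivity
    nlinarith
  refine ⟨h.differentiable_envelope hℓ, ?_, ?_⟩
  · refine NCC.IsScheme.reachesStationarity h hℓ hG hD hσ hε hb hcy hcy' hcx hcx' rfl rfl
      (NCC.isScheme_ogda hs h hG.le hgx hgy hy₀ hM hτ hτℓ) (fun _ => rfl) (fun _ _ => rfl)
      fun T => ?_
    unfold NCC.ogdaEvals
    -- The bound 2(T + 1) ≤ 4T holds for T ≥ 1, and at T = 0 nothing is evaluated.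
    split_ifs <;> omega
  · exact NCC.IsScheme.reachesStationarity h hℓ hG hD hσ hε hb hcy hcy' hcx hcx' rfl rfl
      (NCC.isScheme_eg hs h hG.le hgx hgy hy₀ hM hτ hτℓ) (fun _ => rfl) (fun _ _ => rfl)
      fun _ => le_rfl
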